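/- For $0<b_j\le a_j$ ($j=1,2$) let $\Omega_j=\{(x,y)\in\mathbb R^2:\ x^2/a_j^2+y^2/b_j^2=1\}$, an ellipse (possibly a circle) with eccentricity $\mathbf e_j=\sqrt{1-(b_j/a_j)^2}$. Let $f_j:\Omega_j\times[0,\pi]\to\Omega_j\times[0,\pi]$ be its billiard map: $f_j(x,\theta)=(x',\theta')$, where $x'$ is the point at which the straight trajectory, starting at $x$ with velocity making the angle $\theta$ with the counterclockwise tangent at $x$ and pointing inwards, hits $\Omega_j$ again, and $\theta'$ is the angle between the elastically reflected velocity and the counterclockwise tangent at $x'$; for $\theta\in\{0,\pi\}$ one sets $f_j(x,\theta)=(x,\theta)$. Put $p_j^*=(a_j\cos\arctan(1-\mathbf e_j^2),\,-b_j\sin\arctan(1-\mathbf e_j^2))$ and $\Omega_j^*=\Omega_j\setminus\{p_j^*,-p_j^*\}$. Then: (i) There are $\theta_1^*,\theta_2^*>0$, relatively open sets $U_j$ with $\Omega_j\times[0,\theta_j^*)\subseteq U_j\subseteq\Omega_j\times[0,\pi)$ and a homeomorphism $h:U_1\to U_2$ such that $f_1(U_1)\subseteq U_1$ and $h\circ f_1=f_2\circ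 h$ on $U_1$, and $h$ maps $\Omega_1\times\{0\}$ onto $\Omega_2\times\{0\}$. In particular $f_1$ and $f_2$ are $C^0$-conjugate near their respective boundaries. Moreover, $h$ restricts to a $C^\infty$-diffeomorphism from $U_1\cap(\Omega_1^*\times(0,\pi))$ onto $U_2\cap(\Omega_2^*\times(0,\pi))$. (ii) If $f_1$ and $f_2$ are globally $C^0$-conjugate, i.e. there is a homeomorphism $h:\Omega_1\times(0,\pi)\to\Omega_2\times(0,\pi)$ with $h\circ f_1=f_2\circ h$, then $\Omega_1$ and $\Omega_2$ are similar (a similarity transformation of the plane maps $\Omega_1$ onto $\Omega_2$), and $\mathbf e_1=\mathbf e_2$. -/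

import Mathlib

open scoped ContDiff

/-- The Euclidean plane. -/
abbrev Plane : Type := EuclideanSpace ℝ (Fin 2)

/-- The semi-axes `0 < b ≤ a` of an ellipse in standard position (circles are allowed). -/
structure Ellipse where
  a : ℝ
  b : ℝ
  b_pos : 0 < b
  b_le_a : b ≤ a

namespace Ellipse

variable (E : Ellipse)

/-- The ellipse `x² / a² + y² / b² = 1`, as a curve in the plane. -/
def curve : Set Plane := {x | x 0 ^ 2 / E.a ^ 2 + x 1 ^ 2 / E.b ^ 2 = 1}

/-- The eccentricity. -/
noncomputable def ecc : ℝ := Real.sqrt (1 - (E.b / E.a) ^ 2)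

/-- An outward normal vector (half the gradient of the defining function). -/
noncomputable def grad (x : Plane) : Plane := !₂[x 0 / E.a ^ 2, x 1 / E.b ^ 2]

/-- The inward unit normal at a point of the ellipse. -/
noncomputable def normal (x : Plane) : Plane := (-‖E.grad x‖⁻¹) • E.grad x

/-- The positively oriented (counterclockwise) unit tangent at a point of the ellipse. -/
noncomputable def tangent (x : Plane) : Plane :=
  ‖E.grad x‖⁻¹ • !₂[-(x 1 / E.b ^ 2), x 0 / E.a ^ 2]

/-- The unit vector at `x` that makes the angle `θ` with the positive tangent; it points inside
the ellipse when `0 < θ < π`. -/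
noncomputable def velocity (x : Plane) (θ : ℝ) : Plane :=
  Real.cos θ • E.tangent x + Real.sin θ • E.normal x

/-- For `x` on the ellipse and `v ≠ 0`, this is the second root `t` of the quadratic equation
saying that `x + t v` is on the ellipse (the first one is `t = 0`). -/
noncomputable def hitTime (x v : Plane) : ℝ :=
  -2 * (x 0 * v 0 / E.a ^ 2 + x 1 * v 1 / E.b ^ 2) / (v 0 ^ 2 / E.a ^ 2 + v 1 ^ 2 / E.b ^ 2)

/-- The point where the line through `x` with direction `v` meets the ellipse again
(it is `x` itself when `v` is tangent at `x`). -/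
noncomputable def hitPoint (x v : Plane) : Plane := x + E.hitTime x v • v

/-- Elastic reflection of the velocity `v` at the point `y` of the ellipse. -/
noncomputable def reflect (y v : Plane) : Plane := v - (2 * inner ℝ v (E.normal y)) • E.normal y

theorem a_pos : 0 < E.a := lt_of_lt_of_le E.b_pos E.b_le_a

theorem hitPoint_mem {x : Plane} (hx : x ∈ E.curve) (v : Plane) : E.hitPoint x v ∈ E.curve := by
  have ha := E.a_pos
  have hb := E.b_pos
  simp only [curve, Set.mem_ofPred_eq] at hx ⊢
  simp only [hitPoint, PiLp.add_apply, PiLp.smul_apply, smul_eq_mul]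
  set t := E.hitTime x v with ht
  have key : t * (t * (v 0 ^ 2 / E.a ^ 2 + v 1 ^ 2 / E.b ^ 2)
      + 2 * (x 0 * v 0 / E.a ^ 2 + x 1 * v 1 / E.b ^ 2)) = 0 := by
    by_cases hq : v 0 ^ 2 / E.a ^ 2 + v 1 ^ 2 / E.b ^ 2 = 0
    · have : t = 0 := by rw [ht, hitTime, hq, div_zero]
      rw [this, zero_mul]
    · have : t * (v 0 ^ 2 / E.a ^ 2 + v 1 ^ 2 / E.b ^ 2)
          = -2 * (x 0 * v 0 / E.a ^ 2 + x 1 * v 1 / E.b ^ 2) := by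
        rw [ht, hitTime, div_mul_cancel₀ _ hq]
      rw [this]; ring
  calc _ = (x 0 ^ 2 / E.a ^ 2 + x 1 ^ 2 / E.b ^ 2)
        + t * (t * (v 0 ^ 2 / E.a ^ 2 + v 1 ^ 2 / E.b ^ 2)
          + 2 * (x 0 * v 0 / E.a ^ 2 + x 1 * v 1 / E.b ^ 2)) := by ring
    _ = 1 := by rw [key, hx, add_zero]

/-- The closed phase cylinder `Ω × [0, π]`: a foot point on the ellipse and the angle between the
velocity and the positive tangent there. -/
abbrev Phase : Type := E.curve × Set.Icc (0 : ℝ) Real.pi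

/-- The billiard map `(x, θ) ↦ (x', θ')` of the ellipse: `x'` is the point where the trajectory
from `x` with velocity at angle `θ` hits the ellipse again, and `θ'` is the angle between the
reflected velocity and the positive tangent at `x'`. For `θ = 0` and `θ = π` it is the identity. -/
noncomputable def billiard (p : E.Phase) : E.Phase :=
  let v := E.velocity p.1 p.2
  let y := E.hitPoint p.1 v
  (⟨y, E.hitPoint_mem p.1.2 v⟩,
    ⟨InnerProductGeometry.angle (E.reflect y v) (E.tangent y),
      InnerProductGeometry.angle_nonneg _ _, InnerProductGeometry.angle_le_pi _ _⟩)

/-- The open phase cylinder `Ω × (0, π)`. -/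
def openPhase : Set E.Phase := {p | 0 < (p.2 : ℝ) ∧ (p.2 : ℝ) < Real.pi}

/-- The strip `Ω × [0, τ)`. -/
def strip (τ : ℝ) : Set E.Phase := {p | (p.2 : ℝ) < τ}

/-- The point `p* = (a cos (arctan (1 - e²)), - b sin (arctan (1 - e²)))` of the ellipse. -/
noncomputable def specialPoint : Plane :=
  !₂[E.a * Real.cos (Real.arctan (1 - E.ecc ^ 2)), -(E.b * Real.sin (Real.arctan (1 - E.ecc ^ 2)))]

/-- `Ω* × (0, π)`, where `Ω* = Ω \ {p*, -p*}`. -/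
def puncturedPhase : Set E.Phase :=
  {p | p ∈ E.openPhase ∧ (p.1 : Plane) ≠ E.specialPoint ∧ (p.1 : Plane) ≠ -E.specialPoint}

theorem param_mem (φ : ℝ) : !₂[E.a * Real.cos φ, E.b * Real.sin φ] ∈ E.curve := by
  have ha := E.a_pos.ne'
  have hb := E.b_pos.ne'
  simp only [curve, Set.mem_ofPred_eq]
  simp [mul_pow, ha, hb]

/-- The parametrization `(φ, θ) ↦ ((a cos φ, b sin φ), θ)` of the phase cylinder
(`θ` is clamped to `[0, π]`). -/
noncomputable def param (q : ℝ × ℝ) : E.Phase :=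
  (⟨!₂[E.a * Real.cos q.1, E.b * Real.sin q.1], E.param_mem q.1⟩,
    Set.projIcc 0 Real.pi Real.pi_pos.le q.2)

/-- `h` is `C^∞` on the subset `W` of the open phase cylinder: read in the coordinates `(φ, θ)` of
the source and in the ambient space `ℝ² × ℝ` of the target, it is `C^∞`. -/
def SmoothOn {E E' : Ellipse} (h : E.Phase → E'.Phase) (W : Set E.Phase) : Prop :=
  ContDiffOn ℝ ∞ (fun q : ℝ × ℝ => (((h (E.param q)).1 : Plane), ((h (E.param q)).2 : ℝ)))
    {q | q.2 ∈ Set.Ioo 0 Real.pi ∧ E.param q ∈ W}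

/-- Two ellipses are similar: a similarity transformation of the plane maps one onto the other. -/
def Similar (E E' : Ellipse) : Prop := ∃ Φ : Plane ≃ᵈ Plane, Φ '' E.curve = E'.curve

end Ellipse

/-!
The billiard map of an ellipse is integrable. In the parametrization `φ ↦ (a cos φ, b sin φ)` of
speed `√D`, where `D = a² sin² φ + b² cos² φ`, the level `√D sin θ` is conserved. A chord with end
parameters `σ ± δ` has tangential momenta `√D cos θ` at its ends that are explicit trigonometric
functions of `σ` and `δ` (`billiard_chord`), and its level is `m = a b sin δ / √(D σ)`. For `m < b`
the integral of the density `1 / √(D - m²)` over the chord does not depend on `σ`, because its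
derivative in `σ` vanishes (`angleInt_chord`, Euler's addition theorem). Hence on every level below
`b` the map is a rotation in the angle coordinate `normAngle` (`billiard_rotCurve`).

**Boundary conjugacy.** The angle coordinate depends smoothly on the level, and the rotation number
has non-zero derivative at the boundary level `0` (`exists_hasDerivAt_rotNum_zero`), so it is a
smooth coordinate on the levels near `0`. The conjugacy maps the level `m` of the first ellipse to
the level of the second one with the same rotation number and, in the angle coordinates, it is the
translation that takes `p*` to `p*`. By central symmetry `-p*` is half a period away from `p*` on
every level, so `-p*` goes to `-p*` too. Smoothness for `θ > 0` follows from that of the angle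
coordinate and of its inverse (`contDiffAt_normAngleInv`, an inverse function theorem); the
argument is confined to `θ > 0` because `θ` is recovered from its cosine.

**Global conjugacy.** A trajectory of level `m > b` crosses the major axis between the foci on every
chord, and the map exchanges the two halves of the ellipse. Up to the reflection in the major axis,
the step on this level is the step on the level `b` of the ellipse with semi-axes `a` and `m`
(`billiard_libPt`), to which the addition theorem applies again. So the square of the map is, over
either half, a rotation by a number `libRot m`, which decreases strictly in `m` (`libRot_lt`) to
`(2 / π) arcsin (b / a)` on the level `m = a` of the two-periodic orbit along the minor axis.

The points with irrational rotation number are dense on these levels. A global conjugacy cannot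
send such a point below the level `b`: there the image of an aperiodic point is a limit of its
orbit under the square of the map, while above `b` the map exchanges the two halves
(`not_lt_of_irrational`). So the levels above `b` go to levels above `b`; in particular a circle,
which has none, is conjugate only to circles. On the closure of an orbit the conjugacy
intertwines two irrational rotations of the circle, whose rotation numbers agree up to sign
(`Real.Angle.rotation_eq_or_eq_neg`). At the two-periodic orbit the limits of the rotation numbers
therefore agree or add up to `1`; in the second case the rotation numbers nearby would add up
to `1` although both exceed their limits (`libRot_a_eq`). Thus `b / a` is an invariant of the
conjugacy.
-/

namespace Ellipse

variable (E : Ellipse)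

/-! ### Chords -/

/-- The squared speed `a² sin² φ + b² cos² φ` of the parametrization `φ ↦ (a cos φ, b sin φ)`. -/
noncomputable def speedSq (φ : ℝ) : ℝ := E.b ^ 2 + (E.a ^ 2 - E.b ^ 2) * Real.sin φ ^ 2

theorem b_sq_le_a_sq : E.b ^ 2 ≤ E.a ^ 2 := pow_le_pow_left₀ E.b_pos.le E.b_le_a 2

theorem b_sq_le_speedSq (φ : ℝ) : E.b ^ 2 ≤ E.speedSq φ := by
  have := E.b_sq_le_a_sq
  unfold speedSq
  nlinarith [mul_nonneg (sub_nonneg.2 this) (sq_nonneg (Real.sin φ))]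

theorem speedSq_eq_sub_cos (φ : ℝ) :
    E.speedSq φ = E.a ^ 2 - (E.a ^ 2 - E.b ^ 2) * Real.cos φ ^ 2 := by
  rw [speedSq, Real.sin_sq]; ring

theorem speedSq_le_a_sq (φ : ℝ) : E.speedSq φ ≤ E.a ^ 2 := by
  have := E.b_sq_le_a_sq
  rw [speedSq_eq_sub_cos]
  nlinarith [mul_nonneg (sub_nonneg.2 this) (sq_nonneg (Real.cos φ))]

theorem speedSq_pos (φ : ℝ) : 0 < E.speedSq φ :=
  lt_of_lt_of_le (pow_pos E.b_pos 2) (E.b_sq_le_speedSq φ)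

theorem sqrt_speedSq_pos (φ : ℝ) : 0 < √(E.speedSq φ) := Real.sqrt_pos.2 (E.speedSq_pos φ)

theorem sq_sqrt_speedSq (φ : ℝ) : √(E.speedSq φ) ^ 2 = E.speedSq φ :=
  Real.sq_sqrt (E.speedSq_pos φ).le

@[simp] theorem speedSq_neg (φ : ℝ) : E.speedSq (-φ) = E.speedSq φ := by simp [speedSq]

@[simp] theorem speedSq_add_pi (φ : ℝ) : E.speedSq (φ + Real.pi) = E.speedSq φ := by
  simp [speedSq, Real.sin_add_pi]

@[simp] theorem speedSq_add_two_pi (φ : ℝ) : E.speedSq (φ + 2 * Real.pi) = E.speedSq φ := by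
  simp [speedSq]

theorem contDiff_speedSq : ContDiff ℝ ∞ E.speedSq := by
  unfold speedSq; fun_prop

theorem continuous_speedSq : Continuous E.speedSq := E.contDiff_speedSq.continuous

/-- The tangential momentum `√D cos θ` at the end `σ + δ` of the chord that joins the points of
parameters `σ - δ` and `σ + δ`; at the start of the chord it is `chordMom σ (-δ)`. -/
noncomputable def chordMom (σ δ : ℝ) : ℝ :=
  (Real.cos δ * E.speedSq σ + Real.sin δ * ((E.a ^ 2 - E.b ^ 2) * (Real.sin σ * Real.cos σ))) /
    √(E.speedSq σ)

theorem chordMom_sq (σ δ : ℝ) :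
    E.chordMom σ δ ^ 2 = E.speedSq (σ + δ) - E.a ^ 2 * E.b ^ 2 * Real.sin δ ^ 2 / E.speedSq σ := by
  have h := E.speedSq_pos σ
  rw [chordMom, div_pow, sq_sqrt_speedSq, eq_sub_iff_add_eq, ← add_div, div_eq_iff h.ne']
  simp only [speedSq, Real.sin_add]
  have h1 := Real.sin_sq_add_cos_sq σ
  have h2 := Real.sin_sq_add_cos_sq δ
  set s := Real.sin σ
  set c := Real.cos σ
  set u := Real.sin δ
  set v := Real.cos δ
  have hc : c ^ 2 = 1 - s ^ 2 := by linarith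
  have hv : v ^ 2 = 1 - u ^ 2 := by linarith
  generalize E.a ^ 2 = A
  generalize E.b ^ 2 = B
  have e1 : (s * v + c * u) ^ 2 = s ^ 2 * v ^ 2 + c ^ 2 * u ^ 2 + 2 * (s * v * c * u) := by ring
  have e2 : (v * (B + (A - B) * s ^ 2) + u * ((A - B) * (s * c))) ^ 2 =
      v ^ 2 * (B + (A - B) * s ^ 2) ^ 2 + u ^ 2 * (A - B) ^ 2 * s ^ 2 * c ^ 2
      + 2 * (s * v * c * u) * (A - B) * (B + (A - B) * s ^ 2) := by ring
  rw [e1, e2, hc, hv]; ring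

/-- The point of the phase cylinder with foot point `(a cos φ, b sin φ)` and tangential momentum
`p`, that is, with angle `θ` determined by `√D cos θ = p`. -/
noncomputable def phasePt (φ p : ℝ) : E.Phase := E.param (φ, Real.arccos (p / √(E.speedSq φ)))

theorem projIcc_angle {θ : ℝ} (h : θ ∈ Set.Icc (0 : ℝ) Real.pi) :
    ((Set.projIcc 0 Real.pi Real.pi_pos.le θ : Set.Icc (0 : ℝ) Real.pi) : ℝ) = θ := by
  rw [Set.projIcc_of_mem _ h]

theorem phasePt_fst (φ p : ℝ) :
    ((E.phasePt φ p).1 : Plane) = !₂[E.a * Real.cos φ, E.b * Real.sin φ] := rfl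

theorem phasePt_snd (φ p : ℝ) : ((E.phasePt φ p).2 : ℝ) = Real.arccos (p / √(E.speedSq φ)) :=
  projIcc_angle ⟨Real.arccos_nonneg _, Real.arccos_le_pi _⟩

theorem param_snd {φ θ : ℝ} (h : θ ∈ Set.Icc (0 : ℝ) Real.pi) :
    ((E.param (φ, θ)).2 : ℝ) = θ := projIcc_angle h

theorem norm_grad (φ : ℝ) :
    ‖E.grad !₂[E.a * Real.cos φ, E.b * Real.sin φ]‖ = √(E.speedSq φ) / (E.a * E.b) := by
  have ha := E.a_pos
  have hb := E.b_pos
  rw [EuclideanSpace.norm_eq, ← Real.sqrt_sq (mul_pos ha hb).le,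
    ← Real.sqrt_div' _ (sq_nonneg _)]
  congr 1
  simp only [grad, Fin.sum_univ_two, Real.norm_eq_abs, sq_abs, speedSq]
  simp
  have h1 := Real.sin_sq_add_cos_sq φ
  have hc : Real.cos φ ^ 2 = 1 - Real.sin φ ^ 2 := by linarith
  field_simp
  rw [hc]; ring

theorem tangent_param (φ : ℝ) : E.tangent !₂[E.a * Real.cos φ, E.b * Real.sin φ] =
    !₂[-(E.a * Real.sin φ) / √(E.speedSq φ), E.b * Real.cos φ / √(E.speedSq φ)] := by
  have ha := E.a_pos
  have hb := E.b_pos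
  have h := E.sqrt_speedSq_pos φ
  ext i
  fin_cases i <;> simp [tangent, norm_grad] <;> field_simp

theorem normal_param (φ : ℝ) : E.normal !₂[E.a * Real.cos φ, E.b * Real.sin φ] =
    !₂[-(E.b * Real.cos φ) / √(E.speedSq φ), -(E.a * Real.sin φ) / √(E.speedSq φ)] := by
  have ha := E.a_pos
  have hb := E.b_pos
  have h := E.sqrt_speedSq_pos φ
  ext i
  fin_cases i <;> simp only [normal, norm_grad] <;> simp [grad] <;> field_simp

theorem chordMom_abs_le (σ δ : ℝ) : |E.chordMom σ δ / √(E.speedSq (σ + δ))| ≤ 1 := by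
  rw [abs_div, abs_of_pos (E.sqrt_speedSq_pos _), div_le_one (E.sqrt_speedSq_pos _)]
  apply Real.abs_le_sqrt
  rw [chordMom_sq]
  have : 0 ≤ E.a ^ 2 * E.b ^ 2 * Real.sin δ ^ 2 / E.speedSq σ :=
    div_nonneg (by positivity) (E.speedSq_pos _).le
  linarith

theorem cos_arccos_chordMom (σ δ : ℝ) :
    Real.cos (Real.arccos (E.chordMom σ δ / √(E.speedSq (σ + δ)))) =
      E.chordMom σ δ / √(E.speedSq (σ + δ)) :=
  Real.cos_arccos (abs_le.1 (E.chordMom_abs_le σ δ)).1 (abs_le.1 (E.chordMom_abs_le σ δ)).2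

theorem sin_arccos_chordMom (σ δ : ℝ) :
    Real.sin (Real.arccos (E.chordMom σ δ / √(E.speedSq (σ + δ)))) =
      E.a * E.b * |Real.sin δ| / (√(E.speedSq σ) * √(E.speedSq (σ + δ))) := by
  have ha := E.a_pos
  have hb := E.b_pos
  have h1 := E.sqrt_speedSq_pos σ
  have h2 := E.sqrt_speedSq_pos (σ + δ)
  have h3 := E.speedSq_pos σ
  have h4 := E.speedSq_pos (σ + δ)
  have h5 : 0 ≤ E.a * E.b * |Real.sin δ| / (√(E.speedSq σ) * √(E.speedSq (σ + δ))) := by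
    positivity
  rw [Real.sin_arccos, ← Real.sqrt_sq h5]
  congr 1
  rw [div_pow, div_pow, chordMom_sq, mul_pow, mul_pow, mul_pow, sq_abs, sq_sqrt_speedSq,
    sq_sqrt_speedSq]
  field_simp
  ring

/-- The momentum `chordMom σ (-δ)` belongs to the direction of the chord, which is that of the
tangent at its mean parameter. -/
theorem velocity_chord {σ δ : ℝ} (hδ : 0 ≤ Real.sin δ) :
    E.velocity !₂[E.a * Real.cos (σ - δ), E.b * Real.sin (σ - δ)]
      (Real.arccos (E.chordMom σ (-δ) / √(E.speedSq (σ - δ)))) =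
    !₂[-(E.a * Real.sin σ) / √(E.speedSq σ), E.b * Real.cos σ / √(E.speedSq σ)] := by
  have h1 := E.sqrt_speedSq_pos σ
  have h2 := E.sqrt_speedSq_pos (σ - δ)
  have h3 := E.speedSq_pos σ
  have h4 := E.speedSq_pos (σ - δ)
  have hc := E.cos_arccos_chordMom σ (-δ)
  have hs := E.sin_arccos_chordMom σ (-δ)
  rw [← sub_eq_add_neg] at hc hs
  rw [velocity, hc, hs, tangent_param, normal_param, Real.sin_neg, abs_neg, abs_of_nonneg hδ,
    chordMom, Real.sin_neg, Real.cos_neg]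
  have e1 := E.sq_sqrt_speedSq (σ - δ)
  have hσ := Real.sin_sq_add_cos_sq σ
  have hd := Real.sin_sq_add_cos_sq δ
  have key : E.speedSq (σ - δ) =
      E.b ^ 2 + (E.a ^ 2 - E.b ^ 2) *
        (Real.sin σ * Real.cos δ - Real.cos σ * Real.sin δ) ^ 2 := by
    rw [speedSq, Real.sin_sub]
  ext i
  fin_cases i
  · simp
    field_simp
    rw [e1, key, Real.sin_sub, Real.cos_sub, speedSq]
    linear_combination (-(E.a * E.b ^ 2 * Real.sin σ)) * hd
  · simp
    field_simp
    rw [e1, key, Real.sin_sub, Real.cos_sub, speedSq]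
    linear_combination (E.b * Real.cos δ * E.a ^ 2 * Real.sin σ * Real.sin δ -
      E.b * E.a ^ 2 * Real.sin δ ^ 2 * Real.cos σ - E.b ^ 3 * Real.cos δ * Real.sin σ * Real.sin δ
      + E.b ^ 3 * Real.sin δ ^ 2 * Real.cos σ) * hσ + E.b ^ 3 * Real.cos σ * hd

theorem hitPoint_chord (σ δ : ℝ) :
    E.hitPoint !₂[E.a * Real.cos (σ - δ), E.b * Real.sin (σ - δ)]
      !₂[-(E.a * Real.sin σ) / √(E.speedSq σ), E.b * Real.cos σ / √(E.speedSq σ)] =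
    !₂[E.a * Real.cos (σ + δ), E.b * Real.sin (σ + δ)] := by
  have ha := E.a_pos
  have hb := E.b_pos
  have h1 := E.sqrt_speedSq_pos σ
  have hσ := Real.sin_sq_add_cos_sq σ
  have ht : E.hitTime !₂[E.a * Real.cos (σ - δ), E.b * Real.sin (σ - δ)]
      !₂[-(E.a * Real.sin σ) / √(E.speedSq σ), E.b * Real.cos σ / √(E.speedSq σ)] =
      2 * Real.sin δ * √(E.speedSq σ) := by
    simp only [hitTime]
    simp
    have e : (-(E.a * Real.sin σ) / √(E.speedSq σ)) ^ 2 / E.a ^ 2 +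
        (E.b * Real.cos σ / √(E.speedSq σ)) ^ 2 / E.b ^ 2 = 1 / √(E.speedSq σ) ^ 2 := by
      field_simp; exact hσ
    rw [e, Real.sin_sub, Real.cos_sub]
    field_simp
    linear_combination Real.sin δ * hσ
  rw [hitPoint, ht]
  ext i
  fin_cases i
  · simp
    field_simp
    rw [Real.cos_sub, Real.cos_add]; ring
  · simp
    field_simp
    rw [Real.sin_sub, Real.sin_add]; ring

theorem inner_tangent_chord (σ δ : ℝ) :
    inner ℝ (!₂[-(E.a * Real.sin σ) / √(E.speedSq σ), E.b * Real.cos σ / √(E.speedSq σ)] : Plane)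
      (E.tangent !₂[E.a * Real.cos (σ + δ), E.b * Real.sin (σ + δ)]) =
    E.chordMom σ δ / √(E.speedSq (σ + δ)) := by
  have h1 := E.sqrt_speedSq_pos σ
  have h2 := E.sqrt_speedSq_pos (σ + δ)
  have hσ := Real.sin_sq_add_cos_sq σ
  rw [tangent_param, PiLp.inner_apply, Fin.sum_univ_two, chordMom]
  simp
  field_simp
  rw [Real.sin_add, Real.cos_add, speedSq]
  linear_combination (E.b ^ 2 * Real.cos δ) * hσ

theorem norm_tangent_param (φ : ℝ) :
    ‖E.tangent !₂[E.a * Real.cos φ, E.b * Real.sin φ]‖ = 1 := by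
  have h1 := E.sqrt_speedSq_pos φ
  rw [tangent_param, EuclideanSpace.norm_eq, Real.sqrt_eq_one]
  simp [Fin.sum_univ_two, div_pow, sq_sqrt_speedSq]
  have h3 := E.speedSq_pos φ
  have hσ := Real.cos_sq' φ
  field_simp
  rw [speedSq, hσ]; ring

theorem norm_normal_param (φ : ℝ) :
    ‖E.normal !₂[E.a * Real.cos φ, E.b * Real.sin φ]‖ = 1 := by
  have h1 := E.sqrt_speedSq_pos φ
  rw [normal_param, EuclideanSpace.norm_eq, Real.sqrt_eq_one]
  simp [Fin.sum_univ_two, div_pow, sq_sqrt_speedSq]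
  have h3 := E.speedSq_pos φ
  have hσ := Real.cos_sq' φ
  field_simp
  rw [speedSq, hσ]; ring

theorem inner_normal_tangent_param (φ : ℝ) :
    inner ℝ (E.normal !₂[E.a * Real.cos φ, E.b * Real.sin φ])
      (E.tangent !₂[E.a * Real.cos φ, E.b * Real.sin φ]) = 0 := by
  rw [normal_param, tangent_param, PiLp.inner_apply, Fin.sum_univ_two]
  simp
  ring

theorem norm_reflect (φ : ℝ) (v : Plane) :
    ‖E.reflect !₂[E.a * Real.cos φ, E.b * Real.sin φ] v‖ = ‖v‖ := by
  have h := E.norm_normal_param φ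
  rw [reflect]
  generalize E.normal !₂[E.a * Real.cos φ, E.b * Real.sin φ] = n at h
  rw [← sq_eq_sq₀ (norm_nonneg _) (norm_nonneg _), norm_sub_sq_real, inner_smul_right, norm_smul,
    mul_pow, h, Real.norm_eq_abs, sq_abs]
  ring

/-- The billiard map follows chords. -/
theorem billiard_chord {σ δ : ℝ} (hδ : 0 ≤ Real.sin δ) :
    E.billiard (E.phasePt (σ - δ) (E.chordMom σ (-δ))) = E.phasePt (σ + δ) (E.chordMom σ δ) := by
  have hv := E.velocity_chord (σ := σ) hδ
  have hy := E.hitPoint_chord σ δ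
  have ht := E.tangent_param σ
  have e1 : ((E.phasePt (σ - δ) (E.chordMom σ (-δ))).2 : ℝ) = _ := E.phasePt_snd _ _
  ext1
  · apply Subtype.ext
    simp only [billiard]
    rw [e1, phasePt_fst, phasePt_fst, hv, hy]
  · apply Subtype.ext
    simp only [billiard]
    rw [e1, phasePt_fst, phasePt_snd, hv, hy, InnerProductGeometry.angle, norm_reflect,
      norm_tangent_param, ← ht, norm_tangent_param, reflect, inner_sub_left, inner_smul_left,
      inner_normal_tangent_param, ht, inner_tangent_chord]
    simp

end Ellipse

namespace Ellipse

variable (E : Ellipse)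

/-! ### The invariant density on a level of the Joachimsthal integral -/

/-- The density `1 / √(D - m²)` (in the parameter `φ`) of the measure on the level `m` of the
conserved quantity `√D sin θ` which the billiard map leaves invariant. -/
noncomputable def density (m s : ℝ) : ℝ := 1 / √(E.speedSq s - m ^ 2)

/-- The primitive of the invariant density. -/
noncomputable def angleInt (m φ : ℝ) : ℝ := ∫ s in (0 : ℝ)..φ, E.density m s

variable {E} {m : ℝ}

theorem sub_sq_pos (hm : m ^ 2 < E.b ^ 2) (s : ℝ) : 0 < E.speedSq s - m ^ 2 := by
  linarith [E.b_sq_le_speedSq s]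

theorem density_pos (hm : m ^ 2 < E.b ^ 2) (s : ℝ) : 0 < E.density m s :=
  one_div_pos.2 (Real.sqrt_pos.2 (sub_sq_pos hm s))

theorem continuous_density (hm : m ^ 2 < E.b ^ 2) : Continuous (E.density m) := by
  unfold density
  refine continuous_const.div ?_ fun s => (Real.sqrt_pos.2 (sub_sq_pos hm s)).ne'
  exact (E.continuous_speedSq.sub continuous_const).sqrt

theorem density_neg (s : ℝ) : E.density m (-s) = E.density m s := by simp [density]

theorem density_periodic : Function.Periodic (E.density m) Real.pi := fun s => by simp [density]

theorem hasDerivAt_angleInt (hm : m ^ 2 < E.b ^ 2) (φ : ℝ) :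
    HasDerivAt (E.angleInt m) (E.density m φ) φ :=
  (continuous_density hm).integral_hasStrictDerivAt 0 φ |>.hasDerivAt

theorem continuous_angleInt (hm : m ^ 2 < E.b ^ 2) : Continuous (E.angleInt m) :=
  continuous_iff_continuousAt.2 fun φ => (hasDerivAt_angleInt hm φ).continuousAt

theorem angleInt_strictMono (hm : m ^ 2 < E.b ^ 2) : StrictMono (E.angleInt m) :=
  strictMono_of_hasDerivAt_pos (fun φ => hasDerivAt_angleInt hm φ) fun φ => density_pos hm φ

theorem angleInt_zero : E.angleInt m 0 = 0 := by simp [angleInt]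

theorem angleInt_add_pi (hm : m ^ 2 < E.b ^ 2) (φ : ℝ) :
    E.angleInt m (φ + Real.pi) = E.angleInt m φ + E.angleInt m Real.pi := by
  have hi : ∀ x y, IntervalIntegrable (E.density m) MeasureTheory.volume x y :=
    fun x y => (continuous_density hm).intervalIntegrable x y
  unfold angleInt
  rw [← intervalIntegral.integral_add_adjacent_intervals (hi 0 φ) (hi φ _),
    density_periodic.intervalIntegral_add_eq φ 0, zero_add]

theorem angleInt_neg (φ : ℝ) : E.angleInt m (-φ) = -E.angleInt m φ := by
  unfold angleInt
  have h := intervalIntegral.integral_comp_neg (a := 0) (b := φ) (E.density m)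
  simp only [density_neg, neg_zero] at h
  rw [h, intervalIntegral.integral_symm]

theorem angleInt_pi_pos (hm : m ^ 2 < E.b ^ 2) : 0 < E.angleInt m Real.pi := by
  rw [← angleInt_zero (E := E) (m := m)]
  exact angleInt_strictMono hm Real.pi_pos

theorem angleInt_pi (hm : m ^ 2 < E.b ^ 2) :
    E.angleInt m Real.pi = 2 * E.angleInt m (Real.pi / 2) := by
  have h := angleInt_add_pi hm (-(Real.pi / 2))
  rw [angleInt_neg, show -(Real.pi / 2) + Real.pi = Real.pi / 2 by ring] at h
  linarith

variable (E m) in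
/-- The angle coordinate on the level `m` in which the billiard map is a rotation, normalized to
have period `1`. -/
noncomputable def normAngle (φ : ℝ) : ℝ := E.angleInt m φ / (2 * E.angleInt m Real.pi)

theorem normAngle_zero : E.normAngle m 0 = 0 := by simp [normAngle, angleInt_zero]

theorem normAngle_add_pi (hm : m ^ 2 < E.b ^ 2) (φ : ℝ) :
    E.normAngle m (φ + Real.pi) = E.normAngle m φ + 1 / 2 := by
  have h := angleInt_pi_pos hm
  rw [normAngle, angleInt_add_pi hm, normAngle]
  field_simp

theorem normAngle_add_two_pi (hm : m ^ 2 < E.b ^ 2) (φ : ℝ) :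
    E.normAngle m (φ + 2 * Real.pi) = E.normAngle m φ + 1 := by
  rw [two_mul, ← add_assoc, normAngle_add_pi hm, normAngle_add_pi hm]; ring

theorem normAngle_add_nat_mul_two_pi (hm : m ^ 2 < E.b ^ 2) (φ : ℝ) (n : ℕ) :
    E.normAngle m (φ + n * (2 * Real.pi)) = E.normAngle m φ + n := by
  induction n with
  | zero => simp
  | succ n ih =>
    rw [Nat.cast_succ, add_one_mul, ← add_assoc, normAngle_add_two_pi hm, ih]; ring

theorem normAngle_add_int_mul_two_pi (hm : m ^ 2 < E.b ^ 2) (φ : ℝ) (n : ℤ) :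
    E.normAngle m (φ + n * (2 * Real.pi)) = E.normAngle m φ + n := by
  obtain ⟨k, rfl | rfl⟩ := n.eq_nat_or_neg
  · exact_mod_cast normAngle_add_nat_mul_two_pi hm φ k
  · have := normAngle_add_nat_mul_two_pi hm (φ + ((-(k : ℤ) : ℤ) : ℝ) * (2 * Real.pi)) k
    push_cast at this ⊢
    rw [show φ + -(k : ℝ) * (2 * Real.pi) + k * (2 * Real.pi) = φ by ring] at this
    linarith

theorem normAngle_strictMono (hm : m ^ 2 < E.b ^ 2) : StrictMono (E.normAngle m) := fun _ _ h =>
  div_lt_div_of_pos_right (angleInt_strictMono hm h) (by linarith [angleInt_pi_pos hm])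

theorem continuous_normAngle (hm : m ^ 2 < E.b ^ 2) : Continuous (E.normAngle m) :=
  (continuous_angleInt hm).div_const _

theorem normAngle_surjective (hm : m ^ 2 < E.b ^ 2) : Function.Surjective (E.normAngle m) := by
  intro y
  obtain ⟨n, hn⟩ := exists_nat_ge |y|
  have h1 := normAngle_add_int_mul_two_pi hm 0 n
  have h2 := normAngle_add_int_mul_two_pi hm 0 (-n)
  rw [normAngle_zero] at h1 h2
  have hy := abs_le.1 hn
  push_cast at h1 h2
  have := intermediate_value_univ (0 + -(n : ℝ) * (2 * Real.pi)) (0 + (n : ℝ) * (2 * Real.pi))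
    (continuous_normAngle hm)
  apply this
  rw [h1, h2]
  constructor <;> linarith

variable (E m) in
/-- The inverse of the angle coordinate `normAngle`. -/
noncomputable def normAngleInv : ℝ → ℝ := Function.invFun (E.normAngle m)

theorem normAngle_normAngleInv (hm : m ^ 2 < E.b ^ 2) (t : ℝ) :
    E.normAngle m (E.normAngleInv m t) = t :=
  Function.rightInverse_invFun (normAngle_surjective hm) t

theorem normAngleInv_normAngle (hm : m ^ 2 < E.b ^ 2) (φ : ℝ) :
    E.normAngleInv m (E.normAngle m φ) = φ :=
  Function.leftInverse_invFun (normAngle_strictMono hm).injective φ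

theorem continuous_normAngleInv (hm : m ^ 2 < E.b ^ 2) : Continuous (E.normAngleInv m) := by
  have h : StrictMono (E.normAngleInv m) := fun s t hst =>
    (normAngle_strictMono hm).lt_iff_lt.1 (by rwa [normAngle_normAngleInv hm,
      normAngle_normAngleInv hm])
  exact h.monotone.continuous_of_surjective fun φ => ⟨_, normAngleInv_normAngle hm φ⟩

theorem normAngleInv_add_one (hm : m ^ 2 < E.b ^ 2) (t : ℝ) :
    E.normAngleInv m (t + 1) = E.normAngleInv m t + 2 * Real.pi := by
  apply (normAngle_strictMono hm).injective
  rw [normAngle_add_two_pi hm, normAngle_normAngleInv hm, normAngle_normAngleInv hm]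

/-! ### The billiard map is a rotation on each level -/

variable (E m) in
/-- Half the increment `δ` of the parameter along the chord of level `m` whose end points have
mean parameter `σ`. -/
noncomputable def halfChord (σ : ℝ) : ℝ := Real.arcsin (m / (E.a * E.b) * √(E.speedSq σ))

variable (E m) in
/-- The rotation number on the level `m`, computed on the chord with mean parameter `0`. -/
noncomputable def rotNum : ℝ := 2 * E.normAngle m (Real.arcsin (m / E.a))

theorem sq_chord_arg_lt (hm : m ^ 2 < E.b ^ 2) (σ : ℝ) :
    (m / (E.a * E.b) * √(E.speedSq σ)) ^ 2 < 1 := by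
  have ha := E.a_pos
  have hb := E.b_pos
  rw [mul_pow, div_pow, sq_sqrt_speedSq, mul_pow, div_mul_eq_mul_div, div_lt_one (by positivity)]
  calc m ^ 2 * E.speedSq σ ≤ m ^ 2 * E.a ^ 2 :=
        mul_le_mul_of_nonneg_left (E.speedSq_le_a_sq σ) (sq_nonneg m)
    _ < E.b ^ 2 * E.a ^ 2 := mul_lt_mul_of_pos_right hm (by positivity)
    _ = _ := by ring

theorem sin_halfChord (hm : m ^ 2 < E.b ^ 2) (σ : ℝ) :
    Real.sin (E.halfChord m σ) = m / (E.a * E.b) * √(E.speedSq σ) := by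
  have h := abs_lt.1 (sq_lt_one_iff_abs_lt_one _ |>.1 (sq_chord_arg_lt hm σ))
  exact Real.sin_arcsin h.1.le h.2.le

theorem cos_halfChord_pos (hm : m ^ 2 < E.b ^ 2) (σ : ℝ) : 0 < Real.cos (E.halfChord m σ) := by
  rw [halfChord, Real.cos_arcsin]
  exact Real.sqrt_pos.2 (by linarith [sq_chord_arg_lt hm σ])

theorem hasDerivAt_speedSq (σ : ℝ) : HasDerivAt E.speedSq
    ((E.a ^ 2 - E.b ^ 2) * (2 * (Real.sin σ * Real.cos σ))) σ := by
  unfold speedSq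
  have := (((Real.hasDerivAt_sin σ).pow 2).const_mul (E.a ^ 2 - E.b ^ 2)).const_add (E.b ^ 2)
  refine this.congr_deriv ?_
  simp only [Nat.cast_ofNat, Nat.add_one_sub_one, pow_one]; ring

theorem hasDerivAt_halfChord (hm : m ^ 2 < E.b ^ 2) (σ : ℝ) : HasDerivAt (E.halfChord m)
    (Real.sin (E.halfChord m σ) * ((E.a ^ 2 - E.b ^ 2) * (Real.sin σ * Real.cos σ)) /
      (Real.cos (E.halfChord m σ) * E.speedSq σ)) σ := by
  have h := abs_lt.1 (sq_lt_one_iff_abs_lt_one _ |>.1 (sq_chord_arg_lt hm σ))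
  have hD := E.speedSq_pos σ
  have hs := E.sqrt_speedSq_pos σ
  have h1 := (Real.hasDerivAt_arcsin h.1.ne' h.2.ne).comp σ
    (((E.hasDerivAt_speedSq σ).sqrt hD.ne').const_mul (m / (E.a * E.b)))
  refine h1.congr_deriv ?_
  have hc := cos_halfChord_pos hm σ
  rw [sin_halfChord hm, ← Real.cos_arcsin, ← halfChord]
  field_simp
  rw [E.sq_sqrt_speedSq]

/-- The chord of level `m` is non-degenerate: its momenta are positive (below the level `b`). -/
theorem chord_num_pos (hm : m ^ 2 < E.b ^ 2) (σ : ℝ) {δ : ℝ} (hc : 0 < Real.cos δ)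
    (hs : Real.sin δ ^ 2 = m ^ 2 / (E.a * E.b) ^ 2 * E.speedSq σ) :
    0 < Real.cos δ * E.speedSq σ +
      Real.sin δ * ((E.a ^ 2 - E.b ^ 2) * (Real.sin σ * Real.cos σ)) := by
  have ha := E.a_pos
  have hb := E.b_pos
  have hab := E.b_sq_le_a_sq
  have hD := E.speedSq_pos σ
  have hcc : Real.cos δ ^ 2 = 1 - Real.sin δ ^ 2 := Real.cos_sq' δ
  have key : (Real.sin δ * ((E.a ^ 2 - E.b ^ 2) * (Real.sin σ * Real.cos σ))) ^ 2 <
      (Real.cos δ * E.speedSq σ) ^ 2 := by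
    rw [mul_pow, mul_pow (Real.cos δ), hcc, hs]
    have e : (1 - m ^ 2 / (E.a * E.b) ^ 2 * E.speedSq σ) * E.speedSq σ ^ 2 -
        m ^ 2 / (E.a * E.b) ^ 2 * E.speedSq σ *
          ((E.a ^ 2 - E.b ^ 2) * (Real.sin σ * Real.cos σ)) ^ 2 =
        E.speedSq σ / (E.a * E.b) ^ 2 *
          (E.a ^ 4 * (E.b ^ 2 - m ^ 2) * Real.sin σ ^ 2 +
            E.b ^ 4 * (E.a ^ 2 - m ^ 2) * Real.cos σ ^ 2) := by
      have hσ : Real.cos σ ^ 2 = 1 - Real.sin σ ^ 2 := Real.cos_sq' σ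
      rw [mul_pow (E.a ^ 2 - E.b ^ 2), mul_pow (Real.sin σ), hσ]
      have : E.speedSq σ = E.b ^ 2 + (E.a ^ 2 - E.b ^ 2) * Real.sin σ ^ 2 := rfl
      field_simp
      rw [this]; ring
    have : 0 < E.a ^ 4 * (E.b ^ 2 - m ^ 2) * Real.sin σ ^ 2 +
        E.b ^ 4 * (E.a ^ 2 - m ^ 2) * Real.cos σ ^ 2 := by
      have h1 : 0 < E.a ^ 4 * (E.b ^ 2 - m ^ 2) := mul_pos (by positivity) (by linarith)
      have h2 : 0 < E.b ^ 4 * (E.a ^ 2 - m ^ 2) := mul_pos (by positivity) (by linarith)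
      rcases eq_or_ne (Real.sin σ) 0 with h0 | h0
      · have : Real.cos σ ^ 2 = 1 := by rw [Real.cos_sq', h0]; ring
        rw [this, h0]; linarith
      · have : 0 < Real.sin σ ^ 2 := by positivity
        positivity
    have h3 : 0 < E.speedSq σ / (E.a * E.b) ^ 2 := by positivity
    nlinarith [mul_pos h3 this]
  have := abs_lt_of_sq_lt_sq key (by positivity)
  linarith [(abs_lt.1 this).1]

theorem sq_sin_halfChord (hm : m ^ 2 < E.b ^ 2) (σ : ℝ) :
    Real.sin (E.halfChord m σ) ^ 2 = m ^ 2 / (E.a * E.b) ^ 2 * E.speedSq σ := by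
  rw [sin_halfChord hm, mul_pow, div_pow, sq_sqrt_speedSq]

theorem level_chord (hm : m ^ 2 < E.b ^ 2) (σ : ℝ) :
    E.a ^ 2 * E.b ^ 2 * Real.sin (E.halfChord m σ) ^ 2 / E.speedSq σ = m ^ 2 := by
  have ha := E.a_pos
  have hb := E.b_pos
  have hD := E.speedSq_pos σ
  rw [sq_sin_halfChord hm]
  field_simp

theorem chordMom_halfChord (hm : m ^ 2 < E.b ^ 2) (σ : ℝ) :
    E.chordMom σ (E.halfChord m σ) = √(E.speedSq (σ + E.halfChord m σ) - m ^ 2) := by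
  have h := E.chordMom_sq σ (E.halfChord m σ)
  rw [level_chord hm] at h
  rw [← h, Real.sqrt_sq]
  exact (div_pos (chord_num_pos hm σ (cos_halfChord_pos hm σ) (sq_sin_halfChord hm σ))
    (E.sqrt_speedSq_pos σ)).le

theorem chordMom_neg_halfChord (hm : m ^ 2 < E.b ^ 2) (σ : ℝ) :
    E.chordMom σ (-E.halfChord m σ) = √(E.speedSq (σ - E.halfChord m σ) - m ^ 2) := by
  have h := E.chordMom_sq σ (-E.halfChord m σ)
  rw [Real.sin_neg, neg_sq, level_chord hm, ← sub_eq_add_neg] at h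
  rw [← h, Real.sqrt_sq]
  refine (div_pos (chord_num_pos hm σ ?_ ?_) (E.sqrt_speedSq_pos σ)).le
  · rw [Real.cos_neg]; exact cos_halfChord_pos hm σ
  · rw [Real.sin_neg, neg_sq]; exact sq_sin_halfChord hm σ

/-- Euler's addition theorem: the integral of the invariant density along the chords of a fixed
level is constant, since its derivative with respect to the mean parameter vanishes. -/
theorem angleInt_chord (hm : m ^ 2 < E.b ^ 2) (σ : ℝ) :
    E.angleInt m (σ + E.halfChord m σ) - E.angleInt m (σ - E.halfChord m σ) =
      2 * E.angleInt m (Real.arcsin (m / E.a)) := by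
  have hd : ∀ s, HasDerivAt (fun s => E.angleInt m (s + E.halfChord m s) -
      E.angleInt m (s - E.halfChord m s)) 0 s := by
    intro s
    have h0 := hasDerivAt_halfChord hm s
    have h1 := (hasDerivAt_angleInt hm (s + E.halfChord m s)).comp s ((hasDerivAt_id s).add h0)
    have h2 := (hasDerivAt_angleInt hm (s - E.halfChord m s)).comp s ((hasDerivAt_id s).sub h0)
    refine (h1.sub h2).congr_deriv ?_
    have hc := cos_halfChord_pos hm s
    have hD := E.speedSq_pos s
    have hD' := E.sqrt_speedSq_pos s
    have p1 := chord_num_pos hm s hc (sq_sin_halfChord hm s)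
    have p2 := chord_num_pos hm s (δ := -E.halfChord m s) (by rwa [Real.cos_neg])
      (by rw [Real.sin_neg, neg_sq]; exact sq_sin_halfChord hm s)
    rw [density, density, ← chordMom_halfChord hm, ← chordMom_neg_halfChord hm, chordMom, chordMom]
    rw [Real.cos_neg, Real.sin_neg, neg_mul, ← sub_eq_add_neg] at p2 ⊢
    have q1 := p1.ne'
    have q2 := p2.ne'
    generalize Real.sin (E.halfChord m s) * ((E.a ^ 2 - E.b ^ 2) * (Real.sin s * Real.cos s)) = N
      at q1 q2 ⊢
    field_simp
    ring
  have := is_const_of_deriv_eq_zero (fun s => (hd s).differentiableAt) (fun s => (hd s).deriv) σ 0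
  rw [this, zero_add, zero_sub, angleInt_neg]
  have h0 : E.halfChord m 0 = Real.arcsin (m / E.a) := by
    have hb := E.b_pos
    rw [halfChord]
    congr 1
    simp [speedSq, Real.sqrt_sq hb.le]
    field_simp
  rw [h0]; ring

theorem normAngle_chord (hm : m ^ 2 < E.b ^ 2) (σ : ℝ) :
    E.normAngle m (σ + E.halfChord m σ) = E.normAngle m (σ - E.halfChord m σ) + E.rotNum m := by
  have h := angleInt_chord hm σ
  have hp := angleInt_pi_pos hm
  rw [rotNum, normAngle, normAngle, normAngle]
  field_simp
  linarith

theorem continuous_halfChord : Continuous (E.halfChord m) :=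
  Real.continuous_arcsin.comp (continuous_const.mul E.continuous_speedSq.sqrt)

theorem sub_halfChord_surjective : Function.Surjective fun σ => σ - E.halfChord m σ := by
  have h : ∀ σ, |E.halfChord m σ| ≤ Real.pi / 2 := fun σ =>
    abs_le.2 ⟨Real.neg_pi_div_two_le_arcsin _, Real.arcsin_le_pi_div_two _⟩
  refine (continuous_id.sub continuous_halfChord).surjective ?_ ?_
  · refine Filter.tendsto_atTop_mono (fun σ => ?_)
      (Filter.tendsto_atTop_add_const_right Filter.atTop (-(Real.pi / 2)) Filter.tendsto_id)
    change σ + -(Real.pi / 2) ≤ σ - E.halfChord m σ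
    linarith [(abs_le.1 (h σ)).2]
  · refine Filter.tendsto_atBot_mono (fun σ => ?_)
      (Filter.tendsto_atBot_add_const_right Filter.atBot (Real.pi / 2) Filter.tendsto_id)
    change σ - E.halfChord m σ ≤ σ + Real.pi / 2
    linarith [(abs_le.1 (h σ)).1]

variable (E m) in
/-- The point with angle coordinate `t` on the invariant curve of level `m < b` along which the
orbits turn counterclockwise. -/
noncomputable def rotCurve (t : ℝ) : E.Phase :=
  E.phasePt (E.normAngleInv m t) √(E.speedSq (E.normAngleInv m t) - m ^ 2)

/-- The chord of level `m` that starts at angle coordinate `t`. -/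
theorem exists_chord_of_level (h0 : 0 ≤ m) (hm : m ^ 2 < E.b ^ 2) (t : ℝ) : ∃ σ δ : ℝ,
    0 ≤ Real.sin δ ∧ E.normAngleInv m t = σ - δ ∧ E.normAngleInv m (t + E.rotNum m) = σ + δ ∧
    √(E.speedSq (σ - δ) - m ^ 2) = E.chordMom σ (-δ) ∧
    √(E.speedSq (σ + δ) - m ^ 2) = E.chordMom σ δ := by
  obtain ⟨σ, hσ⟩ := sub_halfChord_surjective (E := E) (m := m) (E.normAngleInv m t)
  simp only at hσ
  refine ⟨σ, E.halfChord m σ, ?_, hσ.symm, ?_, (chordMom_neg_halfChord hm σ).symm,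
    (chordMom_halfChord hm σ).symm⟩
  · rw [sin_halfChord hm]
    exact mul_nonneg (div_nonneg h0 (mul_pos E.a_pos E.b_pos).le) (Real.sqrt_nonneg _)
  · apply (normAngle_strictMono hm).injective
    rw [normAngle_normAngleInv hm, normAngle_chord hm, hσ, normAngle_normAngleInv hm]

theorem billiard_rotCurve (h0 : 0 ≤ m) (hm : m ^ 2 < E.b ^ 2) (t : ℝ) :
    E.billiard (E.rotCurve m t) = E.rotCurve m (t + E.rotNum m) := by
  obtain ⟨σ, δ, hδ, h1, h2, h3, h4⟩ := exists_chord_of_level h0 hm t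
  rw [rotCurve, rotCurve, h1, h2, h3, h4, billiard_chord E hδ]

end Ellipse

namespace Ellipse

variable {E : Ellipse}

/-! ### The phase cylinder, its conserved quantity and its symmetry -/

theorem exists_angle_of_sq_add_sq {u v : ℝ} (h : u ^ 2 + v ^ 2 = 1) :
    ∃ φ : ℝ, Real.cos φ = u ∧ Real.sin φ = v := by
  refine ⟨Complex.arg ⟨u, v⟩, ?_, ?_⟩
  · have h1 := Complex.norm_mul_cos_arg ⟨u, v⟩
    rwa [show ‖(⟨u, v⟩ : ℂ)‖ = 1 by
      rw [Complex.norm_eq_sqrt_sq_add_sq, h, Real.sqrt_one], one_mul] at h1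
  · have h1 := Complex.norm_mul_sin_arg ⟨u, v⟩
    rwa [show ‖(⟨u, v⟩ : ℂ)‖ = 1 by
      rw [Complex.norm_eq_sqrt_sq_add_sq, h, Real.sqrt_one], one_mul] at h1

theorem exists_param_curve {x : Plane} (hx : x ∈ E.curve) :
    ∃ φ : ℝ, x = !₂[E.a * Real.cos φ, E.b * Real.sin φ] := by
  have ha := E.a_pos
  have hb := E.b_pos
  obtain ⟨φ, h1, h2⟩ := exists_angle_of_sq_add_sq (u := x 0 / E.a) (v := x 1 / E.b)
    (by rw [div_pow, div_pow]; exact hx)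
  refine ⟨φ, ?_⟩
  rw [h1, h2]
  ext i
  fin_cases i <;> simp <;> field_simp

theorem exists_param (p : E.Phase) : ∃ φ : ℝ, p = E.param (φ, p.2) := by
  obtain ⟨φ, h⟩ := exists_param_curve p.1.2
  refine ⟨φ, Prod.ext (Subtype.ext h) (Subtype.ext ?_)⟩
  exact (E.param_snd p.2.2).symm

theorem param_eq_phasePt (φ : ℝ) {θ : ℝ} (h : θ ∈ Set.Icc (0 : ℝ) Real.pi) :
    E.param (φ, θ) = E.phasePt φ (√(E.speedSq φ) * Real.cos θ) := by
  rw [phasePt, mul_div_cancel_left₀ _ (E.sqrt_speedSq_pos φ).ne', Real.arccos_cos h.1 h.2]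

theorem phasePt_congr {φ φ' : ℝ} (hc : Real.cos φ = Real.cos φ') (hs : Real.sin φ = Real.sin φ')
    (p : ℝ) : E.phasePt φ p = E.phasePt φ' p := by
  simp only [phasePt, param, speedSq, hc, hs]

variable (E) in
theorem continuous_param : Continuous E.param := by
  unfold param
  refine Continuous.prodMk (Continuous.subtype_mk ?_ _) (continuous_projIcc.comp continuous_snd)
  refine (PiLp.continuous_toLp 2 _).comp (continuous_pi fun i => ?_)
  fin_cases i <;> simp <;> fun_prop

theorem continuous_phasePt {X : Type*} [TopologicalSpace X] {f g : X → ℝ} (hf : Continuous f)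
    (hg : Continuous g) : Continuous fun x => E.phasePt (f x) (g x) := by
  unfold phasePt
  refine E.continuous_param.comp (hf.prodMk (Real.continuous_arccos.comp (hg.div ?_ ?_)))
  · exact (E.continuous_speedSq.comp hf).sqrt
  · exact fun x => (E.sqrt_speedSq_pos _).ne'

/-- The conserved quantity `√D sin θ`, a multiple of the Joachimsthal integral. -/
noncomputable def level (p : E.Phase) : ℝ :=
  Real.sin p.2 * √(E.b ^ 2 * (p.1.1 0) ^ 2 / E.a ^ 2 + E.a ^ 2 * (p.1.1 1) ^ 2 / E.b ^ 2)

theorem continuous_level : Continuous (level : E.Phase → ℝ) := by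
  unfold level
  fun_prop

theorem level_param (φ : ℝ) {θ : ℝ} (h : θ ∈ Set.Icc (0 : ℝ) Real.pi) :
    level (E.param (φ, θ)) = Real.sin θ * √(E.speedSq φ) := by
  have ha := E.a_pos
  have hb := E.b_pos
  rw [level, param_snd E h]
  congr 2
  simp [param]
  field_simp
  rw [speedSq, Real.cos_sq']; ring

theorem level_nonneg (p : E.Phase) : 0 ≤ level p :=
  mul_nonneg (Real.sin_nonneg_of_mem_Icc p.2.2) (Real.sqrt_nonneg _)

theorem mem_openPhase_iff {p : E.Phase} : p ∈ E.openPhase ↔ 0 < level p := by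
  obtain ⟨φ, hp⟩ := exists_param p
  rw [hp, level_param φ p.2.2]
  constructor
  · intro h
    rw [openPhase, Set.mem_ofPred_eq, param_snd E p.2.2] at h
    exact mul_pos (Real.sin_pos_of_pos_of_lt_pi h.1 h.2) (E.sqrt_speedSq_pos φ)
  · intro h
    have h1 := pos_of_mul_pos_left h (E.sqrt_speedSq_pos φ).le
    rw [openPhase, Set.mem_ofPred_eq, param_snd E p.2.2]
    refine ⟨lt_of_le_of_ne p.2.2.1 fun h0 => ?_, lt_of_le_of_ne p.2.2.2 fun h0 => ?_⟩
    · rw [← h0] at h1; simp at h1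
    · rw [h0] at h1; simp at h1

theorem level_phasePt (φ p : ℝ) :
    level (E.phasePt φ p) = √(E.speedSq φ - p ^ 2) := by
  have hD := E.speedSq_pos φ
  rw [phasePt, level_param φ ⟨Real.arccos_nonneg _, Real.arccos_le_pi _⟩, Real.sin_arccos,
    ← Real.sqrt_mul', div_pow, sq_sqrt_speedSq]
  · congr 1; field_simp
  · exact hD.le

theorem level_chordStart (σ δ : ℝ) : level (E.phasePt (σ + δ) (E.chordMom σ δ)) =
    E.a * E.b * |Real.sin δ| / √(E.speedSq σ) := by
  have h1 := E.sqrt_speedSq_pos σ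
  have h2 := E.sqrt_speedSq_pos (σ + δ)
  rw [phasePt, level_param _ ⟨Real.arccos_nonneg _, Real.arccos_le_pi _⟩, sin_arccos_chordMom]
  field_simp

/-- Every point of the open phase cylinder is the start of a chord. -/
theorem exists_chord {p : E.Phase} (hp : p ∈ E.openPhase) : ∃ σ δ : ℝ, 0 < Real.sin δ ∧
    p = E.phasePt (σ - δ) (E.chordMom σ (-δ)) := by
  have ha := E.a_pos
  have hb := E.b_pos
  obtain ⟨φ, h⟩ := exists_param p
  rw [param_eq_phasePt φ p.2.2] at h
  have hθ := Real.sin_pos_of_pos_of_lt_pi hp.1 hp.2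
  set θ : ℝ := (p.2 : ℝ)
  have hD := E.speedSq_pos φ
  -- the slope of the chord determines `δ`
  set K := (E.a ^ 2 - E.b ^ 2) * (Real.sin φ * Real.cos φ) with hK
  set X := E.a * E.b * Real.cos θ - K * Real.sin θ with hX
  set Y := E.speedSq φ * Real.sin θ with hY
  have hYpos : 0 < Y := mul_pos hD hθ
  set N := ‖(⟨X, Y⟩ : ℂ)‖
  set δ := Complex.arg ⟨X, Y⟩
  have hN : 0 < N := norm_pos_iff.2 fun h0 => hYpos.ne' (congrArg Complex.im h0)
  have hc : N * Real.cos δ = X := Complex.norm_mul_cos_arg _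
  have hs : N * Real.sin δ = Y := Complex.norm_mul_sin_arg _
  have hsin : 0 < Real.sin δ := pos_of_mul_pos_right (hs ▸ hYpos) hN.le
  have hφ := Real.cos_sq' φ
  have hD1 : E.speedSq φ = E.b ^ 2 + (E.a ^ 2 - E.b ^ 2) * Real.sin φ ^ 2 := rfl
  have hNN : N ^ 2 * E.speedSq (φ + δ) = (E.a * E.b) ^ 2 * E.speedSq φ := by
    have e0 : N ^ 2 = X ^ 2 + Y ^ 2 := by
      rw [← hc, ← hs]
      linear_combination (-N ^ 2) * Real.sin_sq_add_cos_sq δ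
    have e1 : N * Real.sin (φ + δ) = Real.sin φ * X + Real.cos φ * Y := by
      rw [Real.sin_add, ← hc, ← hs]; ring
    have e2 : N ^ 2 * E.speedSq (φ + δ) = E.b ^ 2 * (X ^ 2 + Y ^ 2) +
        (E.a ^ 2 - E.b ^ 2) * (Real.sin φ * X + Real.cos φ * Y) ^ 2 := by
      rw [speedSq, ← e0, ← e1]; ring
    have e3 : E.speedSq φ * (N ^ 2 * E.speedSq (φ + δ)) =
        (E.speedSq φ * X + K * Y) ^ 2 + (E.a * E.b) ^ 2 * Y ^ 2 := by
      rw [e2, hK, hD1]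
      linear_combination (E.a ^ 2 - E.b ^ 2) * Y ^ 2 * E.b ^ 2 * hφ
    have e4 : E.speedSq φ * X + K * Y = E.speedSq φ * (E.a * E.b * Real.cos θ) := by
      rw [hX, hY]; ring
    apply mul_left_cancel₀ hD.ne'
    rw [e3, e4, hY]
    linear_combination (E.a * E.b) ^ 2 * E.speedSq φ ^ 2 * Real.sin_sq_add_cos_sq θ
  have hsq : N * √(E.speedSq (φ + δ)) = E.a * E.b * √(E.speedSq φ) := by
    rw [← sq_eq_sq₀ (by positivity) (by positivity), mul_pow, mul_pow, sq_sqrt_speedSq,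
      sq_sqrt_speedSq, hNN]
  refine ⟨φ + δ, δ, hsin, ?_⟩
  rw [h, add_sub_cancel_right]
  congr 1
  have h1 := E.sqrt_speedSq_pos (φ + δ)
  have h2 := E.sqrt_speedSq_pos φ
  rw [chordMom, eq_div_iff h1.ne', Real.cos_neg, Real.sin_neg]
  apply mul_left_cancel₀ hN.ne'
  have e5 : Real.cos δ * E.speedSq (φ + δ) + -Real.sin δ *
      ((E.a ^ 2 - E.b ^ 2) * (Real.sin (φ + δ) * Real.cos (φ + δ))) =
      Real.cos δ * E.speedSq φ + Real.sin δ * K := by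
    have hd := Real.sin_sq_add_cos_sq δ
    rw [hK, speedSq, speedSq, Real.sin_add, Real.cos_add]
    linear_combination (E.a ^ 2 - E.b ^ 2) *
      (Real.sin φ * Real.cos δ + Real.cos φ * Real.sin δ) * Real.sin φ * hd
  rw [e5]
  calc N * (√(E.speedSq φ) * Real.cos θ * √(E.speedSq (φ + δ))) =
      √(E.speedSq φ) * Real.cos θ * (N * √(E.speedSq (φ + δ))) := by ring
    _ = √(E.speedSq φ) ^ 2 * (E.a * E.b * Real.cos θ) := by rw [hsq]; ring
    _ = (N * Real.cos δ) * E.speedSq φ + (N * Real.sin δ) * K := by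
      rw [sq_sqrt_speedSq, hc, hs, hX, hY]; ring
    _ = _ := by ring

variable (E) in
/-- The reflection in the major axis, which reverses the orientation of the ellipse. -/
noncomputable def mirror (p : E.Phase) : E.Phase :=
  (⟨!₂[p.1.1 0, -p.1.1 1], by
      have h : (p.1.1 0) ^ 2 / E.a ^ 2 + (p.1.1 1) ^ 2 / E.b ^ 2 = 1 := p.1.2
      simpa [curve] using h⟩,
    ⟨Real.pi - p.2, by linarith [p.2.2.2], by linarith [p.2.2.1]⟩)

theorem continuous_mirror : Continuous E.mirror := by
  unfold mirror
  refine Continuous.prodMk (Continuous.subtype_mk ?_ _) (Continuous.subtype_mk (by fun_prop) _)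
  refine (PiLp.continuous_toLp 2 _).comp (continuous_pi fun i => ?_)
  fin_cases i <;> simp <;> fun_prop

theorem mirror_mirror (p : E.Phase) : E.mirror (E.mirror p) = p := by
  refine Prod.ext (Subtype.ext ?_) (Subtype.ext ?_)
  · ext i
    fin_cases i <;> simp [mirror]
  · simp [mirror]

theorem level_mirror (p : E.Phase) : level (E.mirror p) = level p := by
  simp [level, mirror]

theorem mirror_mem_openPhase {p : E.Phase} (hp : p ∈ E.openPhase) : E.mirror p ∈ E.openPhase := by
  rw [mem_openPhase_iff, level_mirror]; exact mem_openPhase_iff.1 hp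

theorem mirror_phasePt (φ p : ℝ) : E.mirror (E.phasePt φ p) = E.phasePt (-φ) (-p) := by
  refine Prod.ext (Subtype.ext ?_) (Subtype.ext ?_)
  · simp [mirror, phasePt_fst]
  · rw [phasePt_snd, speedSq_neg, neg_div, Real.arccos_neg, ← phasePt_snd]
    rfl

theorem chordMom_mirror (σ δ : ℝ) : E.chordMom (Real.pi - σ) (Real.pi - δ) =
    -E.chordMom σ δ := by
  simp only [chordMom, speedSq, Real.sin_pi_sub, Real.cos_pi_sub]
  rw [← neg_div]
  congr 1
  ring

theorem billiard_mirror {p : E.Phase} (hp : p ∈ E.openPhase) :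
    E.billiard (E.mirror p) = E.mirror (E.billiard p) := by
  obtain ⟨σ, δ, hδ, rfl⟩ := exists_chord hp
  rw [billiard_chord E hδ.le, mirror_phasePt, mirror_phasePt]
  have h := E.billiard_chord (σ := Real.pi - σ) (δ := Real.pi - δ)
    (by rw [Real.sin_pi_sub]; exact hδ.le)
  have e : E.chordMom (Real.pi - σ) (-(Real.pi - δ)) = -E.chordMom σ (-δ) := by
    simp only [chordMom, speedSq, Real.sin_pi_sub, Real.cos_pi_sub, Real.sin_neg, Real.cos_neg]
    rw [← neg_div]
    congr 1
    ring
  rw [e, chordMom_mirror, show Real.pi - σ - (Real.pi - δ) = -(σ - δ) by ring,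
    show Real.pi - σ + (Real.pi - δ) = -(σ + δ) + 2 * Real.pi by ring] at h
  rw [h]
  exact phasePt_congr (Real.cos_add_two_pi _) (Real.sin_add_two_pi _) _

theorem level_billiard {p : E.Phase} (hp : p ∈ E.openPhase) : level (E.billiard p) = level p := by
  obtain ⟨σ, δ, hδ, rfl⟩ := exists_chord hp
  have h := E.level_chordStart σ (-δ)
  rw [billiard_chord E hδ.le, level_chordStart]
  rw [Real.sin_neg, abs_neg, ← sub_eq_add_neg] at h
  rw [h]

theorem billiard_mem_openPhase {p : E.Phase} (hp : p ∈ E.openPhase) :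
    E.billiard p ∈ E.openPhase := by
  rw [mem_openPhase_iff, level_billiard hp]; exact mem_openPhase_iff.1 hp

theorem iterate_billiard_mem_openPhase {p : E.Phase} (hp : p ∈ E.openPhase) (n : ℕ) :
    E.billiard^[n] p ∈ E.openPhase := by
  induction n with
  | zero => exact hp
  | succ n ih => rw [Function.iterate_succ_apply']; exact billiard_mem_openPhase ih

theorem iterate_billiard_mirror {p : E.Phase} (hp : p ∈ E.openPhase) (n : ℕ) :
    E.billiard^[n] (E.mirror p) = E.mirror (E.billiard^[n] p) := by
  induction n with
  | zero => rfl
  | succ n ih =>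
    rw [Function.iterate_succ_apply', Function.iterate_succ_apply', ih,
      billiard_mirror (iterate_billiard_mem_openPhase hp n)]

/-! ### The levels below `b` -/

theorem level_rotCurve {m : ℝ} (h0 : 0 ≤ m) (hm : m ^ 2 < E.b ^ 2) (t : ℝ) :
    level (E.rotCurve m t) = m := by
  have h := sub_sq_pos hm (E.normAngleInv m t)
  rw [rotCurve, level_phasePt, Real.sq_sqrt h.le, sub_sub_cancel, Real.sqrt_sq h0]

theorem exists_rotCurve {p : E.Phase} (hp : level p ^ 2 < E.b ^ 2)
    (hθ : (p.2 : ℝ) ≤ Real.pi / 2) : ∃ t, p = E.rotCurve (level p) t := by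
  obtain ⟨φ, h⟩ := exists_param p
  have hl : level p = Real.sin p.2 * √(E.speedSq φ) := by rw [h, level_param φ p.2.2, ← h]
  refine ⟨E.normAngle (level p) φ, ?_⟩
  rw [rotCurve, normAngleInv_normAngle hp]
  conv_lhs => rw [h, param_eq_phasePt φ p.2.2]
  congr 1
  have hc : 0 ≤ Real.cos p.2 :=
    Real.cos_nonneg_of_neg_pi_div_two_le_of_le (by linarith [p.2.2.1, Real.pi_pos]) hθ
  rw [hl, ← Real.sqrt_sq (mul_nonneg (Real.sqrt_nonneg (E.speedSq φ)) hc), mul_pow, mul_pow,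
    sq_sqrt_speedSq, Real.cos_sq']
  congr 1; ring

theorem iterate_billiard_rotCurve {m : ℝ} (h0 : 0 ≤ m) (hm : m ^ 2 < E.b ^ 2) (t : ℝ) (n : ℕ) :
    E.billiard^[n] (E.rotCurve m t) = E.rotCurve m (t + n * E.rotNum m) := by
  induction n with
  | zero => simp
  | succ n ih =>
    rw [Function.iterate_succ_apply', ih, billiard_rotCurve h0 hm]
    congr 1; push_cast; ring

theorem rotCurve_periodic {m : ℝ} (hm : m ^ 2 < E.b ^ 2) :
    Function.Periodic (E.rotCurve m) 1 := fun t => by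
  rw [rotCurve, normAngleInv_add_one hm, speedSq_add_two_pi]
  exact phasePt_congr (Real.cos_add_two_pi _) (Real.sin_add_two_pi _) _

theorem continuous_rotCurve {m : ℝ} (hm : m ^ 2 < E.b ^ 2) : Continuous (E.rotCurve m) :=
  continuous_phasePt (continuous_normAngleInv hm)
    ((E.continuous_speedSq.comp (continuous_normAngleInv hm)).sub continuous_const).sqrt

end Ellipse

namespace Ellipse

variable {E : Ellipse}

/-! ### The levels above `b` -/

variable (E) in
/-- The ellipse with semi-axes `m ≤ a`. The librational motion on the level `m` of `E`
is governed by the level `b` of this ellipse. -/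
noncomputable def dual (m : ℝ) (h : E.b < m) (h' : m < E.a) : Ellipse where
  a := E.a
  b := m
  b_pos := E.b_pos.trans h
  b_le_a := h'.le

theorem sq_lt_dual {m : ℝ} (h : E.b < m) (h' : m < E.a) : E.b ^ 2 < (E.dual m h h').b ^ 2 :=
  pow_lt_pow_left₀ h E.b_pos.le two_ne_zero

variable (E) in
/-- The point of the level `m > b`, over the upper half of the ellipse, at which
`c cos φ = ε cos ψ` and the momentum is `ε sin ψ`, where `c² = a² - b²` and `ε² = a² - m²`. -/
noncomputable def libPt (m ψ : ℝ) : E.Phase :=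
  E.phasePt (Real.arccos (√(E.a ^ 2 - m ^ 2) / √(E.a ^ 2 - E.b ^ 2) * Real.cos ψ))
    (√(E.a ^ 2 - m ^ 2) * Real.sin ψ)

theorem libPt_eq {m ψ φ : ℝ} (hs : 0 < Real.sin φ)
    (hc : Real.cos φ = √(E.a ^ 2 - m ^ 2) / √(E.a ^ 2 - E.b ^ 2) * Real.cos ψ) :
    E.libPt m ψ = E.phasePt φ (√(E.a ^ 2 - m ^ 2) * Real.sin ψ) := by
  rw [libPt, ← hc]
  refine phasePt_congr (Real.cos_arccos (Real.neg_one_le_cos φ) (Real.cos_le_one φ)) ?_ _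
  rw [Real.sin_arccos, ← Real.sin_sq, Real.sqrt_sq hs.le]

section

variable {m : ℝ} (h : E.b < m) (h' : m < E.a)
include h h'

theorem lib_pos : 0 < m ∧ 0 < E.a ^ 2 - m ^ 2 ∧ 0 < E.a ^ 2 - E.b ^ 2 ∧
    E.a ^ 2 - m ^ 2 < E.a ^ 2 - E.b ^ 2 := by
  have hb := E.b_pos
  have h1 : E.b ^ 2 < m ^ 2 := pow_lt_pow_left₀ h hb.le two_ne_zero
  have h2 : m ^ 2 < E.a ^ 2 := pow_lt_pow_left₀ h' (hb.trans h).le two_ne_zero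
  exact ⟨hb.trans h, by linarith, by linarith, by linarith⟩

theorem lib_ratio_lt : √(E.a ^ 2 - m ^ 2) / √(E.a ^ 2 - E.b ^ 2) < 1 := by
  obtain ⟨h1, h2, h3, h4⟩ := lib_pos h h'
  rw [div_lt_one (Real.sqrt_pos.2 h3)]
  exact Real.sqrt_lt_sqrt h2.le h4

theorem abs_lib_cos_lt (ψ : ℝ) :
    |√(E.a ^ 2 - m ^ 2) / √(E.a ^ 2 - E.b ^ 2) * Real.cos ψ| < 1 := by
  rw [abs_mul, abs_of_nonneg (by positivity)]
  calc _ ≤ √(E.a ^ 2 - m ^ 2) / √(E.a ^ 2 - E.b ^ 2) * 1 :=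
        mul_le_mul_of_nonneg_left (Real.abs_cos_le_one ψ) (by positivity)
    _ < 1 := by rw [mul_one]; exact lib_ratio_lt h h'

theorem libPt_fst_zero (ψ : ℝ) : (E.libPt m ψ).1.1 0 =
    E.a * (√(E.a ^ 2 - m ^ 2) / √(E.a ^ 2 - E.b ^ 2) * Real.cos ψ) := by
  have := abs_lt.1 (abs_lib_cos_lt h h' ψ)
  rw [libPt, phasePt_fst]
  simp only [Real.cos_arccos this.1.le this.2.le]
  simp

theorem libPt_fst_one_pos (ψ : ℝ) : 0 < (E.libPt m ψ).1.1 1 := by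
  have := abs_lib_cos_lt h h' ψ
  rw [libPt, phasePt_fst]
  simp only [Real.sin_arccos]
  simp
  refine mul_pos E.b_pos (Real.sqrt_pos.2 ?_)
  linarith [sq_lt_one_iff_abs_lt_one _ |>.2 this]

theorem libPt_speedSq (ψ : ℝ) :
    E.speedSq (Real.arccos (√(E.a ^ 2 - m ^ 2) / √(E.a ^ 2 - E.b ^ 2) * Real.cos ψ)) =
      m ^ 2 + (E.a ^ 2 - m ^ 2) * Real.sin ψ ^ 2 := by
  obtain ⟨h1, h2, h3, h4⟩ := lib_pos h h'
  have := abs_lt.1 (abs_lib_cos_lt h h' ψ)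
  rw [speedSq_eq_sub_cos, Real.cos_arccos this.1.le this.2.le, mul_pow, div_pow,
    Real.sq_sqrt h2.le, Real.sq_sqrt h3.le, Real.cos_sq']
  field_simp
  ring

theorem level_libPt (ψ : ℝ) : level (E.libPt m ψ) = m := by
  obtain ⟨h1, h2, h3, h4⟩ := lib_pos h h'
  rw [libPt, level_phasePt, libPt_speedSq h h', mul_pow, Real.sq_sqrt h2.le, add_sub_cancel_right,
    Real.sqrt_sq h1.le]

theorem libPt_mem_openPhase (ψ : ℝ) : E.libPt m ψ ∈ E.openPhase := by
  rw [mem_openPhase_iff, level_libPt h h']; exact (lib_pos h h').1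

/-- Along a chord of level `m > b` the angle `ψ` changes as the parameter along a chord of level
`b` of the dual ellipse. -/
theorem billiard_libPt (ψ : ℝ) :
    E.billiard (E.libPt m (ψ - (E.dual m h h').halfChord E.b ψ)) =
      E.mirror (E.libPt m (ψ + (E.dual m h h').halfChord E.b ψ)) := by
  have ha := E.a_pos
  have hb := E.b_pos
  obtain ⟨hm, h2, h3, h4⟩ := lib_pos h h'
  have hV := sq_lt_dual h h'
  set V := E.dual m h h' with hVdef
  set d := V.halfChord E.b ψ
  set e := √(E.a ^ 2 - m ^ 2) with he
  set c := √(E.a ^ 2 - E.b ^ 2) with hc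
  set w := √(V.speedSq ψ) with hw
  have he2 : e ^ 2 = E.a ^ 2 - m ^ 2 := Real.sq_sqrt h2.le
  have hc2 : c ^ 2 = E.a ^ 2 - E.b ^ 2 := Real.sq_sqrt h3.le
  have hw2 : w ^ 2 = m ^ 2 + (E.a ^ 2 - m ^ 2) * Real.sin ψ ^ 2 := V.sq_sqrt_speedSq ψ
  have hepos : 0 < e := Real.sqrt_pos.2 h2
  have hcpos : 0 < c := Real.sqrt_pos.2 h3
  have hwpos : 0 < w := V.sqrt_speedSq_pos ψ
  have hψ := Real.cos_sq' ψ
  have hs1 : Real.sin ψ ^ 2 ≤ 1 := Real.sin_sq_le_one ψ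
  have hk2 : (e * E.b / (c * m)) ^ 2 < 1 := by
    rw [div_pow, mul_pow, mul_pow, he2, hc2, div_lt_one (by positivity)]
    nlinarith [mul_lt_mul_of_pos_left h4 (pow_pos ha 2)]
  have hks : (e * E.b / (c * m) * Real.sin ψ) ^ 2 < 1 := by
    rw [mul_pow]
    nlinarith [sq_nonneg (e * E.b / (c * m))]
  set k := e * E.b / (c * m) with hk
  set q := √(1 - (k * Real.sin ψ) ^ 2) with hq
  have hq2 : q ^ 2 = 1 - (k * Real.sin ψ) ^ 2 := Real.sq_sqrt (by linarith)
  have hqpos : 0 < q := Real.sqrt_pos.2 (by linarith)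
  -- the chord with mean parameter `σ` and half increment `δ`
  set σ := Real.pi - Real.arcsin (k * Real.sin ψ) with hσdef
  set δ := Real.arccos (-(e / E.a) * Real.cos ψ) with hδdef
  have hks' := abs_lt.1 (sq_lt_one_iff_abs_lt_one _ |>.1 hks)
  have hsσ : Real.sin σ = k * Real.sin ψ := by
    rw [hσdef, Real.sin_pi_sub, Real.sin_arcsin hks'.1.le hks'.2.le]
  have hcσ : Real.cos σ = -q := by
    rw [hσdef, Real.cos_pi_sub, Real.cos_arcsin]
  have hea : (e / E.a * Real.cos ψ) ^ 2 ≤ 1 := by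
    rw [mul_pow, div_pow, he2, hψ, div_mul_eq_mul_div, div_le_one (by positivity)]
    nlinarith [sq_nonneg (Real.sin ψ)]
  have hea' := abs_le.1 (sq_le_one_iff_abs_le_one _ |>.1 hea)
  have hcδ : Real.cos δ = -(e / E.a) * Real.cos ψ :=
    Real.cos_arccos (by linarith) (by linarith)
  have hsδ : Real.sin δ = w / E.a := by
    have h0 : 0 ≤ Real.sin δ := by rw [hδdef, Real.sin_arccos]; exact Real.sqrt_nonneg _
    rw [← sq_eq_sq₀ h0 (by positivity), Real.sin_sq, hcδ, div_pow, hw2, mul_pow, neg_sq, div_pow,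
      he2, hψ]
    field_simp; ring
  have hsδpos : 0 < Real.sin δ := by rw [hsδ]; positivity
  clear_value σ δ
  have hDσ : E.speedSq σ = (E.b * w / m) ^ 2 := by
    rw [speedSq, hsσ, ← hc2, div_pow, mul_pow, mul_pow, hw2, ← he2, hk]
    field_simp
  have hsqD : √(E.speedSq σ) = E.b * w / m := by
    rw [hDσ, Real.sqrt_sq (by positivity)]
  have hsd : Real.sin d = E.b * w / (E.a * m) := by
    rw [show Real.sin d = E.b / (V.a * V.b) * √(V.speedSq ψ) from sin_halfChord hV ψ]
    change E.b / (E.a * m) * w = _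
    ring
  have hcd : Real.cos d = c * q / E.a := by
    have h0 : 0 < Real.cos d := cos_halfChord_pos hV ψ
    rw [← sq_eq_sq₀ h0.le (by positivity), Real.cos_sq', hsd, div_pow, div_pow, mul_pow, mul_pow,
      mul_pow, hw2, hq2, hk, mul_pow, div_pow, mul_pow, mul_pow, he2]
    field_simp
    rw [hc2]; ring
  have hpos : (k * Real.sin ψ * (e / E.a * Real.cos ψ)) ^ 2 < (q * (w / E.a)) ^ 2 := by
    have e1 : (q * (w / E.a)) ^ 2 - (k * Real.sin ψ * (e / E.a * Real.cos ψ)) ^ 2 =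
        (m ^ 2 * q ^ 2 + e ^ 2 * Real.sin ψ ^ 2 * (1 - k ^ 2)) / E.a ^ 2 := by
      rw [mul_pow q, div_pow, hw2, ← he2, mul_pow _ (e / E.a * Real.cos ψ), mul_pow (e / E.a),
        hψ, hq2, div_pow]
      ring
    have : 0 < (m ^ 2 * q ^ 2 + e ^ 2 * Real.sin ψ ^ 2 * (1 - k ^ 2)) / E.a ^ 2 := by
      have : 0 ≤ e ^ 2 * Real.sin ψ ^ 2 * (1 - k ^ 2) := mul_nonneg (by positivity) (by linarith)
      positivity
    linarith
  have hpos' := abs_lt.1 (abs_lt_of_sq_lt_sq hpos (by positivity))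
  have hs_start : 0 < Real.sin (σ - δ) := by
    rw [Real.sin_sub, hsσ, hcσ, hcδ, hsδ]; linarith
  have hs_end : 0 < Real.sin (-(σ + δ)) := by
    rw [Real.sin_neg, Real.sin_add, hsσ, hcσ, hcδ, hsδ]; linarith
  have hc_start : Real.cos (σ - δ) = e / c * Real.cos (ψ - d) := by
    rw [Real.cos_sub, Real.cos_sub, hsσ, hcσ, hcδ, hsδ, hsd, hcd, hk]
    field_simp
  have hc_end : Real.cos (-(σ + δ)) = e / c * Real.cos (ψ + d) := by
    rw [Real.cos_neg, Real.cos_add, Real.cos_add, hsσ, hcσ, hcδ, hsδ, hsd, hcd, hk]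
    field_simp
  have hm_start : e * Real.sin (ψ - d) = E.chordMom σ (-δ) := by
    rw [chordMom, hsqD, hDσ, Real.sin_sub, Real.cos_neg, Real.sin_neg, hsσ, hcσ, hcδ, hsδ, hsd,
      hcd, hk, ← hc2]
    field_simp
    ring
  have hm_end : e * Real.sin (ψ + d) = -E.chordMom σ δ := by
    rw [chordMom, hsqD, hDσ, Real.sin_add, hsσ, hcσ, hcδ, hsδ, hsd, hcd, hk, ← hc2]
    field_simp
    ring
  rw [libPt_eq hs_start hc_start, libPt_eq hs_end hc_end, ← he, hm_start, hm_end,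
    billiard_chord E hsδpos.le, mirror_phasePt, neg_neg, neg_neg]

end

variable (E) in
/-- The integral `∫₀ˣ ds / √(m² cos² s + a² sin² s - b²)`. -/
noncomputable def libInt (m x : ℝ) : ℝ :=
  ∫ s in (0 : ℝ)..x, 1 / √(m ^ 2 + (E.a ^ 2 - m ^ 2) * Real.sin s ^ 2 - E.b ^ 2)

variable (E) in
/-- The rotation number of the square of the billiard map on the level `m > b`. -/
noncomputable def libRot (m : ℝ) : ℝ :=
  E.libInt m (Real.arcsin (E.b / E.a)) / E.libInt m (Real.pi / 2)

variable (E) in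
/-- The upper invariant curve of level `m`, parametrized by the angle coordinate in which the
square of the billiard map is a rotation. -/
noncomputable def libCurve (m : ℝ) (h : E.b < m) (h' : m < E.a) (t : ℝ) : E.Phase :=
  E.libPt m ((E.dual m h h').normAngleInv E.b t)

section

variable {m : ℝ} (h : E.b < m) (h' : m < E.a)
include h h'

theorem two_mul_rotNum_dual : 2 * (E.dual m h h').rotNum E.b = E.libRot m := by
  have hV := sq_lt_dual h h'
  have h1 : (E.dual m h h').angleInt E.b (Real.arcsin (E.b / (E.dual m h h').a)) =
    E.libInt m (Real.arcsin (E.b / E.a)) := rfl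
  have h2 : (E.dual m h h').angleInt E.b (Real.pi / 2) = E.libInt m (Real.pi / 2) := rfl
  have h3 := angleInt_pi_pos hV
  rw [angleInt_pi hV, h2] at h3
  rw [rotNum, normAngle, angleInt_pi hV, h1, h2, libRot]
  field_simp

/-- The billiard map exchanges the upper invariant curve and its mirror image. -/
theorem billiard_libCurve (t : ℝ) : E.billiard (E.libCurve m h h' t) =
    E.mirror (E.libCurve m h h' (t + (E.dual m h h').rotNum E.b)) := by
  have hV := sq_lt_dual h h'
  obtain ⟨ψ, hψ⟩ := sub_halfChord_surjective (E := E.dual m h h') (m := E.b)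
    ((E.dual m h h').normAngleInv E.b t)
  simp only at hψ
  have h3 := normAngle_chord hV ψ
  rw [hψ, normAngle_normAngleInv hV] at h3
  rw [libCurve, libCurve, ← hψ, billiard_libPt h h', ← h3, normAngleInv_normAngle hV]

theorem libCurve_mem_openPhase (t : ℝ) : E.libCurve m h h' t ∈ E.openPhase :=
  libPt_mem_openPhase h h' _

theorem libCurve_fst_one_pos (t : ℝ) : 0 < (E.libCurve m h h' t).1.1 1 :=
  libPt_fst_one_pos h h' _

theorem billiard_billiard_libCurve (t : ℝ) : E.billiard (E.billiard (E.libCurve m h h' t)) =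
    E.libCurve m h h' (t + E.libRot m) := by
  rw [billiard_libCurve, billiard_mirror (libCurve_mem_openPhase h h' _), billiard_libCurve,
    mirror_mirror, add_assoc, ← two_mul, two_mul_rotNum_dual]

theorem libCurve_periodic : Function.Periodic (E.libCurve m h h') 1 := fun t => by
  rw [libCurve, libCurve, normAngleInv_add_one (sq_lt_dual h h'), libPt, libPt,
    Real.cos_add_two_pi, Real.sin_add_two_pi]

theorem continuous_libCurve : Continuous (E.libCurve m h h') := by
  have hc := continuous_normAngleInv (sq_lt_dual h h')
  unfold libCurve libPt
  refine continuous_phasePt (Real.continuous_arccos.comp ?_) ?_ <;> fun_prop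

theorem exists_int_of_libCurve_eq {s t : ℝ} (hst : E.libCurve m h h' s = E.libCurve m h h' t) :
    ∃ n : ℤ, s = t + n := by
  obtain ⟨h1, h2, h3, h4⟩ := lib_pos h h'
  have he : 0 < √(E.a ^ 2 - m ^ 2) := Real.sqrt_pos.2 h2
  have hc : 0 < √(E.a ^ 2 - E.b ^ 2) := Real.sqrt_pos.2 h3
  have hV := sq_lt_dual h h'
  rw [libCurve, libCurve] at hst
  set x := (E.dual m h h').normAngleInv E.b s with hx
  set y := (E.dual m h h').normAngleInv E.b t with hy
  have hcos : Real.cos x = Real.cos y := by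
    have := congrArg (fun p : E.Phase => p.1.1 0) hst
    simp only [libPt_fst_zero h h'] at this
    exact mul_left_cancel₀ (div_pos he hc).ne' (mul_left_cancel₀ E.a_pos.ne' this)
  have hsin : Real.sin x = Real.sin y := by
    have := congrArg (fun p : E.Phase => Real.cos p.2) hst
    have hb : ∀ z : ℝ, |√(E.a ^ 2 - m ^ 2) * Real.sin z /
        √(m ^ 2 + (E.a ^ 2 - m ^ 2) * Real.sin z ^ 2)| ≤ 1 := by
      intro z
      have : 0 < m ^ 2 + (E.a ^ 2 - m ^ 2) * Real.sin z ^ 2 := by positivity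
      rw [abs_div, abs_of_pos (Real.sqrt_pos.2 this), div_le_one (Real.sqrt_pos.2 this)]
      apply Real.abs_le_sqrt
      rw [mul_pow, Real.sq_sqrt h2.le]
      linarith [sq_nonneg m]
    simp only [libPt, phasePt_snd, libPt_speedSq h h'] at this
    rw [Real.cos_arccos (abs_le.1 (hb x)).1 (abs_le.1 (hb x)).2,
      Real.cos_arccos (abs_le.1 (hb y)).1 (abs_le.1 (hb y)).2] at this
    have hsq : Real.sin x ^ 2 = Real.sin y ^ 2 := by
      rw [Real.sin_sq, Real.sin_sq, hcos]
    rw [hsq] at this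
    have hp : 0 < √(m ^ 2 + (E.a ^ 2 - m ^ 2) * Real.sin y ^ 2) :=
      Real.sqrt_pos.2 (by positivity)
    exact mul_left_cancel₀ he.ne' ((div_left_inj' hp.ne').1 this)
  obtain ⟨n, hn⟩ := (Real.Angle.angle_eq_iff_two_pi_dvd_sub).1
    (Real.Angle.cos_sin_inj hcos hsin)
  refine ⟨n, ?_⟩
  have : x = y + n * (2 * Real.pi) := by linarith
  have h5 := normAngle_add_int_mul_two_pi hV y n
  rw [← this, hx, hy, normAngle_normAngleInv hV, normAngle_normAngleInv hV] at h5
  exact h5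

end

theorem exists_libCurve {p : E.Phase} (h : E.b < level p) (h' : level p < E.a)
    (hp : 0 < p.1.1 1) : ∃ t, p = E.libCurve (level p) h h' t := by
  obtain ⟨h1, h2, h3, h4⟩ := lib_pos h h'
  have he : 0 < √(E.a ^ 2 - level p ^ 2) := Real.sqrt_pos.2 h2
  have hc : 0 < √(E.a ^ 2 - E.b ^ 2) := Real.sqrt_pos.2 h3
  obtain ⟨φ, hφ⟩ := exists_param p
  have hl : level p = Real.sin p.2 * √(E.speedSq φ) := by
    conv_lhs => rw [hφ, level_param φ p.2.2]
  have hs : 0 < Real.sin φ := by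
    rw [hφ] at hp
    have : 0 < E.b * Real.sin φ := by simpa [param] using hp
    exact pos_of_mul_pos_right this E.b_pos.le
  have hsq : (√(E.a ^ 2 - E.b ^ 2) * Real.cos φ / √(E.a ^ 2 - level p ^ 2)) ^ 2 +
      (√(E.speedSq φ) * Real.cos p.2 / √(E.a ^ 2 - level p ^ 2)) ^ 2 = 1 := by
    rw [div_pow, div_pow, ← add_div, Real.sq_sqrt h2.le, div_eq_one_iff_eq h2.ne', mul_pow,
      mul_pow, Real.sq_sqrt h3.le, sq_sqrt_speedSq, hl, mul_pow, sq_sqrt_speedSq,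
      Real.sin_sq, speedSq_eq_sub_cos]
    ring
  obtain ⟨ψ, hψc, hψs⟩ := exists_angle_of_sq_add_sq hsq
  refine ⟨(E.dual _ h h').normAngle E.b ψ, ?_⟩
  rw [libCurve, normAngleInv_normAngle (sq_lt_dual h h'), libPt_eq hs, hψs,
    mul_div_cancel₀ _ he.ne', ← param_eq_phasePt φ p.2.2, ← hφ]
  rw [hψc]
  field_simp

end Ellipse

namespace Ellipse

variable {E : Ellipse}

/-! ### Monotonicity of the rotation number on the levels above `b` -/

theorem libInt_arg_pos {m : ℝ} (h : E.b < m) (h' : m ≤ E.a) (s : ℝ) :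
    0 < m ^ 2 + (E.a ^ 2 - m ^ 2) * Real.sin s ^ 2 - E.b ^ 2 := by
  have hb := E.b_pos
  have h1 : E.b ^ 2 < m ^ 2 := pow_lt_pow_left₀ h hb.le two_ne_zero
  have h2 : m ^ 2 ≤ E.a ^ 2 := pow_le_pow_left₀ (hb.trans h).le h' 2
  nlinarith [mul_nonneg (sub_nonneg.2 h2) (sq_nonneg (Real.sin s))]

theorem continuous_libInt_integrand {m : ℝ} (h : E.b < m) (h' : m ≤ E.a) : Continuous fun s : ℝ =>
    1 / √(m ^ 2 + (E.a ^ 2 - m ^ 2) * Real.sin s ^ 2 - E.b ^ 2) := by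
  refine continuous_const.div (by fun_prop) fun s => ?_
  exact (Real.sqrt_pos.2 (libInt_arg_pos h h' s)).ne'

variable (E) in
theorem arcsin_ratio_pos : 0 < Real.arcsin (E.b / E.a) :=
  Real.arcsin_pos.2 (div_pos E.b_pos E.a_pos)

theorem arcsin_ratio_lt (h : E.b < E.a) : Real.arcsin (E.b / E.a) < Real.pi / 2 :=
  Real.arcsin_lt_pi_div_two.2 ((div_lt_one E.a_pos).2 h)

theorem libInt_pos {m : ℝ} (h : E.b < m) (h' : m ≤ E.a) {x : ℝ} (hx : 0 < x) :
    0 < E.libInt m x :=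
  intervalIntegral.intervalIntegral_pos_of_pos
    ((continuous_libInt_integrand h h').intervalIntegrable _ _)
    (fun s => one_div_pos.2 (Real.sqrt_pos.2 (libInt_arg_pos h h' s))) hx

theorem libInt_add {m : ℝ} (h : E.b < m) (h' : m ≤ E.a) (x y : ℝ) : E.libInt m y =
    E.libInt m x + ∫ s in x..y, 1 / √(m ^ 2 + (E.a ^ 2 - m ^ 2) * Real.sin s ^ 2 - E.b ^ 2) := by
  have hi := fun x y => (continuous_libInt_integrand h h').intervalIntegrable
    (μ := MeasureTheory.volume) x y
  exact (intervalIntegral.integral_add_adjacent_intervals (hi 0 x) (hi x y)).symm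

/-- The quotient of the integrands of the levels `m < n` is monotone; the form with products avoids
dividing by the integrands. -/
theorem libInt_cross_le {m n : ℝ} (hm : E.b < m) (hmn : m < n) (hn : n ≤ E.a) {s x : ℝ}
    (hs : 0 ≤ s) (hsx : s ≤ x) (hx : x ≤ Real.pi / 2) :
    1 / √(m ^ 2 + (E.a ^ 2 - m ^ 2) * Real.sin s ^ 2 - E.b ^ 2) *
      (1 / √(n ^ 2 + (E.a ^ 2 - n ^ 2) * Real.sin x ^ 2 - E.b ^ 2)) ≥
    1 / √(n ^ 2 + (E.a ^ 2 - n ^ 2) * Real.sin s ^ 2 - E.b ^ 2) *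
      (1 / √(m ^ 2 + (E.a ^ 2 - m ^ 2) * Real.sin x ^ 2 - E.b ^ 2)) := by
  have p1 := libInt_arg_pos hm (hmn.le.trans hn) s
  have p2 := libInt_arg_pos hm (hmn.le.trans hn) x
  have p3 := libInt_arg_pos (hm.trans hmn) hn s
  have p4 := libInt_arg_pos (hm.trans hmn) hn x
  have hsin : Real.sin s ^ 2 ≤ Real.sin x ^ 2 :=
    pow_le_pow_left₀ (Real.sin_nonneg_of_nonneg_of_le_pi hs (by linarith))
      (Real.sin_le_sin_of_le_of_le_pi_div_two (by linarith [Real.pi_pos]) hx hsx) 2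
  rw [ge_iff_le, one_div_mul_one_div, one_div_mul_one_div, ← Real.sqrt_mul p1.le,
    ← Real.sqrt_mul p3.le]
  apply one_div_le_one_div_of_le (Real.sqrt_pos.2 (mul_pos p1 p4))
  apply Real.sqrt_le_sqrt
  have hb := E.b_pos
  have q1 : m ^ 2 < n ^ 2 := pow_lt_pow_left₀ hmn (hb.trans hm).le two_ne_zero
  have q2 : 0 < E.a ^ 2 - E.b ^ 2 := by
    have : E.b ^ 2 < E.a ^ 2 := pow_lt_pow_left₀ (by linarith) hb.le two_ne_zero
    linarith
  nlinarith [mul_nonneg (mul_pos q2 (sub_pos.2 q1)).le (sub_nonneg.2 hsin)]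

theorem libInt_cross_lt {m n : ℝ} (hm : E.b < m) (hmn : m < n) (hn : n ≤ E.a) {s x : ℝ}
    (hs : 0 ≤ s) (hsx : s < x) (hx : x ≤ Real.pi / 2) :
    1 / √(n ^ 2 + (E.a ^ 2 - n ^ 2) * Real.sin s ^ 2 - E.b ^ 2) *
      (1 / √(m ^ 2 + (E.a ^ 2 - m ^ 2) * Real.sin x ^ 2 - E.b ^ 2)) <
    1 / √(m ^ 2 + (E.a ^ 2 - m ^ 2) * Real.sin s ^ 2 - E.b ^ 2) *
      (1 / √(n ^ 2 + (E.a ^ 2 - n ^ 2) * Real.sin x ^ 2 - E.b ^ 2)) := by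
  have p1 := libInt_arg_pos hm (hmn.le.trans hn) s
  have p2 := libInt_arg_pos hm (hmn.le.trans hn) x
  have p3 := libInt_arg_pos (hm.trans hmn) hn s
  have p4 := libInt_arg_pos (hm.trans hmn) hn x
  have hsin : Real.sin s ^ 2 < Real.sin x ^ 2 :=
    pow_lt_pow_left₀ (Real.sin_lt_sin_of_lt_of_le_pi_div_two (by linarith [Real.pi_pos]) hx hsx)
      (Real.sin_nonneg_of_nonneg_of_le_pi hs (by linarith)) two_ne_zero
  rw [one_div_mul_one_div, one_div_mul_one_div, ← Real.sqrt_mul p1.le,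
    ← Real.sqrt_mul p3.le]
  apply one_div_lt_one_div_of_lt (Real.sqrt_pos.2 (mul_pos p1 p4))
  apply Real.sqrt_lt_sqrt (mul_pos p1 p4).le
  have hb := E.b_pos
  have q1 : m ^ 2 < n ^ 2 := pow_lt_pow_left₀ hmn (hb.trans hm).le two_ne_zero
  have q2 : 0 < E.a ^ 2 - E.b ^ 2 := by
    have : E.b ^ 2 < E.a ^ 2 := pow_lt_pow_left₀ (by linarith) hb.le two_ne_zero
    linarith
  nlinarith [mul_pos (mul_pos q2 (sub_pos.2 q1)) (sub_pos.2 hsin)]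

/-- The quotient of the densities of two levels is strictly monotone on `[0, π / 2]`; therefore
the rotation number is a strictly monotone function of the level. -/
theorem libRot_lt {m n : ℝ} (hm : E.b < m) (hmn : m < n) (hn : n ≤ E.a) :
    E.libRot n < E.libRot m := by
  set x := Real.arcsin (E.b / E.a) with hx
  have hx0 : 0 < x := E.arcsin_ratio_pos
  have hx1 : x < Real.pi / 2 := arcsin_ratio_lt (hm.trans (hmn.trans_le hn))
  have hma := hmn.le.trans hn
  have hbn := hm.trans hmn
  set g : ℝ → ℝ → ℝ := fun m s => 1 / √(m ^ 2 + (E.a ^ 2 - m ^ 2) * Real.sin s ^ 2 - E.b ^ 2)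
  have hgm : Continuous (g m) := continuous_libInt_integrand hm hma
  have hgn : Continuous (g n) := continuous_libInt_integrand hbn hn
  have g1 : 0 < g m x := one_div_pos.2 (Real.sqrt_pos.2 (libInt_arg_pos hm hma x))
  have g2 : 0 < g n x := one_div_pos.2 (Real.sqrt_pos.2 (libInt_arg_pos hbn hn x))
  have hA : g m x * E.libInt n x ≤ g n x * E.libInt m x := by
    unfold libInt
    rw [← intervalIntegral.integral_const_mul, ← intervalIntegral.integral_const_mul]
    refine intervalIntegral.integral_mono_on hx0.le
      ((hgn.const_mul _).intervalIntegrable _ _) ((hgm.const_mul _).intervalIntegrable _ _) ?_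
    intro s hs
    have := libInt_cross_le hm hmn hn hs.1 hs.2 hx1.le
    linarith
  have hB : g n x * (∫ s in x..Real.pi / 2, g m s) < g m x * ∫ s in x..Real.pi / 2, g n s := by
    rw [← intervalIntegral.integral_const_mul, ← intervalIntegral.integral_const_mul]
    refine intervalIntegral.integral_lt_integral_of_continuousOn_of_le_of_exists_lt hx1
      (hgm.const_mul _).continuousOn (hgn.const_mul _).continuousOn ?_ ?_
    · intro s hs
      have := libInt_cross_lt hm hmn hn hx0.le hs.1 hs.2
      exact this.le
    · exact ⟨Real.pi / 2, ⟨hx1.le, le_rfl⟩, libInt_cross_lt hm hmn hn hx0.le hx1 le_rfl⟩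
  have hAm := libInt_pos hm hma hx0
  have hAn := libInt_pos hbn hn hx0
  rw [libRot, libRot, div_lt_div_iff₀ (libInt_pos hbn hn (by linarith))
    (libInt_pos hm hma (by linarith)), libInt_add hm hma x (Real.pi / 2),
    libInt_add hbn hn x (Real.pi / 2)]
  change E.libInt n x * (E.libInt m x + ∫ s in x..Real.pi / 2, g m s) <
    E.libInt m x * (E.libInt n x + ∫ s in x..Real.pi / 2, g n s)
  have key : E.libInt n x * (∫ s in x..Real.pi / 2, g m s) <
      E.libInt m x * ∫ s in x..Real.pi / 2, g n s := by
    have hB0 : 0 < ∫ s in x..Real.pi / 2, g n s :=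
      intervalIntegral.intervalIntegral_pos_of_pos (hgn.intervalIntegrable _ _)
        (fun s => one_div_pos.2 (Real.sqrt_pos.2 (libInt_arg_pos hbn hn s))) hx1
    have k1 := mul_lt_mul_of_pos_left hB hAn
    have k2 := mul_le_mul_of_nonneg_right hA hB0.le
    have k3 : g n x * (E.libInt n x * ∫ s in x..Real.pi / 2, g m s) <
        g n x * (E.libInt m x * ∫ s in x..Real.pi / 2, g n s) := by
      linarith
    exact lt_of_mul_lt_mul_left k3 g2.le
  linarith

/-- On the level of the two-periodic orbit the integrand is constant. -/
theorem libRot_a (h : E.b < E.a) : E.libRot E.a = 2 / Real.pi * Real.arcsin (E.b / E.a) := by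
  have h1 : 0 < E.a ^ 2 - E.b ^ 2 := by
    have := pow_lt_pow_left₀ h E.b_pos.le two_ne_zero
    linarith
  have h2 := Real.sqrt_pos.2 h1
  have hp := Real.pi_pos
  simp only [libRot, libInt, sub_self, zero_mul, add_zero, intervalIntegral.integral_const,
    smul_eq_mul]
  field_simp
  ring

theorem libRot_lt_one {m : ℝ} (h : E.b < m) (h' : m ≤ E.a) : E.libRot m < 1 := by
  have hx1 : Real.arcsin (E.b / E.a) < Real.pi / 2 := arcsin_ratio_lt (h.trans_le h')
  rw [libRot, div_lt_one (libInt_pos h h' (by positivity)),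
    libInt_add h h' (Real.arcsin (E.b / E.a)) (Real.pi / 2)]
  have := intervalIntegral.intervalIntegral_pos_of_pos
    ((continuous_libInt_integrand h h').intervalIntegrable _ _)
    (fun s => one_div_pos.2 (Real.sqrt_pos.2 (libInt_arg_pos h h' s))) hx1
  linarith

theorem libRot_pos {m : ℝ} (h : E.b < m) (h' : m ≤ E.a) : 0 < E.libRot m :=
  div_pos (libInt_pos h h' E.arcsin_ratio_pos) (libInt_pos h h' (by positivity))

/-- An upper bound that tends to `libRot a` as `m → a`, by bounding the integrand above in the
numerator and below in the denominator. -/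
theorem libRot_le {m : ℝ} (h : E.b < m) (h' : m ≤ E.a) : E.libRot m ≤
    E.libRot E.a * (√(E.a ^ 2 - E.b ^ 2) / √(m ^ 2 - E.b ^ 2)) := by
  have hx0 := E.arcsin_ratio_pos
  have hb := E.b_pos
  have h1 : E.b ^ 2 < m ^ 2 := pow_lt_pow_left₀ h hb.le two_ne_zero
  have h2 : m ^ 2 ≤ E.a ^ 2 := pow_le_pow_left₀ (hb.trans h).le h' 2
  have p1 : 0 < √(m ^ 2 - E.b ^ 2) := Real.sqrt_pos.2 (by linarith)
  have p2 : 0 < √(E.a ^ 2 - E.b ^ 2) := Real.sqrt_pos.2 (by linarith)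
  have hi := fun x y => (continuous_libInt_integrand h h').intervalIntegrable
    (μ := MeasureTheory.volume) x y
  have hc := fun (c : ℝ) x y => (continuous_const (y := c)).intervalIntegrable
    (μ := MeasureTheory.volume) x y
  have hA : E.libInt m (Real.arcsin (E.b / E.a)) ≤
      Real.arcsin (E.b / E.a) * (1 / √(m ^ 2 - E.b ^ 2)) := by
    have := intervalIntegral.integral_mono_on hx0.le (hi _ _) (hc (1 / √(m ^ 2 - E.b ^ 2)) _ _)
      (fun s _ => one_div_le_one_div_of_le p1 (Real.sqrt_le_sqrt (by
        nlinarith [mul_nonneg (sub_nonneg.2 h2) (sq_nonneg (Real.sin s))])))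
    simpa [libInt] using this
  have hB : Real.pi / 2 * (1 / √(E.a ^ 2 - E.b ^ 2)) ≤ E.libInt m (Real.pi / 2) := by
    have := intervalIntegral.integral_mono_on (a := 0) (b := Real.pi / 2) (by positivity)
      (hc (1 / √(E.a ^ 2 - E.b ^ 2)) _ _) (hi _ _)
      (fun s _ => one_div_le_one_div_of_le (Real.sqrt_pos.2 (libInt_arg_pos h h' s))
        (Real.sqrt_le_sqrt (by
        nlinarith [mul_nonneg (sub_nonneg.2 h2) (sub_nonneg.2 (Real.sin_sq_le_one s))])))
    simpa [libInt] using this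
  rw [libRot_a (h.trans_le h'), libRot]
  calc _ ≤ Real.arcsin (E.b / E.a) * (1 / √(m ^ 2 - E.b ^ 2)) /
        (Real.pi / 2 * (1 / √(E.a ^ 2 - E.b ^ 2))) :=
        div_le_div₀ (by positivity) hA (by positivity) hB
    _ = _ := by field_simp

theorem tendsto_libRot (h : E.b < E.a) :
    Filter.Tendsto E.libRot (nhdsWithin E.a (Set.Iio E.a)) (nhds (E.libRot E.a)) := by
  have hev : ∀ᶠ m in nhdsWithin E.a (Set.Iio E.a), E.b < m ∧ m < E.a :=
    Filter.Eventually.and (eventually_nhdsWithin_of_eventually_nhds (lt_mem_nhds h))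
      self_mem_nhdsWithin
  have hp : 0 < √(E.a ^ 2 - E.b ^ 2) := Real.sqrt_pos.2 (by
    have := pow_lt_pow_left₀ h E.b_pos.le two_ne_zero
    linarith)
  refine tendsto_of_tendsto_of_tendsto_of_le_of_le' tendsto_const_nhds ?_
    (hev.mono fun m hm => (libRot_lt hm.1 hm.2 le_rfl).le)
    (hev.mono fun m hm => libRot_le hm.1 hm.2.le)
  have : Filter.Tendsto (fun m : ℝ => E.libRot E.a * (√(E.a ^ 2 - E.b ^ 2) / √(m ^ 2 - E.b ^ 2)))
      (nhds E.a) (nhds (E.libRot E.a * (√(E.a ^ 2 - E.b ^ 2) / √(E.a ^ 2 - E.b ^ 2)))) := by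
    apply Filter.Tendsto.const_mul
    apply Filter.Tendsto.div tendsto_const_nhds _ hp.ne'
    exact ((continuous_id.pow 2).sub continuous_const).sqrt.tendsto E.a
  rw [div_self hp.ne', mul_one] at this
  exact this.mono_left nhdsWithin_le_nhds

end Ellipse

/-! ### Rigidity of rotations of the circle -/

instance Real.Angle.instCompactSpace : CompactSpace Real.Angle :=
  have : Fact (0 < 2 * Real.pi) := ⟨Real.two_pi_pos⟩
  inferInstanceAs (CompactSpace (AddCircle (2 * Real.pi)))

/-- A continuous injective endomorphism of the circle is the identity or the inversion. Up to the
inversion it maps the upper half circle to itself, because it fixes the two points where the sine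
vanishes; hence it fixes all dyadic points. -/
theorem Real.Angle.eq_or_eq_neg_of_continuous_injective (σ : Real.Angle →+ Real.Angle)
    (hc : Continuous σ) (hi : Function.Injective σ) :
    (∀ x, σ x = x) ∨ ∀ x, σ x = -x := by
  have hpi : σ (Real.pi : Real.Angle) = (Real.pi : Real.Angle) := by
    have h1 : (2 : ℕ) • σ (Real.pi : Real.Angle) = 0 := by
      rw [← map_nsmul, Real.Angle.two_nsmul_coe_pi, map_zero]
    rcases Real.Angle.two_nsmul_eq_zero_iff.1 h1 with h | h
    · rw [← map_zero σ] at h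
      exact absurd (hi h) Real.Angle.pi_ne_zero
    · exact h
  have hne : ∀ t ∈ Set.Ioo (0 : ℝ) Real.pi, Real.Angle.sin (σ (t : Real.Angle)) ≠ 0 := by
    intro t ht h0
    have hs : Real.Angle.sin (t : Real.Angle) ≠ 0 := by
      rw [Real.Angle.sin_coe]; exact (Real.sin_pos_of_pos_of_lt_pi ht.1 ht.2).ne'
    apply hs
    rcases Real.Angle.sin_eq_zero_iff.1 h0 with h | h
    · rw [← map_zero σ] at h
      rw [hi h, Real.Angle.sin_zero]
    · rw [← hpi] at h
      rw [hi h, Real.Angle.sin_coe_pi]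
  have hcont : Continuous fun t : ℝ => Real.Angle.sin (σ (t : Real.Angle)) :=
    Real.Angle.continuous_sin.comp (hc.comp Real.Angle.continuous_coe)
  have key : ∀ τ : Real.Angle →+ Real.Angle, Continuous τ → τ (Real.pi : Real.Angle) = Real.pi →
      (∀ t ∈ Set.Ioo (0 : ℝ) Real.pi, 0 < Real.Angle.sin (τ (t : Real.Angle))) →
      ∀ x, τ x = x := by
    intro τ hτ hτpi hpos
    have hdy : ∀ n : ℕ, τ ((Real.pi / 2 ^ n : ℝ) : Real.Angle) =
        ((Real.pi / 2 ^ n : ℝ) : Real.Angle) := by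
      intro n
      induction n with
      | zero => simpa using hτpi
      | succ n ih =>
        have hmem : Real.pi / 2 ^ (n + 1) ∈ Set.Ioo (0 : ℝ) Real.pi :=
          ⟨by positivity, div_lt_self Real.pi_pos (one_lt_pow₀ one_lt_two n.succ_ne_zero)⟩
        have h2 : (2 : ℕ) • ((Real.pi / 2 ^ (n + 1) : ℝ) : Real.Angle) =
            ((Real.pi / 2 ^ n : ℝ) : Real.Angle) := by
          rw [← Real.Angle.coe_nsmul]
          congr 1
          rw [pow_succ]; simp; field_simp
        have h3 : (2 : ℕ) • τ ((Real.pi / 2 ^ (n + 1) : ℝ) : Real.Angle) =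
            (2 : ℕ) • ((Real.pi / 2 ^ (n + 1) : ℝ) : Real.Angle) := by
          rw [← map_nsmul, h2, ih]
        rcases Real.Angle.two_nsmul_eq_iff.1 h3 with h | h
        · exact h
        · have h4 := hpos _ hmem
          rw [h, Real.Angle.sin_add_pi, Real.Angle.sin_coe] at h4
          linarith [Real.sin_pos_of_pos_of_lt_pi hmem.1 hmem.2]
    let S : AddSubgroup ℝ :=
      (τ.comp Real.Angle.coeHom - Real.Angle.coeHom).ker
    have hS : ∀ t, t ∈ S ↔ τ (t : Real.Angle) = (t : Real.Angle) := fun t => by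
      simp only [S, AddMonoidHom.mem_ker, AddMonoidHom.sub_apply, AddMonoidHom.comp_apply,
        Real.Angle.coe_coeHom, sub_eq_zero]
    have hdense : Dense (S : Set ℝ) := by
      refine AddSubgroup.dense_of_not_isolated_zero S fun ε hε => ?_
      obtain ⟨n, hn⟩ := exists_pow_lt_of_lt_one (div_pos hε Real.pi_pos)
        (show (1 / 2 : ℝ) < 1 by norm_num)
      refine ⟨Real.pi / 2 ^ n, (hS _).2 (hdy n), by positivity, ?_⟩
      rw [lt_div_iff₀ Real.pi_pos] at hn
      calc Real.pi / 2 ^ n = (1 / 2) ^ n * Real.pi := by rw [div_pow, one_pow]; ring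
        _ < ε := hn
    have hclosed : IsClosed (S : Set ℝ) := by
      have : (S : Set ℝ) = {t : ℝ | τ (t : Real.Angle) = (t : Real.Angle)} :=
        Set.ext fun t => hS t
      rw [this]
      exact isClosed_eq (hτ.comp Real.Angle.continuous_coe) Real.Angle.continuous_coe
    intro x
    induction x using Real.Angle.induction_on with
    | _ t => exact (hS t).1 (by rw [← SetLike.mem_coe, ← hclosed.closure_eq]; exact hdense t)
  have hmid : Real.pi / 2 ∈ Set.Ioo (0 : ℝ) Real.pi := ⟨by positivity, by linarith [Real.pi_pos]⟩
  rcases lt_or_gt_of_ne (hne _ hmid) with hlt | hgt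
  · right
    have := key (-σ) hc.neg (by
      rw [AddMonoidHom.neg_apply, hpi, Real.Angle.neg_coe_pi]) (fun t ht => by
        rw [AddMonoidHom.neg_apply, Real.Angle.sin_neg, neg_pos]
        by_contra hcon
        obtain ⟨s, hs, hs0⟩ := isPreconnected_Ioo.intermediate_value hmid ht hcont.continuousOn
          ⟨hlt.le, not_lt.1 hcon⟩
        exact hne s hs hs0)
    exact fun x => neg_eq_iff_eq_neg.1 (this x)
  · left
    refine key σ hc hpi fun t ht => ?_
    by_contra hcon
    obtain ⟨s, hs, hs0⟩ := isPreconnected_Ioo.intermediate_value ht hmid hcont.continuousOn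
      ⟨not_lt.1 hcon, hgt.le⟩
    exact hne s hs hs0

/-- The rotation number of a minimal rotation of the circle is determined, up to its sign, by the
conjugacy class of the rotation. -/
theorem Real.Angle.rotation_eq_or_eq_neg {k : Real.Angle → Real.Angle} (hk : Continuous k)
    (hi : Function.Injective k) {α β : Real.Angle} (hα : DenseRange fun n : ℕ => n • α)
    (h : ∀ x, k (x + α) = k x + β) : β = α ∨ β = -α := by
  have hn : ∀ (n : ℕ) x, k (x + n • α) = k x + n • β := by
    intro n x
    induction n with
    | zero => simp
    | succ n ih => rw [succ_nsmul, ← add_assoc, h, ih, succ_nsmul, add_assoc]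
  have hadd : ∀ x y, k (x + y) + k 0 = k x + k y := by
    intro x
    refine fun y => hα.induction_on (p := fun y => k (x + y) + k 0 = k x + k y) y ?_ ?_
    · exact isClosed_eq (by fun_prop) (by fun_prop)
    · intro n
      have h0 := hn n 0
      rw [zero_add] at h0
      rw [hn, h0]; abel
  let σ : Real.Angle →+ Real.Angle :=
    { toFun := fun x => k x - k 0
      map_zero' := sub_self _
      map_add' := fun x y => by
        have := hadd x y
        rw [sub_eq_iff_eq_add, eq_sub_of_add_eq this]; abel }
  have hσα : σ α = β := by
    change k α - k 0 = β
    have := h 0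
    rw [zero_add] at this
    rw [this]; abel
  rcases Real.Angle.eq_or_eq_neg_of_continuous_injective σ (hk.sub continuous_const)
    (fun x y hxy => hi (sub_left_inj.1 hxy)) with h | h
  · left; rw [← hσα, h]
  · right; rw [← hσα, h]

/-- A map that conjugates two rotations of topological circles identifies their rotation numbers
up to sign. -/
theorem Real.Angle.rotation_eq_or_eq_neg_of_semiconj {X Y : Type*} [TopologicalSpace X]
    [TopologicalSpace Y] [T2Space Y] {F : X → X} {G : Y → Y} {h : X → Y}
    {Γ : Real.Angle → X} {Δ : Real.Angle → Y} (hΔ : Continuous Δ) (hΔi : Function.Injective Δ)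
    (hh : Continuous (h ∘ Γ)) (hhi : Function.Injective (h ∘ Γ)) {α β : Real.Angle}
    (hF : ∀ x, F (Γ x) = Γ (x + α)) (hG : ∀ x, G (Δ x) = Δ (x + β))
    (hFG : ∀ x, h (F (Γ x)) = G (h (Γ x))) (h0 : ∃ y, h (Γ 0) = Δ y)
    (hα : DenseRange fun n : ℕ => n • α) : β = α ∨ β = -α := by
  have hcl : Topology.IsClosedEmbedding Δ := hΔ.isClosedEmbedding hΔi
  have hr : ∀ x, h (Γ x) ∈ Set.range Δ := by
    intro x
    refine hα.induction_on (p := fun x => h (Γ x) ∈ Set.range Δ) x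
      (hcl.isClosed_range.preimage hh) fun n => ?_
    induction n with
    | zero =>
      obtain ⟨y, hy⟩ := h0
      exact ⟨y, by rw [zero_nsmul]; exact hy.symm⟩
    | succ n ih =>
      obtain ⟨y, hy⟩ := ih
      exact ⟨y + β, by rw [succ_nsmul, ← hF, hFG, ← hy, hG]⟩
  choose k hk using hr
  refine Real.Angle.rotation_eq_or_eq_neg (k := k) ?_ ?_ hα fun x => ?_
  · rw [hcl.isInducing.continuous_iff]
    exact hh.congr fun x => (hk x).symm
  · intro x y hxy
    apply hhi
    change h (Γ x) = h (Γ y)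
    rw [← hk, ← hk, hxy]
  · apply hΔi
    rw [hk, ← hG, hk, ← hFG, hF]

/-- The map of the circle induced by a function of period `1`. -/
noncomputable def Function.Periodic.angleLift {X : Type*} {Γ : ℝ → X} (h : Function.Periodic Γ 1) :
    Real.Angle → X :=
  Function.Periodic.lift (f := fun x => Γ (x / (2 * Real.pi))) (c := 2 * Real.pi) fun x => by
    simp only
    rw [add_div, div_self Real.two_pi_pos.ne', h]

theorem Function.Periodic.angleLift_coe {X : Type*} {Γ : ℝ → X} (h : Function.Periodic Γ 1)
    (t : ℝ) : h.angleLift ((2 * Real.pi * t : ℝ) : Real.Angle) = Γ t := by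
  change Γ (2 * Real.pi * t / (2 * Real.pi)) = Γ t
  rw [mul_div_cancel_left₀ _ Real.two_pi_pos.ne']

theorem Real.Angle.exists_eq_coe_two_pi_mul (x : Real.Angle) :
    ∃ t : ℝ, x = ((2 * Real.pi * t : ℝ) : Real.Angle) := by
  induction x using Real.Angle.induction_on with
  | _ s => exact ⟨s / (2 * Real.pi), by rw [mul_div_cancel₀ _ Real.two_pi_pos.ne']⟩

theorem Function.Periodic.continuous_angleLift {X : Type*} [TopologicalSpace X] {Γ : ℝ → X}
    (h : Function.Periodic Γ 1) (hc : Continuous Γ) : Continuous h.angleLift :=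
  continuous_coinduced_dom.2 (hc.comp (continuous_id.div_const _))

theorem Function.Periodic.angleLift_injective {X : Type*} {Γ : ℝ → X}
    (h : Function.Periodic Γ 1) (hi : ∀ s t, Γ s = Γ t → ∃ n : ℤ, s = t + n) :
    Function.Injective h.angleLift := by
  intro x y hxy
  obtain ⟨s, rfl⟩ := x.exists_eq_coe_two_pi_mul
  obtain ⟨t, rfl⟩ := y.exists_eq_coe_two_pi_mul
  rw [h.angleLift_coe, h.angleLift_coe] at hxy
  obtain ⟨n, hn⟩ := hi s t hxy
  rw [Real.Angle.angle_eq_iff_two_pi_dvd_sub]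
  exact ⟨n, by rw [hn]; ring⟩

theorem Real.Angle.denseRange_nsmul_of_irrational {r : ℝ} (hr : Irrational r) :
    DenseRange fun n : ℕ => n • ((2 * Real.pi * r : ℝ) : Real.Angle) := by
  have h1 : DenseRange fun n : ℤ => n • ((2 * Real.pi * r : ℝ) : AddCircle (2 * Real.pi)) := by
    rw [AddCircle.denseRange_zsmul_coe_iff, mul_div_cancel_left₀ _ Real.two_pi_pos.ne']
    exact hr
  exact denseRange_zsmul_iff_nsmul.1 h1

namespace Ellipse

variable {E : Ellipse}

/-! ### Generic points -/

theorem mirror_preimage_isOpen {V : Set E.Phase} (hV : IsOpen V) : IsOpen (E.mirror ⁻¹' V) :=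
  hV.preimage continuous_mirror

/-- Near a point of the open phase cylinder the conserved quantity takes all slightly smaller
values. -/
theorem exists_level_eq {V : Set E.Phase} (hV : IsOpen V) {p : E.Phase} (hp : p ∈ V)
    (hpo : p ∈ E.openPhase) : ∃ l₀ < level p, ∀ l ∈ Set.Ioo l₀ (level p), ∃ q ∈ V, level q = l := by
  wlog hθ : (p.2 : ℝ) ≤ Real.pi / 2 generalizing p V
  · obtain ⟨l₀, h1, h2⟩ := this (mirror_preimage_isOpen hV) (p := E.mirror p)
      (by rwa [Set.mem_preimage, mirror_mirror]) (mirror_mem_openPhase hpo)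
      (by change Real.pi - (p.2 : ℝ) ≤ Real.pi / 2; linarith)
    rw [level_mirror] at h1 h2
    refine ⟨l₀, h1, fun l hl => ?_⟩
    obtain ⟨q, hq, rfl⟩ := h2 l hl
    exact ⟨E.mirror q, hq, level_mirror q⟩
  obtain ⟨φ, h⟩ := exists_param p
  have hl : level p = Real.sin p.2 * √(E.speedSq φ) := by
    conv_lhs => rw [h, level_param φ p.2.2]
  have hD := E.sqrt_speedSq_pos φ
  let γ : ℝ → E.Phase := fun l => E.param (φ, Real.arcsin (l / √(E.speedSq φ)))
  have hγ : Continuous γ := E.continuous_param.comp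
    (continuous_const.prodMk (Real.continuous_arcsin.comp (continuous_id.div_const _)))
  have hγp : γ (level p) = p := by
    simp only [γ]
    rw [hl, mul_div_cancel_right₀ _ hD.ne', Real.arcsin_sin (by linarith [p.2.2.1, Real.pi_pos]) hθ,
      ← h]
  have hmem : γ ⁻¹' V ∈ nhds (level p) :=
    (hV.preimage hγ).mem_nhds (by rwa [Set.mem_preimage, hγp])
  obtain ⟨l₁, hl₁, hsub⟩ := exists_Ioc_subset_of_mem_nhds hmem ⟨_, sub_one_lt (level p)⟩
  have hp0 := mem_openPhase_iff.1 hpo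
  refine ⟨max l₁ 0, max_lt hl₁ hp0, fun l hll => ⟨γ l, hsub ⟨(le_max_left _ _).trans_lt hll.1,
    hll.2.le⟩, ?_⟩⟩
  have h0 : 0 < l := (le_max_right _ _).trans_lt hll.1
  have h1 : l / √(E.speedSq φ) ≤ 1 := by
    rw [div_le_one hD]
    calc l ≤ level p := hll.2.le
      _ ≤ 1 * √(E.speedSq φ) := by
        rw [hl]; exact mul_le_mul_of_nonneg_right (Real.sin_le_one _) hD.le
      _ = _ := one_mul _
  have h2 : 0 ≤ l / √(E.speedSq φ) := by positivity
  simp only [γ]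
  rw [level_param φ ⟨Real.arcsin_nonneg.2 h2,
      (Real.arcsin_le_pi_div_two _).trans (by linarith [Real.pi_pos])⟩,
    Real.sin_arcsin (by linarith) h1, div_mul_cancel₀ _ hD.ne']

theorem level_le_a (p : E.Phase) : level p ≤ E.a := by
  obtain ⟨φ, h⟩ := exists_param p
  rw [h, level_param φ p.2.2]
  calc Real.sin p.2 * √(E.speedSq φ) ≤ 1 * √(E.speedSq φ) :=
        mul_le_mul_of_nonneg_right (Real.sin_le_one _) (E.sqrt_speedSq_pos φ).le
    _ ≤ E.a := by
      rw [one_mul]; exact Real.sqrt_le_iff.2 ⟨E.a_pos.le, E.speedSq_le_a_sq φ⟩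

variable (E) in
/-- The upper librational region: the phase points over the upper half of the ellipse whose
trajectory crosses the major axis between the foci. -/
def upperLib : Set E.Phase := {p | E.b < level p ∧ 0 < p.1.1 1}

theorem isOpen_upperLib : IsOpen E.upperLib :=
  (isOpen_lt continuous_const continuous_level).inter
    (isOpen_lt continuous_const (by fun_prop : Continuous fun p : E.Phase => p.1.1 1))

theorem upperLib_subset_openPhase : E.upperLib ⊆ E.openPhase := fun _ hp =>
  mem_openPhase_iff.2 (E.b_pos.trans hp.1)

/-- Since the rotation number is strictly monotone in the level, the points of irrational rotation
number are dense in the librational region. -/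
theorem exists_irrational {V : Set E.Phase} (hV : IsOpen V) {p : E.Phase} (hp : p ∈ V)
    (hpl : p ∈ E.upperLib) : ∃ q ∈ V, q ∈ E.upperLib ∧ level q < E.a ∧
      Irrational (E.libRot (level q)) := by
  obtain ⟨l₀, hl₀, h⟩ := exists_level_eq (hV.inter isOpen_upperLib) ⟨hp, hpl⟩
    (upperLib_subset_openPhase hpl)
  set l₁ := max l₀ E.b
  have hl₁ : l₁ < level p := max_lt hl₀ hpl.1
  let S : Set ℝ := {l | l ∈ Set.Ioo l₁ (level p) ∧ E.libRot l ∈ Set.range ((↑) : ℚ → ℝ)}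
  have hS : S.Countable := by
    refine Set.MapsTo.countable_of_injOn (f := E.libRot) (t := Set.range ((↑) : ℚ → ℝ))
      (fun l hl => hl.2) ?_ (Set.countable_range _)
    have hanti : StrictAntiOn E.libRot S := fun x hx y hy hxy =>
      libRot_lt ((le_max_right _ _).trans_lt hx.1.1) hxy (hy.1.2.le.trans (level_le_a p))
    exact hanti.injOn
  obtain ⟨l, hlS, hl⟩ := (hS.dense_compl ℝ).exists_mem_open isOpen_Ioo (Set.nonempty_Ioo.2 hl₁)
  obtain ⟨q, hq, rfl⟩ := h l ⟨(le_max_left _ _).trans_lt hl.1, hl.2⟩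
  exact ⟨q, hq.1, hq.2, hl.2.trans_le (level_le_a p), fun hr => hlS ⟨hl, hr⟩⟩

/-! ### The two-periodic points on the minor axis -/

theorem billiard_billiard_of_level_eq {p : E.Phase} (h : E.b < E.a) (hp : level p = E.a) :
    E.billiard (E.billiard p) = p := by
  have ha := E.a_pos
  have hab : E.b ^ 2 < E.a ^ 2 := pow_lt_pow_left₀ h E.b_pos.le two_ne_zero
  have hpo : p ∈ E.openPhase := mem_openPhase_iff.2 (hp ▸ ha)
  obtain ⟨φ, hφ⟩ := exists_param p
  have hl : E.a ^ 2 = Real.sin p.2 ^ 2 * E.speedSq φ := by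
    rw [← E.sq_sqrt_speedSq, ← mul_pow, ← level_param φ p.2.2, ← hφ, hp]
  have hD := E.speedSq_le_a_sq φ
  have hDp := E.speedSq_pos φ
  have hs := Real.sin_sq_le_one (p.2 : ℝ)
  have hD' : E.speedSq φ = E.a ^ 2 := le_antisymm hD (by nlinarith)
  have hcos : Real.cos φ = 0 := by
    rw [speedSq_eq_sub_cos] at hD'
    have : (E.a ^ 2 - E.b ^ 2) * Real.cos φ ^ 2 = 0 := by linarith
    rcases mul_eq_zero.1 this with h0 | h0
    · linarith
    · exact pow_eq_zero_iff two_ne_zero |>.1 h0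
  have hcosθ : Real.cos (p.2 : ℝ) = 0 := by
    have : Real.sin (p.2 : ℝ) ^ 2 = 1 := by
      rw [hD'] at hl
      have : E.a ^ 2 * (Real.sin (p.2 : ℝ) ^ 2 - 1) = 0 := by linarith
      rcases mul_eq_zero.1 this with h0 | h0
      · nlinarith
      · linarith
    have := Real.sin_sq_add_cos_sq (p.2 : ℝ)
    exact pow_eq_zero_iff two_ne_zero |>.1 (by linarith)
  have hsin : Real.sin φ = 1 ∨ Real.sin φ = -1 := by
    have := Real.sin_sq_add_cos_sq φ
    rw [hcos] at this
    exact mul_self_eq_one_iff.1 (by nlinarith)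
  set z := E.phasePt (Real.pi / 2) 0 with hz
  have hmz : E.mirror z = E.phasePt (-(Real.pi / 2)) 0 := by rw [hz, mirror_phasePt, neg_zero]
  have hbz : E.billiard z = E.mirror z := by
    have := E.billiard_chord (σ := Real.pi) (δ := Real.pi / 2) (by simp)
    simp only [chordMom, Real.cos_neg, Real.cos_pi_div_two, Real.sin_pi, zero_mul, mul_zero,
      add_zero, zero_div] at this
    rw [show Real.pi - Real.pi / 2 = Real.pi / 2 by ring,
      show Real.pi + Real.pi / 2 = -(Real.pi / 2) + 2 * Real.pi by ring] at this
    rw [hmz, hz, this]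
    exact phasePt_congr (Real.cos_add_two_pi _) (Real.sin_add_two_pi _) _
  rw [param_eq_phasePt φ p.2.2, hcosθ, mul_zero] at hφ
  have hpz : p = z ∨ p = E.mirror z := by
    rcases hsin with h1 | h1
    · left
      rw [hφ]
      exact phasePt_congr (by rw [hcos, Real.cos_pi_div_two]) (by rw [h1, Real.sin_pi_div_two]) _
    · right
      rw [hφ, hmz]
      exact phasePt_congr (by rw [hcos, Real.cos_neg, Real.cos_pi_div_two])
        (by rw [h1, Real.sin_neg, Real.sin_pi_div_two]) _
  rcases hpz with rfl | h2
  · rw [hbz, billiard_mirror hpo, hbz, mirror_mirror]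
  · have hzo : z ∈ E.openPhase := by
      rw [h2] at hpo
      simpa [mirror_mirror] using mirror_mem_openPhase hpo
    rw [h2, billiard_mirror hzo, hbz, mirror_mirror, hbz]

theorem exists_mem_upperLib (h : E.b < E.a) : ∃ z ∈ E.upperLib, level z = E.a := by
  have hl : level (E.phasePt (Real.pi / 2) 0) = E.a := by
    rw [level_phasePt, speedSq, Real.sin_pi_div_two]
    rw [show E.b ^ 2 + (E.a ^ 2 - E.b ^ 2) * 1 ^ 2 - 0 ^ 2 = E.a ^ 2 by ring,
      Real.sqrt_sq E.a_pos.le]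
  refine ⟨E.phasePt (Real.pi / 2) 0, ⟨by rw [hl]; exact h, ?_⟩, hl⟩
  rw [phasePt_fst]
  simpa using E.b_pos

/-! ### Orbits on a level -/

theorem iterate_two_mul_libCurve {m : ℝ} (h : E.b < m) (h' : m < E.a) (t : ℝ) (n : ℕ) :
    E.billiard^[2 * n] (E.libCurve m h h' t) = E.libCurve m h h' (t + n * E.libRot m) := by
  induction n with
  | zero => simp
  | succ n ih =>
    rw [show 2 * (n + 1) = 2 * n + 1 + 1 by ring, Function.iterate_succ_apply',
      Function.iterate_succ_apply', ih, billiard_billiard_libCurve]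
    congr 1; push_cast; ring

/-- A librational point has the form `Γ 0` for a parametrization `Γ` of its invariant curve in
which the square of the billiard map is the rotation by `libRot`. -/
theorem exists_libParam {p : E.Phase} (h : E.b < level p) (h' : level p < E.a) :
    ∃ Γ : ℝ → E.Phase, Γ 0 = p ∧ Continuous Γ ∧ (∀ t, Γ t ∈ E.openPhase) ∧
      Function.Periodic Γ 1 ∧ (∀ s t, Γ s = Γ t → ∃ n : ℤ, s = t + n) ∧
      ∀ t, E.billiard (E.billiard (Γ t)) = Γ (t + E.libRot (level p)) := by
  -- the foot point is not on the major axis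
  have hne : p.1.1 1 ≠ 0 := by
    intro h0
    obtain ⟨φ, hφ⟩ := exists_param p
    have hs : Real.sin φ = 0 := by
      have h1 : (p.1.1 1) = E.b * Real.sin φ := by
        conv_lhs => rw [hφ]
        simp [param]
      rw [h0] at h1
      exact (mul_eq_zero.1 h1.symm).resolve_left E.b_pos.ne'
    have hl : level p = Real.sin p.2 * √(E.speedSq φ) := by
      conv_lhs => rw [hφ, level_param φ p.2.2]
    rw [speedSq, hs, show E.b ^ 2 + (E.a ^ 2 - E.b ^ 2) * 0 ^ 2 = E.b ^ 2 by ring,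
      Real.sqrt_sq E.b_pos.le] at hl
    have := mul_le_mul_of_nonneg_right (Real.sin_le_one (p.2 : ℝ)) E.b_pos.le
    linarith
  have main : ∀ q : E.Phase, level q = level p → 0 < q.1.1 1 → ∃ t, q = E.libCurve _ h h' t := by
    intro q hq hq1
    obtain ⟨t, ht⟩ := exists_libCurve (p := q) (by rwa [hq]) (by rwa [hq]) hq1
    exact ⟨t, by rw [ht]; congr 1⟩
  rcases lt_or_gt_of_ne hne with hlt | hgt
  · obtain ⟨t, ht⟩ := main (E.mirror p) (level_mirror p)
      (by change 0 < -(p.1.1 1); linarith)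
    refine ⟨fun s => E.mirror (E.libCurve _ h h' (t + s)), ?_, ?_, ?_, ?_, ?_, ?_⟩
    · simp only [add_zero]; rw [← ht, mirror_mirror]
    · exact continuous_mirror.comp ((continuous_libCurve h h').comp (continuous_const.add
        continuous_id))
    · exact fun s => mirror_mem_openPhase (libCurve_mem_openPhase h h' _)
    · intro s; simp only; rw [← add_assoc, libCurve_periodic h h']
    · intro s u hsu
      have := congrArg E.mirror hsu
      simp only [mirror_mirror] at this
      obtain ⟨n, hn⟩ := exists_int_of_libCurve_eq h h' this
      exact ⟨n, by linarith⟩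
    · intro s
      simp only
      have ho := libCurve_mem_openPhase h h' (t + s)
      rw [billiard_mirror ho, billiard_mirror (billiard_mem_openPhase ho),
        billiard_billiard_libCurve, add_assoc]
  · obtain ⟨t, ht⟩ := main p rfl hgt
    refine ⟨fun s => E.libCurve _ h h' (t + s), ?_, ?_, ?_, ?_, ?_, ?_⟩
    · simp only [add_zero]; rw [← ht]
    · exact (continuous_libCurve h h').comp (continuous_const.add continuous_id)
    · exact fun s => libCurve_mem_openPhase h h' _
    · intro s; simp only; rw [← add_assoc, libCurve_periodic h h']
    · intro s u hsu
      obtain ⟨n, hn⟩ := exists_int_of_libCurve_eq h h' hsu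
      exact ⟨n, by linarith⟩
    · intro s
      simp only
      rw [billiard_billiard_libCurve, add_assoc]

theorem ne_of_level_lt_a {p : E.Phase} (h : E.b < level p) (h' : level p < E.a) :
    E.billiard (E.billiard p) ≠ p := by
  obtain ⟨Γ, h0, -, -, -, hi, hr⟩ := exists_libParam h h'
  intro hp
  have h1 := hr 0
  rw [h0, hp] at h1
  have h1 := h0.trans h1
  obtain ⟨n, hn⟩ := hi _ _ h1
  have h2 := libRot_pos h h'.le
  have h3 := libRot_lt_one h h'.le
  have h4 : E.libRot (level p) = ((-n : ℤ) : ℝ) := by push_cast; linarith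
  rw [h4] at h2 h3
  have : (0 : ℤ) < -n := by exact_mod_cast h2
  have : -n < (1 : ℤ) := by exact_mod_cast h3
  omega

theorem not_periodic_of_irrational {p : E.Phase} (h : E.b < level p) (h' : level p < E.a)
    (hp : 0 < p.1.1 1) (hr : Irrational (E.libRot (level p))) {n : ℕ} (hn : 0 < n) :
    E.billiard^[n] p ≠ p := by
  intro hf
  obtain ⟨t, ht⟩ := exists_libCurve h h' hp
  have h2 : E.billiard^[2 * n] p = p := by
    rw [two_mul, Function.iterate_add_apply, hf, hf]
  have h3 : E.libCurve (level p) h h' (t + n * E.libRot (level p)) = E.libCurve _ h h' t := by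
    rw [← iterate_two_mul_libCurve, ← ht, h2]
  obtain ⟨k, hk⟩ := exists_int_of_libCurve_eq h h' h3
  have h4 : (n : ℝ) * E.libRot (level p) = k := by linarith
  exact (hr.natCast_mul hn.ne').ne_int k h4

/-- On a level below `b` an orbit is either periodic or dense in its invariant curve; in the second
case the orbit of the square of the billiard map is dense as well. -/
theorem periodic_or_mem_closure {p : E.Phase} (hpo : p ∈ E.openPhase) (hp : level p < E.b) :
    (∃ n : ℕ, 0 < n ∧ E.billiard^[n] p = p) ∨
      E.billiard p ∈ closure (Set.range fun n : ℕ => E.billiard^[2 * n] p) := by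
  wlog hθ : (p.2 : ℝ) ≤ Real.pi / 2 generalizing p
  · have hmo := mirror_mem_openPhase hpo
    rcases this hmo (by rwa [level_mirror])
      (by change Real.pi - (p.2 : ℝ) ≤ Real.pi / 2; linarith) with ⟨n, hn, h⟩ | h
    · left
      refine ⟨n, hn, ?_⟩
      rw [iterate_billiard_mirror hpo] at h
      rw [← mirror_mirror (E.billiard^[n] p), h, mirror_mirror]
    · right
      rw [billiard_mirror hpo] at h
      have h1 := image_closure_subset_closure_image (continuous_mirror (E := E))
        (Set.mem_image_of_mem _ h)
      rw [mirror_mirror] at h1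
      refine closure_mono ?_ h1
      rintro _ ⟨_, ⟨n, rfl⟩, rfl⟩
      exact ⟨n, by simp only; rw [iterate_billiard_mirror hpo, mirror_mirror]⟩
  have h0 := level_nonneg p
  have hm : level p ^ 2 < E.b ^ 2 := pow_lt_pow_left₀ hp h0 two_ne_zero
  obtain ⟨t, ht⟩ := exists_rotCurve hm hθ
  set m := level p
  have hper := rotCurve_periodic hm
  by_cases hr : Irrational (E.rotNum m)
  · right
    have hd := Real.Angle.denseRange_nsmul_of_irrational (hr.natCast_mul (two_ne_zero (α := ℕ)))
    have hc := hper.continuous_angleLift (continuous_rotCurve hm)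
    let k : Real.Angle → E.Phase := fun x =>
      hper.angleLift (((2 * Real.pi * t : ℝ) : Real.Angle) + x)
    have hk : Continuous k := hc.comp (continuous_const_add _)
    have h1 : k ((2 * Real.pi * E.rotNum m : ℝ) : Real.Angle) = E.billiard p := by
      simp only [k]
      rw [← Real.Angle.coe_add, ← mul_add, hper.angleLift_coe, ht, billiard_rotCurve h0 hm]
    have h2 := image_closure_subset_closure_image hk (Set.mem_image_of_mem _
      (hd ((2 * Real.pi * E.rotNum m : ℝ) : Real.Angle)))
    rw [h1] at h2
    refine closure_mono ?_ h2
    rintro _ ⟨_, ⟨n, rfl⟩, rfl⟩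
    refine ⟨n, ?_⟩
    simp only [k]
    rw [← Real.Angle.coe_nsmul, ← Real.Angle.coe_add, nsmul_eq_mul,
      show 2 * Real.pi * t + n * (2 * Real.pi * ((2 : ℕ) * E.rotNum m)) =
        2 * Real.pi * (t + (2 * n : ℕ) * E.rotNum m) by push_cast; ring, hper.angleLift_coe, ht,
      iterate_billiard_rotCurve h0 hm]
  · left
    rw [irrational_iff_ne_rational] at hr
    push Not at hr
    obtain ⟨u, v, hv, huv⟩ := hr
    refine ⟨v.natAbs, Int.natAbs_pos.2 hv, ?_⟩
    have hv' : (v : ℝ) ≠ 0 := Int.cast_ne_zero.2 hv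
    rw [ht, iterate_billiard_rotCurve h0 hm, huv]
    rcases Int.natAbs_eq v with he | he
    · have : ((v.natAbs : ℕ) : ℝ) = (v : ℝ) := by
        conv_rhs => rw [he]
        simp
      rw [this, mul_div_cancel₀ _ hv']
      simpa using hper.int_mul u t
    · have : ((v.natAbs : ℕ) : ℝ) = -(v : ℝ) := by
        conv_rhs => rw [he]
        simp
      rw [this, neg_mul, mul_div_cancel₀ _ hv']
      simpa using hper.int_mul (-u) t

end Ellipse

namespace Ellipse

/-! ### Global conjugacies -/

section

variable {E₁ E₂ : Ellipse} {h : OpenPartialHomeomorph E₁.Phase E₂.Phase}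

theorem conj_iterate (hc : ∀ p ∈ E₁.openPhase, h (E₁.billiard p) = E₂.billiard (h p))
    {p : E₁.Phase} (hp : p ∈ E₁.openPhase) (n : ℕ) :
    h (E₁.billiard^[n] p) = E₂.billiard^[n] (h p) := by
  induction n with
  | zero => rfl
  | succ n ih =>
    rw [Function.iterate_succ_apply', Function.iterate_succ_apply',
      hc _ (iterate_billiard_mem_openPhase hp n), ih]

variable (hs : h.source = E₁.openPhase) (ht : h.target = E₂.openPhase)
  (hc : ∀ p ∈ E₁.openPhase, h (E₁.billiard p) = E₂.billiard (h p))
include hs ht hc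

theorem conj_symm : ∀ p ∈ E₂.openPhase, h.symm (E₂.billiard p) = E₁.billiard (h.symm p) := by
  intro p hp
  have h1 : h.symm p ∈ E₁.openPhase := hs ▸ h.map_target (ht ▸ hp)
  have h2 := hc _ h1
  rw [h.right_inv (ht ▸ hp)] at h2
  rw [← h2, h.left_inv (hs ▸ billiard_mem_openPhase h1)]

/-- A librational point of irrational rotation number is not mapped below the level `b`: there,
the image of a non-periodic point under the billiard map is a limit of its orbit under the square
of the billiard map, whereas the billiard map exchanges the two librational regions. -/
theorem not_lt_of_irrational {p : E₁.Phase} (hp : p ∈ E₁.upperLib) (hpa : level p < E₁.a)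
    (hr : Irrational (E₁.libRot (level p))) : ¬ level (h p) < E₂.b := by
  intro hlt
  have hpo := upperLib_subset_openPhase hp
  have hqo : h p ∈ E₂.openPhase := ht ▸ h.map_source (hs ▸ hpo)
  rcases periodic_or_mem_closure hqo hlt with ⟨n, hn, hper⟩ | hcl
  · refine not_periodic_of_irrational hp.1 hpa hp.2 hr hn ?_
    rw [← conj_iterate hc hpo] at hper
    exact h.injOn (hs ▸ iterate_billiard_mem_openPhase hpo n) (hs ▸ hpo) hper
  · have hmem : E₂.billiard (h p) ∈ h.target := ht ▸ billiard_mem_openPhase hqo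
    have h1 := (h.continuousAt_symm hmem).continuousWithinAt.mem_closure_image hcl
    rw [← hc p hpo, h.left_inv (hs ▸ billiard_mem_openPhase hpo)] at h1
    obtain ⟨t, htp⟩ := exists_libCurve hp.1 hpa hp.2
    have hclosed : IsClosed {q : E₁.Phase | 0 ≤ q.1.1 1} :=
      isClosed_le continuous_const (by fun_prop : Continuous fun q : E₁.Phase => q.1.1 1)
    have hsub : (h.symm '' Set.range fun n : ℕ => E₂.billiard^[2 * n] (h p)) ⊆
        {q : E₁.Phase | 0 ≤ q.1.1 1} := by
      rintro _ ⟨_, ⟨n, rfl⟩, rfl⟩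
      simp only [Set.mem_ofPred_eq]
      rw [← conj_iterate hc hpo, h.left_inv (hs ▸ iterate_billiard_mem_openPhase hpo _), htp,
        iterate_two_mul_libCurve]
      exact (libCurve_fst_one_pos _ _ _).le
    have h2 : 0 ≤ (E₁.billiard p).1.1 1 := closure_minimal hsub hclosed h1
    rw [htp, billiard_libCurve] at h2
    have h3 := libCurve_fst_one_pos hp.1 hpa (t + (E₁.dual (level p) hp.1 hpa).rotNum E₁.b)
    change 0 ≤ -((E₁.libCurve _ hp.1 hpa _).1.1 1) at h2
    linarith

/-- A global conjugacy maps the librational region into the librational region. -/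
theorem lt_level_of_mem_upperLib {p : E₁.Phase} (hp : p ∈ E₁.upperLib) : E₂.b < level (h p) := by
  have hsub : E₁.upperLib ⊆ h.source := hs ▸ upperLib_subset_openPhase
  have hle : ∀ q ∈ E₁.upperLib, E₂.b ≤ level (h q) := by
    intro q hq
    by_contra hlt
    rw [not_le] at hlt
    have hV : IsOpen (h.source ∩ h ⁻¹' {y | level y < E₂.b}) :=
      h.isOpen_inter_preimage (isOpen_lt continuous_level continuous_const)
    obtain ⟨x, hx, hxl, hxa, hxr⟩ := exists_irrational hV ⟨hsub hq, hlt⟩ hq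
    exact not_lt_of_irrational hs ht hc hxl hxa hxr hx.2
  refine lt_of_le_of_ne (hle p hp) fun heq => ?_
  have ho : IsOpen (h '' E₁.upperLib) := h.isOpen_image_of_subset_source isOpen_upperLib hsub
  have hpo : h p ∈ E₂.openPhase := ht ▸ h.map_source (hsub hp)
  obtain ⟨l₀, hl₀, hl⟩ := exists_level_eq ho (Set.mem_image_of_mem _ hp) hpo
  obtain ⟨l, hl1⟩ := exists_between hl₀
  obtain ⟨_, ⟨q, hq, rfl⟩, rfl⟩ := hl l hl1
  have := hle q hq
  linarith [hl1.2]

theorem lt_of_conj (hab : E₁.b < E₁.a) : E₂.b < E₂.a := by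
  obtain ⟨z, hz, -⟩ := exists_mem_upperLib hab
  exact (lt_level_of_mem_upperLib hs ht hc hz).trans_le (level_le_a _)

/-- The rotation numbers of a generic librational point and of its image agree up to sign. -/
theorem libRot_eq_or_eq_one_sub {p : E₁.Phase} (hp : p ∈ E₁.upperLib) (hpa : level p < E₁.a)
    (hr : Irrational (E₁.libRot (level p))) : level (h p) < E₂.a ∧
      (E₂.libRot (level (h p)) = E₁.libRot (level p) ∨
        E₂.libRot (level (h p)) = 1 - E₁.libRot (level p)) := by
  have hpo := upperLib_subset_openPhase hp
  have hqo : h p ∈ E₂.openPhase := ht ▸ h.map_source (hs ▸ hpo)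
  have hb := lt_level_of_mem_upperLib hs ht hc hp
  have hF : ∀ x ∈ E₁.openPhase,
      h (E₁.billiard (E₁.billiard x)) = E₂.billiard (E₂.billiard (h x)) := fun x hx => by
    rw [hc _ (billiard_mem_openPhase hx), hc _ hx]
  have hqa : level (h p) < E₂.a := by
    refine lt_of_le_of_ne (level_le_a _) fun heq => ?_
    have h1 := billiard_billiard_of_level_eq (hb.trans_le (level_le_a _)) heq
    rw [← hF p hpo] at h1
    exact ne_of_level_lt_a hp.1 hpa (h.injOn
      (hs ▸ billiard_mem_openPhase (billiard_mem_openPhase hpo)) (hs ▸ hpo) h1)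
  refine ⟨hqa, ?_⟩
  obtain ⟨Γ, hΓ0, hΓc, hΓo, hΓp, hΓi, hΓr⟩ := exists_libParam hp.1 hpa
  obtain ⟨Δ, hΔ0, hΔc, hΔo, hΔp, hΔi, hΔr⟩ := exists_libParam hb hqa
  have hlo : ∀ x, hΓp.angleLift x ∈ h.source := fun x => by
    obtain ⟨t, rfl⟩ := x.exists_eq_coe_two_pi_mul
    rw [hΓp.angleLift_coe, hs]; exact hΓo t
  have hz : ((2 * Real.pi * 0 : ℝ) : Real.Angle) = 0 := by simp
  have key := Real.Angle.rotation_eq_or_eq_neg_of_semiconj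
    (F := fun x => E₁.billiard (E₁.billiard x)) (G := fun y => E₂.billiard (E₂.billiard y))
    (h := h) (Γ := hΓp.angleLift) (Δ := hΔp.angleLift)
    (α := ((2 * Real.pi * E₁.libRot (level p) : ℝ) : Real.Angle))
    (β := ((2 * Real.pi * E₂.libRot (level (h p)) : ℝ) : Real.Angle))
    (hΔp.continuous_angleLift hΔc) (hΔp.angleLift_injective hΔi)
    (h.continuousOn.comp_continuous (hΓp.continuous_angleLift hΓc) hlo)
    (fun x y hxy => hΓp.angleLift_injective hΓi (h.injOn (hlo x) (hlo y) hxy))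
    (fun x => by
      obtain ⟨t, rfl⟩ := x.exists_eq_coe_two_pi_mul
      rw [← Real.Angle.coe_add, ← mul_add, hΓp.angleLift_coe, hΓp.angleLift_coe, hΓr])
    (fun x => by
      obtain ⟨t, rfl⟩ := x.exists_eq_coe_two_pi_mul
      rw [← Real.Angle.coe_add, ← mul_add, hΔp.angleLift_coe, hΔp.angleLift_coe, hΔr])
    (fun x => hF _ (hs ▸ hlo x))
    ⟨0, by rw [← hz, hΓp.angleLift_coe, hΔp.angleLift_coe, hΓ0, hΔ0]⟩
    (Real.Angle.denseRange_nsmul_of_irrational hr)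
  have p1 := libRot_pos hp.1 hpa.le
  have p2 := libRot_lt_one hp.1 hpa.le
  have q1 := libRot_pos hb hqa.le
  have q2 := libRot_lt_one hb hqa.le
  have hpi := Real.two_pi_pos
  rcases key with hk | hk
  · left
    obtain ⟨n, hn⟩ := Real.Angle.angle_eq_iff_two_pi_dvd_sub.1 hk
    have hn' : E₂.libRot (level (h p)) - E₁.libRot (level p) = n :=
      mul_left_cancel₀ hpi.ne' (by linarith)
    have n1 : (-1 : ℤ) < n := by
      have : ((-1 : ℤ) : ℝ) < n := by push_cast; linarith
      exact_mod_cast this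
    have n2 : n < (1 : ℤ) := by
      have : (n : ℝ) < (1 : ℤ) := by push_cast; linarith
      exact_mod_cast this
    have : n = 0 := by omega
    rw [this, Int.cast_zero] at hn'
    linarith
  · right
    rw [← Real.Angle.coe_neg] at hk
    obtain ⟨n, hn⟩ := Real.Angle.angle_eq_iff_two_pi_dvd_sub.1 hk
    have hn' : E₂.libRot (level (h p)) + E₁.libRot (level p) = n :=
      mul_left_cancel₀ hpi.ne' (by linarith)
    have n1 : (0 : ℤ) < n := by
      have : ((0 : ℤ) : ℝ) < n := by push_cast; linarith
      exact_mod_cast this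
    have n2 : n < (2 : ℤ) := by
      have : (n : ℝ) < (2 : ℤ) := by push_cast; linarith
      exact_mod_cast this
    have : n = 1 := by omega
    rw [this, Int.cast_one] at hn'
    linarith

/-- The rotation number at the elliptic two-periodic orbit is an invariant of global conjugacies.
The sign ambiguity is resolved by the twist: on both sides the rotation number increases away from
the two-periodic orbit. -/
theorem libRot_a_eq (hab : E₁.b < E₁.a) : E₁.libRot E₁.a = E₂.libRot E₂.a := by
  obtain ⟨z, hz, hza⟩ := exists_mem_upperLib hab
  have hab₂ := lt_of_conj hs ht hc hab
  have hzo := upperLib_subset_openPhase hz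
  have hwa : level (h z) = E₂.a := by
    by_contra hne
    refine ne_of_level_lt_a (lt_level_of_mem_upperLib hs ht hc hz)
      (lt_of_le_of_ne (level_le_a _) hne) ?_
    rw [← hc z hzo, ← hc _ (billiard_mem_openPhase hzo), billiard_billiard_of_level_eq hab hza]
  let S : Set E₁.Phase := {p | p ∈ E₁.upperLib ∧ level p < E₁.a ∧
    Irrational (E₁.libRot (level p))}
  have hzS : z ∈ closure S := by
    rw [mem_closure_iff]
    intro V hV hzV
    obtain ⟨q, hqV, hq⟩ := exists_irrational hV hzV hz
    exact ⟨q, hqV, hq⟩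
  have : (nhdsWithin z S).NeBot := mem_closure_iff_nhdsWithin_neBot.1 hzS
  have hS : ∀ᶠ p in nhdsWithin z S, p ∈ S := self_mem_nhdsWithin
  have t1 : Filter.Tendsto (fun p => E₁.libRot (level p)) (nhdsWithin z S)
      (nhds (E₁.libRot E₁.a)) := by
    refine (tendsto_libRot hab).comp (tendsto_nhdsWithin_iff.2 ⟨?_, hS.mono fun p hp => hp.2.1⟩)
    rw [← hza]
    exact continuous_level.continuousAt.tendsto.mono_left nhdsWithin_le_nhds
  have t2 : Filter.Tendsto (fun p => E₂.libRot (level (h p))) (nhdsWithin z S)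
      (nhds (E₂.libRot E₂.a)) := by
    refine (tendsto_libRot hab₂).comp (tendsto_nhdsWithin_iff.2 ⟨?_, hS.mono fun p hp =>
      (libRot_eq_or_eq_one_sub hs ht hc hp.1 hp.2.1 hp.2.2).1⟩)
    rw [← hwa]
    exact (continuous_level.continuousAt.tendsto.comp
      (h.continuousAt (hs ▸ hzo))).mono_left nhdsWithin_le_nhds
  by_contra hne
  -- otherwise the rotation numbers add up to `1` near `z`, although both exceed their limits
  have hdiff : ∀ᶠ p in nhdsWithin z S, E₁.libRot (level p) - E₂.libRot (level (h p)) ≠ 0 :=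
    (t1.sub t2).eventually_ne (sub_ne_zero.2 hne)
  have hsum : ∀ᶠ p in nhdsWithin z S, E₂.libRot (level (h p)) = 1 - E₁.libRot (level p) := by
    filter_upwards [hdiff, hS] with p hp hpS
    rcases (libRot_eq_or_eq_one_sub hs ht hc hpS.1 hpS.2.1 hpS.2.2).2 with h1 | h1
    · exact absurd (by rw [h1, sub_self]) hp
    · exact h1
  have hlim : E₂.libRot E₂.a = 1 - E₁.libRot E₁.a :=
    tendsto_nhds_unique (t2.congr' hsum) (t1.const_sub 1)
  obtain ⟨p, hp1, hpS⟩ := (hsum.and hS).exists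
  have h1 := libRot_lt hpS.1.1 hpS.2.1 le_rfl
  have h2 := libRot_lt (lt_level_of_mem_upperLib hs ht hc hpS.1)
    (libRot_eq_or_eq_one_sub hs ht hc hpS.1 hpS.2.1 hpS.2.2).1 le_rfl
  linarith

theorem ratio_eq_of_conj : E₁.b / E₁.a = E₂.b / E₂.a := by
  have ha₁ := E₁.a_pos
  have ha₂ := E₂.a_pos
  rcases E₁.b_le_a.lt_or_eq with h1 | h1
  · have h2 := lt_of_conj hs ht hc h1
    have h3 := libRot_a_eq hs ht hc h1
    rw [libRot_a h1, libRot_a h2] at h3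
    have h4 := mul_left_cancel₀ (by positivity : 2 / Real.pi ≠ 0) h3
    have hm : ∀ E : Ellipse, E.b / E.a ∈ Set.Icc (-1 : ℝ) 1 := fun E =>
      ⟨by linarith [div_pos E.b_pos E.a_pos], (div_le_one E.a_pos).2 E.b_le_a⟩
    exact Real.injOn_arcsin (hm _) (hm _) h4
  · rcases E₂.b_le_a.lt_or_eq with h2 | h2
    · have := lt_of_conj (h := h.symm) (by rw [h.symm_source, ht]) (by rw [h.symm_target, hs])
        (conj_symm hs ht hc) h2
      linarith
    · rw [h1, h2, div_self ha₁.ne', div_self ha₂.ne']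

end

theorem similar_of_ratio_eq {E₁ E₂ : Ellipse} (h : E₁.b / E₁.a = E₂.b / E₂.a) :
    Similar E₁ E₂ := by
  have ha₁ := E₁.a_pos
  have ha₂ := E₂.a_pos
  have hb₁ := E₁.b_pos
  have hb₂ := E₂.b_pos
  have hk : E₂.a / E₁.a ≠ 0 := by positivity
  have hb : E₂.b = E₂.a / E₁.a * E₁.b := by field_simp at h ⊢; linarith
  have ha : E₂.a = E₂.a / E₁.a * E₁.a := by field_simp
  refine ⟨DilationEquiv.smulTorsor (0 : Plane) hk, ?_⟩
  generalize E₂.a / E₁.a = k at *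
  have hmem : ∀ x : Plane, k • x ∈ E₂.curve ↔ x ∈ E₁.curve := fun x => by
    simp only [curve, Set.mem_ofPred_eq, PiLp.smul_apply, smul_eq_mul]
    rw [ha, hb, mul_pow, mul_pow, mul_pow, mul_pow, mul_div_mul_left _ _ (pow_ne_zero 2 hk),
      mul_div_mul_left _ _ (pow_ne_zero 2 hk)]
  ext y
  constructor
  · rintro ⟨x, hx, rfl⟩
    simpa [hmem] using hx
  · intro hy
    refine ⟨k⁻¹ • y, (hmem _).1 (by rwa [smul_inv_smul₀ hk]), ?_⟩
    simp [smul_inv_smul₀ hk]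

end Ellipse

/-! ### Smooth dependence of integrals on parameters -/

theorem ContDiff.intervalIntegral_of_param_nat {H : Type} [NormedAddCommGroup H] [NormedSpace ℝ H]
    [ProperSpace H] (a b : ℝ) (n : ℕ) {F : Type} [NormedAddCommGroup F] [NormedSpace ℝ F]
    [CompleteSpace F] {f : H → ℝ → F} (hf : ContDiff ℝ n fun q : H × ℝ => f q.1 q.2) :
    ContDiff ℝ n fun x => ∫ t in a..b, f x t := by
  induction n generalizing F with
  | zero =>
    simp only [Nat.cast_zero, contDiff_zero] at hf ⊢
    exact intervalIntegral.continuous_parametric_intervalIntegral_of_continuous' hf a b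
  | succ n ih =>
    obtain ⟨D, hD, hfD⟩ := contDiff_succ_iff_hasFDerivAt.1 hf
    refine contDiff_succ_iff_hasFDerivAt.2
      ⟨fun x => ∫ t in a..b, (D (x, t)).comp (ContinuousLinearMap.inl ℝ H ℝ), ?_, fun x₀ => ?_⟩
    · exact ih (f := fun x t => (D (x, t)).comp (ContinuousLinearMap.inl ℝ H ℝ))
        (hD.clm_comp contDiff_const)
    · have hc : Continuous fun q : H × ℝ => (D q).comp (ContinuousLinearMap.inl ℝ H ℝ) :=
        hD.continuous.clm_comp continuous_const
      have hK : IsCompact (Metric.closedBall x₀ 1 ×ˢ Set.uIcc a b) :=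
        (isCompact_closedBall x₀ 1).prod isCompact_uIcc
      obtain ⟨C, hC⟩ := hK.exists_bound_of_continuousOn hc.continuousOn
      refine intervalIntegral.hasFDerivAt_integral_of_dominated_of_fderiv_le
        (F' := fun x t => (D (x, t)).comp (ContinuousLinearMap.inl ℝ H ℝ)) (bound := fun _ => C)
        (Metric.ball_mem_nhds x₀ one_pos) ?_ ?_ ?_ ?_ intervalIntegrable_const ?_
      · exact Filter.Eventually.of_forall fun x =>
          (hf.continuous.comp (continuous_const.prodMk continuous_id)).aestronglyMeasurable
      · exact (hf.continuous.comp (continuous_const.prodMk continuous_id)).intervalIntegrable _ _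
      · exact (hc.comp (continuous_const.prodMk continuous_id)).aestronglyMeasurable
      · exact Filter.Eventually.of_forall fun t ht x hx =>
          hC (x, t) ⟨Metric.ball_subset_closedBall hx, Set.uIoc_subset_uIcc ht⟩
      · exact Filter.Eventually.of_forall fun t _ x _ =>
          (hfD (x, t)).comp (f := fun e : H => (e, t)) x (hasFDerivAt_prodMk_left x t)

theorem ContDiff.intervalIntegral_of_param {H : Type} [NormedAddCommGroup H] [NormedSpace ℝ H]
    [ProperSpace H] (a b : ℝ) {F : Type} [NormedAddCommGroup F] [NormedSpace ℝ F]
    [CompleteSpace F] {f : H → ℝ → F} (hf : ContDiff ℝ ∞ fun q : H × ℝ => f q.1 q.2) :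
    ContDiff ℝ ∞ fun x => ∫ t in a..b, f x t :=
  contDiff_infty.2 fun n =>
    ContDiff.intervalIntegral_of_param_nat a b n (hf.of_le (by exact_mod_cast le_top))

namespace Ellipse

variable {E : Ellipse}

/-! ### Smoothness of the angle coordinate -/

theorem contDiffAt_angleInt {φ m : ℝ} (hm : m ^ 2 < E.b ^ 2) :
    ContDiffAt ℝ ∞ (fun q : ℝ × ℝ => E.angleInt q.2 q.1) (φ, m) := by
  have hb := E.b_pos
  have hmb : |m| < E.b := abs_lt_of_sq_lt_sq hm hb.le
  have h0 := abs_nonneg m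
  -- a smooth function that is `m²` near the given level and stays below `b²`
  let β : ContDiffBump (0 : ℝ) := ⟨(2 * |m| + E.b) / 3, (|m| + 2 * E.b) / 3, by linarith,
    by linarith⟩
  have hχ : ∀ x : ℝ, β x * x ^ 2 < E.b ^ 2 := by
    intro x
    by_cases hx : |x| < (|m| + 2 * E.b) / 3
    · have h1 : x ^ 2 < E.b ^ 2 := by
        rw [← sq_abs x]; exact pow_lt_pow_left₀ (by linarith) (abs_nonneg x) two_ne_zero
      nlinarith [β.le_one (x := x), β.nonneg' x, sq_nonneg x]
    · rw [β.zero_of_le_dist (by rw [dist_zero_right]; exact not_lt.1 hx), zero_mul]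
      positivity
  have hsm : ContDiff ℝ ∞ fun q : ℝ × ℝ =>
      q.1 * ∫ u in (0 : ℝ)..1, 1 / √(E.speedSq (q.1 * u) - β q.2 * q.2 ^ 2) := by
    refine contDiff_fst.mul (ContDiff.intervalIntegral_of_param (H := ℝ × ℝ) 0 1
      (f := fun q u => 1 / √(E.speedSq (q.1 * u) - β q.2 * q.2 ^ 2)) ?_)
    have hpos : ∀ q : (ℝ × ℝ) × ℝ, 0 < E.speedSq (q.1.1 * q.2) - β q.1.2 * q.1.2 ^ 2 := fun q => by
      linarith [hχ q.1.2, E.b_sq_le_speedSq (q.1.1 * q.2)]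
    refine contDiff_const.div (ContDiff.sqrt ?_ fun q => (hpos q).ne')
      fun q => (Real.sqrt_pos.2 (hpos q)).ne'
    have hβ : ContDiff ℝ ∞ fun q : (ℝ × ℝ) × ℝ => β q.1.2 :=
      β.contDiff.comp (contDiff_snd.comp contDiff_fst)
    have hD : ContDiff ℝ ∞ fun q : (ℝ × ℝ) × ℝ => E.speedSq (q.1.1 * q.2) :=
      E.contDiff_speedSq.comp (by fun_prop)
    exact hD.sub (hβ.mul (by fun_prop))
  refine hsm.contDiffAt.congr_of_eventuallyEq ?_
  have hnear : ∀ᶠ q : ℝ × ℝ in nhds (φ, m), |q.2| < (2 * |m| + E.b) / 3 :=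
    (isOpen_lt (continuous_abs.comp continuous_snd) continuous_const).mem_nhds
      (by change |m| < _; linarith)
  filter_upwards [hnear] with q hq
  have h1 : β q.2 = 1 := β.one_of_mem_closedBall (by
    rw [mem_closedBall_zero_iff]; exact hq.le)
  rw [h1, one_mul, angleInt]
  have := intervalIntegral.mul_integral_comp_mul_left (a := 0) (b := 1) (f := E.density q.2) q.1
  rw [mul_zero, mul_one] at this
  rw [← this]
  rfl

theorem contDiffAt_normAngle {φ m : ℝ} (hm : m ^ 2 < E.b ^ 2) :
    ContDiffAt ℝ ∞ (fun q : ℝ × ℝ => E.normAngle q.2 q.1) (φ, m) := by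
  refine (contDiffAt_angleInt hm).div (contDiffAt_const.mul ?_)
    (mul_pos two_pos (angleInt_pi_pos hm)).ne'
  exact (contDiffAt_angleInt (φ := Real.pi) hm).comp (φ, m)
    (contDiffAt_const.prodMk contDiffAt_snd)

theorem hasDerivAt_normAngle {m : ℝ} (hm : m ^ 2 < E.b ^ 2) (φ : ℝ) : HasDerivAt (E.normAngle m)
    (E.density m φ / (2 * E.angleInt m Real.pi)) φ :=
  (hasDerivAt_angleInt hm φ).div_const _

/-- The angle coordinate, together with the level, is a smooth coordinate system; hence the inverse
of the angle coordinate depends smoothly on the level. -/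
theorem contDiffAt_normAngleInv {t m : ℝ} (hm : m ^ 2 < E.b ^ 2) :
    ContDiffAt ℝ ∞ (fun q : ℝ × ℝ => E.normAngleInv q.2 q.1) (t, m) := by
  set φ := E.normAngleInv m t with hφ
  let N : ℝ × ℝ → ℝ × ℝ := fun q => (E.normAngle q.2 q.1, q.2)
  have hN : ContDiffAt ℝ ∞ N (φ, m) :=
    (contDiffAt_normAngle hm).prodMk contDiffAt_snd
  have hNa : N (φ, m) = (t, m) := by
    simp only [N, hφ, normAngle_normAngleInv hm]
  obtain ⟨L, hL⟩ := (contDiffAt_normAngle (φ := φ) hm).differentiableAt (by simp)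
  have hL1 : L (1, 0) = E.density m φ / (2 * E.angleInt m Real.pi) := by
    have h1 := hL.comp_hasDerivAt (x := φ) (f := fun s : ℝ => (s, m))
      ((hasDerivAt_id φ).prodMk (hasDerivAt_const φ m))
    exact h1.unique (hasDerivAt_normAngle hm φ)
  have hL0 : L (1, 0) ≠ 0 := by
    rw [hL1]
    exact (div_pos (density_pos hm φ) (mul_pos two_pos (angleInt_pi_pos hm))).ne'
  have hinj : Function.Injective (L.prod (ContinuousLinearMap.snd ℝ ℝ ℝ)) := by
    rw [injective_iff_map_eq_zero]
    rintro ⟨x, y⟩ hxy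
    rw [ContinuousLinearMap.prod_apply, Prod.mk_eq_zero] at hxy
    have hy : y = 0 := hxy.2
    have hx : L (x, y) = 0 := hxy.1
    rw [hy] at hx
    rw [show ((x, 0) : ℝ × ℝ) = x • ((1, 0) : ℝ × ℝ) by simp, map_smul, smul_eq_mul] at hx
    rw [hy, (mul_eq_zero.1 hx).resolve_right hL0]; rfl
  let e : (ℝ × ℝ) ≃L[ℝ] (ℝ × ℝ) :=
    (LinearEquiv.ofInjectiveEndo (L.prod (ContinuousLinearMap.snd ℝ ℝ ℝ) : (ℝ × ℝ) →ₗ[ℝ] (ℝ × ℝ))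
      hinj).toContinuousLinearEquiv
  have he : (e : (ℝ × ℝ) →L[ℝ] (ℝ × ℝ)) = L.prod (ContinuousLinearMap.snd ℝ ℝ ℝ) := by
    ext1 <;> rfl
  have hNd : HasFDerivAt N
      (e : (ℝ × ℝ) →L[ℝ] (ℝ × ℝ)) (φ, m) := by
    rw [he]; exact hL.prodMk hasFDerivAt_snd
  have hinv := hN.to_localInverse hNd (by simp)
  rw [hNa] at hinv
  have hfst : ContDiffAt ℝ ∞ (fun q => (hN.localInverse hNd (by simp) q).1) (t, m) :=
    contDiffAt_fst.comp _ hinv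
  refine hfst.congr_of_eventuallyEq ?_
  have hr := (hN.hasStrictFDerivAt' hNd (by simp)).eventually_right_inverse
  rw [hNa] at hr
  have hb : ∀ᶠ q : ℝ × ℝ in nhds (t, m), q.2 ^ 2 < E.b ^ 2 :=
    (isOpen_lt (continuous_snd.pow 2) continuous_const).mem_nhds hm
  filter_upwards [hr, hb] with q hq hqb
  set g := hN.localInverse hNd (by simp) q with hg
  have hq' : N g = q := hq
  have h2 : (N g).2 = q.2 := by rw [hq']
  have h1 : (N g).1 = q.1 := by rw [hq']
  change g.2 = q.2 at h2
  change E.normAngle g.2 g.1 = q.1 at h1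
  rw [h2] at h1
  rw [← h1, normAngleInv_normAngle hqb]

theorem contDiffAt_rotNum {m : ℝ} (hm : m ^ 2 < E.b ^ 2) : ContDiffAt ℝ ∞ E.rotNum m := by
  have ha := E.a_pos
  have h1 : (m / E.a) ^ 2 < 1 := by
    rw [div_pow, div_lt_one (by positivity)]
    exact hm.trans_le E.b_sq_le_a_sq
  have h2 := abs_lt.1 (sq_lt_one_iff_abs_lt_one _ |>.1 h1)
  refine contDiffAt_const.mul ((contDiffAt_normAngle hm).comp
    (f := fun m : ℝ => (Real.arcsin (m / E.a), m)) m (ContDiffAt.prodMk ?_ contDiffAt_id))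
  exact ContDiffAt.comp (g := Real.arcsin) (f := fun m : ℝ => m / E.a) m
    (Real.contDiffAt_arcsin h2.1.ne' h2.2.ne) (contDiffAt_id.div_const _)

theorem rotNum_zero : E.rotNum 0 = 0 := by simp [rotNum, normAngle_zero]

/-- The twist condition at the boundary. -/
theorem exists_hasDerivAt_rotNum_zero : ∃ d, 0 < d ∧ HasDerivAt E.rotNum d 0 := by
  have ha := E.a_pos
  have hb := E.b_pos
  have hm : (0 : ℝ) ^ 2 < E.b ^ 2 := by rw [zero_pow two_ne_zero]; positivity
  obtain ⟨L, hL⟩ := (contDiffAt_normAngle (E := E) (φ := 0) hm).differentiableAt (by simp)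
  have hL1 : L (1, 0) = E.density 0 0 / (2 * E.angleInt 0 Real.pi) := by
    have h1 := hL.comp_hasDerivAt (x := 0) (f := fun s : ℝ => (s, (0 : ℝ)))
      ((hasDerivAt_id 0).prodMk (hasDerivAt_const 0 0))
    exact h1.unique (hasDerivAt_normAngle hm 0)
  have hL2 : L (0, 1) = 0 := by
    have h1 := hL.comp_hasDerivAt (x := 0) (f := fun s : ℝ => ((0 : ℝ), s))
      ((hasDerivAt_const 0 0).prodMk (hasDerivAt_id 0))
    refine h1.unique ?_
    have : (fun q : ℝ × ℝ => E.normAngle q.2 q.1) ∘ (fun s : ℝ => ((0 : ℝ), s)) = fun _ => 0 := by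
      ext s; exact normAngle_zero
    rw [this]
    exact hasDerivAt_const 0 0
  have hc := (density_pos hm (0 : ℝ))
  have hp := angleInt_pi_pos hm
  refine ⟨2 * (E.density 0 0 / (2 * E.angleInt 0 Real.pi) * (1 / E.a)), by positivity, ?_⟩
  have harc : HasDerivAt (fun m : ℝ => Real.arcsin (m / E.a)) (1 / E.a) 0 := by
    have h1 := (Real.hasDerivAt_arcsin (x := 0 / E.a) (by simp) (by simp)).comp 0
      ((hasDerivAt_id (0 : ℝ)).div_const E.a)
    refine h1.congr_deriv ?_
    simp
  have hL' : HasFDerivAt (fun q : ℝ × ℝ => E.normAngle q.2 q.1) L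
      (Real.arcsin (0 / E.a), (0 : ℝ)) := by simpa using hL
  have h1 := hL'.comp_hasDerivAt (x := 0) (f := fun m : ℝ => (Real.arcsin (m / E.a), m))
    (harc.prodMk (hasDerivAt_id 0))
  refine (h1.const_mul 2).congr_deriv ?_
  rw [show ((1 / E.a, 1) : ℝ × ℝ) = (1 / E.a) • ((1, 0) : ℝ × ℝ) + ((0, 1) : ℝ × ℝ) by simp,
    map_add, map_smul, hL1, hL2, smul_eq_mul, add_zero]
  ring

/-- Near the boundary the rotation number is a smooth coordinate on the set of levels. -/
theorem exists_rotNum_chart : ∃ P : OpenPartialHomeomorph ℝ ℝ, (P : ℝ → ℝ) = E.rotNum ∧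
    0 ∈ P.source ∧ (∀ m ∈ P.source, m ^ 2 < E.b ^ 2) ∧ StrictMonoOn E.rotNum P.source ∧
    ∀ r ∈ P.target, ContDiffAt ℝ ∞ P.symm r := by
  have hb := E.b_pos
  obtain ⟨d, hd, hder⟩ := exists_hasDerivAt_rotNum_zero (E := E)
  have h0 : (0 : ℝ) ^ 2 < E.b ^ 2 := by rw [zero_pow two_ne_zero]; positivity
  let Q := (contDiffAt_rotNum h0).toOpenPartialHomeomorph E.rotNum
    (hder.hasFDerivAt_equiv hd.ne') (by simp)
  have hQ : (Q : ℝ → ℝ) = E.rotNum := rfl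
  have hQ0 : (0 : ℝ) ∈ Q.source := ContDiffAt.mem_toOpenPartialHomeomorph_source _ _ _
  have hcont : ContinuousAt (deriv E.rotNum) 0 := by
    have h := ((contDiffAt_rotNum (E := E) h0).continuousAt_fderiv (by simp)).clm_apply
      (continuousAt_const (y := (1 : ℝ)))
    exact h
  have hpos : ∀ᶠ m in nhds (0 : ℝ), 0 < deriv E.rotNum m :=
    hcont.eventually_const_lt (by rw [hder.deriv]; exact hd)
  have hbnd : ∀ᶠ m in nhds (0 : ℝ), m ^ 2 < E.b ^ 2 :=
    (isOpen_lt (continuous_pow 2) continuous_const).mem_nhds h0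
  obtain ⟨ε, hε, hball⟩ := Metric.eventually_nhds_iff_ball.1 (hpos.and hbnd)
  let P := Q.restrOpen (Metric.ball 0 ε) Metric.isOpen_ball
  have hPs : P.source = Q.source ∩ Metric.ball 0 ε := Q.restrOpen_source _ _
  have hPe : (P : ℝ → ℝ) = E.rotNum := rfl
  have hP2 : ∀ m ∈ P.source, m ∈ Metric.ball (0 : ℝ) ε := fun m hm => by
    rw [hPs] at hm; exact hm.2
  refine ⟨P, hPe, by rw [hPs]; exact ⟨hQ0, Metric.mem_ball_self hε⟩,
    fun m hm => (hball m (hP2 m hm)).2, ?_, fun r hr => ?_⟩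
  · have hmono : StrictMonoOn E.rotNum (Metric.ball 0 ε) := by
      refine strictMonoOn_of_deriv_pos (convex_ball 0 ε) (fun m hm =>
        (contDiffAt_rotNum (hball m hm).2).continuousAt.continuousWithinAt) fun m hm => ?_
      exact (hball m (interior_subset hm)).1
    exact hmono.mono fun m hm => hP2 m hm
  · have hm := hball _ (hP2 _ (P.map_target hr))
    have hs := contDiffAt_rotNum hm.2
    exact P.contDiffAt_symm_deriv hm.1.ne' hr
      (hs.differentiableAt (by simp)).hasDerivAt hs

end Ellipse

namespace Ellipse

variable {E E' : Ellipse} {m : ℝ}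

/-! ### The special points in angle coordinates -/

variable (E) in
/-- The parameter `-arctan (1 - e²)` of the special point `p*`. -/
noncomputable def specialParam : ℝ := -Real.arctan (1 - E.ecc ^ 2)

theorem specialPoint_eq : E.specialPoint =
    !₂[E.a * Real.cos E.specialParam, E.b * Real.sin E.specialParam] := by
  rw [specialPoint, specialParam, Real.cos_neg, Real.sin_neg, mul_neg]

variable (E m) in
/-- The angle coordinate, on the level `m`, of the special point `p*`. -/
noncomputable def baseAngle : ℝ := E.normAngle m E.specialParam

theorem normAngle_add_int_mul_pi (hm : m ^ 2 < E.b ^ 2) (φ : ℝ) (n : ℤ) :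
    E.normAngle m (φ + n * Real.pi) = E.normAngle m φ + n / 2 := by
  induction n with
  | zero => simp
  | succ n ih =>
    have h := normAngle_add_pi hm (φ + (n : ℤ) * Real.pi)
    rw [ih] at h
    push_cast at h ⊢
    rw [add_one_mul, ← add_assoc, h]; ring
  | pred n ih =>
    have h := normAngle_add_pi hm (φ + ((-(n : ℤ) - 1 : ℤ) : ℝ) * Real.pi)
    push_cast at h ih ⊢
    rw [show φ + (-(n : ℝ) - 1) * Real.pi + Real.pi = φ + -n * Real.pi by ring, ih] at h
    linarith

/-- On every level the two special points divide the period of the angle coordinate into halves,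
by central symmetry. -/
theorem rotCurve_fst_special_iff (hm : m ^ 2 < E.b ^ 2) (t : ℝ) :
    (((E.rotCurve m t).1 : Plane) = E.specialPoint ∨
      ((E.rotCurve m t).1 : Plane) = -E.specialPoint) ↔
    ∃ k : ℤ, t - E.baseAngle m = k / 2 := by
  have ha := E.a_pos.ne'
  have hb := E.b_pos.ne'
  have h1 : ((E.rotCurve m t).1 : Plane) = !₂[E.a * Real.cos (E.normAngleInv m t),
      E.b * Real.sin (E.normAngleInv m t)] := by rw [rotCurve, phasePt_fst]
  rw [h1, specialPoint_eq]
  set φ := E.normAngleInv m t with hφ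
  set ψ := E.specialParam with hψ
  have e1 : ((!₂[E.a * Real.cos φ, E.b * Real.sin φ] : Plane) =
      !₂[E.a * Real.cos ψ, E.b * Real.sin ψ]) ↔
      Real.cos φ = Real.cos ψ ∧ Real.sin φ = Real.sin ψ := by
    constructor
    · intro h
      have h0 := congrFun (congrArg WithLp.ofLp h) 0
      have h1 := congrFun (congrArg WithLp.ofLp h) 1
      simp at h0 h1
      exact ⟨h0.resolve_right ha, h1.resolve_right hb⟩
    · rintro ⟨h, h'⟩; rw [h, h']
  have e2 : ((!₂[E.a * Real.cos φ, E.b * Real.sin φ] : Plane) =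
      -!₂[E.a * Real.cos ψ, E.b * Real.sin ψ]) ↔
      Real.cos φ = -Real.cos ψ ∧ Real.sin φ = -Real.sin ψ := by
    constructor
    · intro h
      have h0 := congrFun (congrArg WithLp.ofLp h) 0
      have h1 := congrFun (congrArg WithLp.ofLp h) 1
      simp [← mul_neg] at h0 h1
      exact ⟨h0.resolve_right ha, h1.resolve_right hb⟩
    · rintro ⟨h, h'⟩; rw [h, h']
      ext i; fin_cases i <;> simp
  rw [e1, e2]
  constructor
  · intro h
    have hs : Real.sin (φ - ψ) = 0 := by
      rw [Real.sin_sub]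
      rcases h with ⟨h, h'⟩ | ⟨h, h'⟩ <;> rw [h, h'] <;> ring
    obtain ⟨n, hn⟩ := Real.sin_eq_zero_iff.1 hs
    refine ⟨n, ?_⟩
    rw [← normAngle_normAngleInv hm t, ← hφ, show φ = ψ + n * Real.pi by linarith,
      normAngle_add_int_mul_pi hm, baseAngle]
    ring
  · rintro ⟨k, hk⟩
    have : φ = ψ + k * Real.pi := by
      apply (normAngle_strictMono hm).injective
      rw [hφ, normAngle_normAngleInv hm, normAngle_add_int_mul_pi hm]
      rw [baseAngle] at hk
      linarith
    rw [this, Real.cos_add_int_mul_pi, Real.sin_add_int_mul_pi]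
    rcases Int.even_or_odd k with h | h
    · left; simp [h.neg_one_zpow]
    · right; simp [h.neg_one_zpow]

theorem mem_puncturedPhase_iff {p : E.Phase} : p ∈ E.puncturedPhase ↔ 0 < level p ∧
    ¬ ((p.1 : Plane) = E.specialPoint ∨ (p.1 : Plane) = -E.specialPoint) := by
  rw [← mem_openPhase_iff, not_or]; rfl

/-! ### Regularity of the invariant curves -/

theorem continuousAt_rotCurve {t : ℝ} (hm : m ^ 2 < E.b ^ 2) :
    ContinuousAt (fun q : ℝ × ℝ => E.rotCurve q.2 q.1) (t, m) := by
  have h1 := (contDiffAt_normAngleInv (E := E) (t := t) hm).continuousAt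
  have hD : ContinuousAt (fun q : ℝ × ℝ => E.speedSq (E.normAngleInv q.2 q.1)) (t, m) :=
    ContinuousAt.comp (g := E.speedSq) E.continuous_speedSq.continuousAt h1
  have h2 : ContinuousAt (fun q : ℝ × ℝ => √(E.speedSq (E.normAngleInv q.2 q.1) - q.2 ^ 2))
      (t, m) := (hD.sub (continuousAt_snd.pow 2)).sqrt
  have h3 : Continuous fun r : ℝ × ℝ => E.phasePt r.1 r.2 :=
    continuous_phasePt continuous_fst continuous_snd
  exact ContinuousAt.comp (g := fun r : ℝ × ℝ => E.phasePt r.1 r.2)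
    (f := fun q : ℝ × ℝ => (E.normAngleInv q.2 q.1,
      √(E.speedSq (E.normAngleInv q.2 q.1) - q.2 ^ 2))) h3.continuousAt (h1.prodMk h2)

/-- The angle coordinate and the level are smooth coordinates on the part of the phase cylinder
above the boundary. -/
theorem contDiffAt_rotCurve {t : ℝ} (h0 : 0 < m) (hm : m ^ 2 < E.b ^ 2) :
    ContDiffAt ℝ ∞ (fun q : ℝ × ℝ => (((E.rotCurve q.2 q.1).1 : Plane),
      ((E.rotCurve q.2 q.1).2 : ℝ))) (t, m) := by
  have h1 := contDiffAt_normAngleInv (E := E) (t := t) hm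
  simp only [rotCurve, phasePt_fst, phasePt_snd]
  refine ContDiffAt.prodMk ?_ ?_
  · have hc : ContDiffAt ℝ ∞ (fun q : ℝ × ℝ => E.a * Real.cos (E.normAngleInv q.2 q.1)) (t, m) :=
      contDiffAt_const.mul h1.cos
    have hs : ContDiffAt ℝ ∞ (fun q : ℝ × ℝ => E.b * Real.sin (E.normAngleInv q.2 q.1)) (t, m) :=
      contDiffAt_const.mul h1.sin
    rw [contDiffAt_piLp]
    intro i
    fin_cases i
    · exact hc
    · exact hs
  · have hD : ContDiffAt ℝ ∞ (fun q : ℝ × ℝ => E.speedSq (E.normAngleInv q.2 q.1)) (t, m) :=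
      E.contDiff_speedSq.contDiffAt.comp (t, m) h1
    have hpos := sub_sq_pos hm (E.normAngleInv m t)
    have hDp := E.speedSq_pos (E.normAngleInv m t)
    have hsq := E.sqrt_speedSq_pos (E.normAngleInv m t)
    have hr : ContDiffAt ℝ ∞ (fun q : ℝ × ℝ => √(E.speedSq (E.normAngleInv q.2 q.1) - q.2 ^ 2) /
        √(E.speedSq (E.normAngleInv q.2 q.1))) (t, m) :=
      ((hD.sub (contDiffAt_snd.pow 2)).sqrt hpos.ne').div (hD.sqrt hDp.ne') hsq.ne'
    refine ContDiffAt.comp (g := Real.arccos) (t, m) (Real.contDiffAt_arccos ?_ ?_) hr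
    · exact (lt_trans (by norm_num) (div_pos (Real.sqrt_pos.2 hpos) hsq)).ne'
    · refine ((div_lt_one hsq).2 (Real.sqrt_lt_sqrt hpos.le ?_)).ne
      nlinarith

theorem rotCurve_snd_lt (hm : m ^ 2 < E.b ^ 2) (t : ℝ) :
    ((E.rotCurve m t).2 : ℝ) < Real.pi / 2 := by
  rw [rotCurve, phasePt_snd, Real.arccos_lt_pi_div_two]
  exact div_pos (Real.sqrt_pos.2 (sub_sq_pos hm _)) (E.sqrt_speedSq_pos _)

/-! ### Arguments of points of the phase cylinder -/

/-- A choice of the parameter `φ` of the foot point. -/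
noncomputable def angleParam (p : E.Phase) : ℝ := (exists_param p).choose

theorem param_angleParam (p : E.Phase) : p = E.param (angleParam p, p.2) :=
  (exists_param p).choose_spec

theorem param_fst_eq {φ φ' θ θ' : ℝ} (h : (E.param (φ, θ)).1 = (E.param (φ', θ')).1) :
    ∃ k : ℤ, φ = φ' + k * (2 * Real.pi) := by
  have ha := E.a_pos.ne'
  have hb := E.b_pos.ne'
  have h0 := congrFun (congrArg (fun x : E.curve => WithLp.ofLp (x : Plane)) h) 0
  have h1 := congrFun (congrArg (fun x : E.curve => WithLp.ofLp (x : Plane)) h) 1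
  simp [param, ha, hb] at h0 h1
  obtain ⟨k, hk⟩ := Real.Angle.angle_eq_iff_two_pi_dvd_sub.1 (Real.Angle.cos_sin_inj h0 h1)
  exact ⟨k, by linarith⟩

/-- The parameter of the foot point can be chosen continuously near a given point. -/
theorem exists_section {p₀ : E.Phase} {φ₀ : ℝ} (h₀ : p₀ = E.param (φ₀, p₀.2)) :
    ∃ s : E.Phase → ℝ, s p₀ = φ₀ ∧ ContinuousAt s p₀ ∧ ∀ p, p = E.param (s p, p.2) := by
  have ha := E.a_pos.ne'
  have hb := E.b_pos.ne'
  let z : E.Phase → ℂ := fun p => ⟨p.1.1 0 / E.a, p.1.1 1 / E.b⟩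
  let u : E.Phase → ℂ := fun p => z p * Complex.exp (-(φ₀ * Complex.I))
  have hz : ∀ φ θ, z (E.param (φ, θ)) = Complex.exp (φ * Complex.I) := fun φ θ => by
    apply Complex.ext <;>
      simp [z, param, ha, hb, Complex.exp_ofReal_mul_I_re, Complex.exp_ofReal_mul_I_im]
  have hu₀ : u p₀ = 1 := by
    have := hz φ₀ p₀.2
    rw [← h₀] at this
    simp only [u]
    rw [this, ← Complex.exp_add, add_neg_cancel, Complex.exp_zero]
  have huc : Continuous u := by
    have : Continuous z := by
      have e : z = fun p : E.Phase => ((p.1.1 0 / E.a : ℝ) : ℂ) +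
          ((p.1.1 1 / E.b : ℝ) : ℂ) * Complex.I := by
        ext p; exact Complex.mk_eq_add_mul_I _ _
      rw [e]; fun_prop
    exact this.mul continuous_const
  refine ⟨fun p => φ₀ + Complex.arg (u p), by simp [hu₀],
    continuousAt_const.add (ContinuousAt.comp (g := Complex.arg) (f := u)
      (Complex.continuousAt_arg (by rw [hu₀]; exact Complex.one_mem_slitPlane))
      huc.continuousAt), fun p => ?_⟩
  obtain ⟨φ, hp⟩ := exists_param p
  have hzp : z p = Complex.exp (φ * Complex.I) := by
    have := hz φ p.2
    rwa [← hp] at this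
  have hnorm : ‖u p‖ = 1 := by
    simp only [u]
    rw [hzp, ← neg_mul, ← Complex.ofReal_neg, norm_mul, Complex.norm_exp_ofReal_mul_I,
      Complex.norm_exp_ofReal_mul_I, one_mul]
  have harg : Complex.exp ((Complex.arg (u p) : ℂ) * Complex.I) = u p := by
    have := Complex.norm_mul_exp_arg_mul_I (u p)
    rwa [hnorm, Complex.ofReal_one, one_mul] at this
  have hfin : Complex.exp (((φ₀ + Complex.arg (u p) : ℝ) : ℂ) * Complex.I) =
      Complex.exp (φ * Complex.I) := by
    rw [Complex.ofReal_add, add_mul, Complex.exp_add, harg]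
    simp only [u]
    rw [hzp, mul_left_comm, ← Complex.exp_add, add_neg_cancel, Complex.exp_zero, mul_one]
  have hc := congrArg Complex.re hfin
  have hs := congrArg Complex.im hfin
  rw [Complex.exp_ofReal_mul_I_re, Complex.exp_ofReal_mul_I_re] at hc
  rw [Complex.exp_ofReal_mul_I_im, Complex.exp_ofReal_mul_I_im] at hs
  rw [param_eq_phasePt _ p.2.2]
  conv_lhs => rw [hp, param_eq_phasePt _ p.2.2]
  have hD : E.speedSq (φ₀ + Complex.arg (u p)) = E.speedSq φ := by rw [speedSq, hs, speedSq]
  change _ = E.phasePt (φ₀ + Complex.arg (u p))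
    (√(E.speedSq (φ₀ + Complex.arg (u p))) * Real.cos p.2)
  rw [hD, phasePt_congr hc hs]

/-! ### Matching the levels by their rotation numbers -/

/-- A smooth change of the level parameter, defined near `0`, which preserves the rotation
number. -/
structure IsLevelMap (E E' : Ellipse) (M : OpenPartialHomeomorph ℝ ℝ) : Prop where
  zero_mem : 0 ∈ M.source
  map_zero : M 0 = 0
  sq_lt : ∀ m ∈ M.source, m ^ 2 < E.b ^ 2
  sq_lt' : ∀ m ∈ M.target, m ^ 2 < E'.b ^ 2
  pos_iff : ∀ m ∈ M.source, 0 < M m ↔ 0 < m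
  rotNum_eq : ∀ m ∈ M.source, E'.rotNum (M m) = E.rotNum m
  contDiffAt : ∀ m ∈ M.source, ContDiffAt ℝ ∞ M m
  contDiffAt_symm : ∀ m ∈ M.target, ContDiffAt ℝ ∞ M.symm m

theorem IsLevelMap.symm {M : OpenPartialHomeomorph ℝ ℝ} (hM : IsLevelMap E E' M) :
    IsLevelMap E' E M.symm where
  zero_mem := by
    have := M.map_source hM.zero_mem
    rwa [hM.map_zero] at this
  map_zero := by
    have := M.left_inv hM.zero_mem
    rwa [hM.map_zero] at this
  sq_lt := hM.sq_lt'
  sq_lt' := hM.sq_lt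
  pos_iff := fun m hm => by
    rw [← hM.pos_iff _ (M.map_target hm), M.right_inv hm]
  rotNum_eq := fun m hm => by
    rw [← hM.rotNum_eq _ (M.map_target hm), M.right_inv hm]
  contDiffAt := hM.contDiffAt_symm
  contDiffAt_symm := hM.contDiffAt

theorem IsLevelMap.nonneg {M : OpenPartialHomeomorph ℝ ℝ} (hM : IsLevelMap E E' M)
    (hm : m ∈ M.source) (h : 0 ≤ m) : 0 ≤ M m := by
  rcases h.eq_or_lt with rfl | h
  · rw [hM.map_zero]
  · exact ((hM.pos_iff m hm).2 h).le

variable (E E') in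
/-- By the twist condition the rotation number is a coordinate on the levels near `0` for both
ellipses; comparing the two coordinates gives the change of level. -/
theorem exists_isLevelMap : ∃ M : OpenPartialHomeomorph ℝ ℝ, IsLevelMap E E' M := by
  obtain ⟨P, hP, hP0, hPb, hPm, hPs⟩ := exists_rotNum_chart (E := E)
  obtain ⟨Q, hQ, hQ0, hQb, hQm, hQs⟩ := exists_rotNum_chart (E := E')
  have hP00 : P 0 = 0 := by rw [hP, rotNum_zero]
  have hQ00 : Q 0 = 0 := by rw [hQ, rotNum_zero]
  have hQt : (0 : ℝ) ∈ Q.target := by simpa [hQ00] using Q.map_source hQ0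
  have hQ0' : Q.symm 0 = 0 := by simpa [hQ00] using Q.left_inv hQ0
  have hsrc : ∀ m ∈ (P.trans Q.symm).source, m ∈ P.source ∧ P m ∈ Q.target := fun m hm => by
    rwa [OpenPartialHomeomorph.trans_source] at hm
  have htgt : ∀ m ∈ (P.trans Q.symm).target, m ∈ Q.source ∧ Q m ∈ P.target := fun m hm => by
    rwa [OpenPartialHomeomorph.trans_target] at hm
  have hrot : ∀ m ∈ (P.trans Q.symm).source, E'.rotNum (Q.symm (P m)) = E.rotNum m :=
    fun m hm => by rw [← hQ, ← hP, Q.right_inv (hsrc m hm).2]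
  refine ⟨P.trans Q.symm, ?_, ?_, fun m hm => hPb m (hsrc m hm).1,
    fun m hm => hQb m (htgt m hm).1, fun m hm => ?_, hrot, fun m hm => ?_, fun m hm => ?_⟩
  · rw [OpenPartialHomeomorph.trans_source]
    exact ⟨hP0, by rw [Set.mem_preimage, hP00]; exact hQt⟩
  · change Q.symm (P 0) = 0
    rw [hP00, hQ0']
  · have h1 := hPm.lt_iff_lt hP0 (hsrc m hm).1
    have h2 := hQm.lt_iff_lt hQ0 (Q.map_target (hsrc m hm).2)
    rw [rotNum_zero] at h1 h2
    rw [hrot m hm, h1] at h2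
    exact h2.symm
  · refine ContDiffAt.comp (g := Q.symm) (f := P) m (hQs _ (hsrc m hm).2) ?_
    rw [hP]; exact contDiffAt_rotNum (hPb m (hsrc m hm).1)
  · refine ContDiffAt.comp (g := P.symm) (f := Q) m (hPs _ (htgt m hm).2) ?_
    rw [hQ]; exact contDiffAt_rotNum (hQb m (htgt m hm).1)

end Ellipse

namespace Ellipse

variable {E E' : Ellipse} {m : ℝ} {M : OpenPartialHomeomorph ℝ ℝ}

/-! ### The conjugacy near the boundary -/

variable (E E' M) in
/-- The shift of the angle coordinate, on the level `m`, by which the conjugacy takes the special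
points to the special points. -/
noncomputable def angleShift (m : ℝ) : ℝ := E'.baseAngle (M m) - E.baseAngle m

variable (E E' M) in
/-- The conjugacy: on each level it is the translation in the angle coordinates that takes the
special points to the special points. -/
noncomputable def conjMap (p : E.Phase) : E'.Phase :=
  E'.rotCurve (M (level p)) (E.normAngle (level p) (angleParam p) + angleShift E E' M (level p))

variable (E) in
/-- The points of the phase cylinder on the levels in `S` with angle `θ < π / 2`. -/
def levelDomain (S : Set ℝ) : Set E.Phase := {p | (p.2 : ℝ) < Real.pi / 2 ∧ level p ∈ S}

theorem isOpen_levelDomain {S : Set ℝ} (hS : IsOpen S) : IsOpen (E.levelDomain S) :=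
  (isOpen_lt (f := fun p : E.Phase => (p.2 : ℝ)) (by fun_prop) continuous_const).inter
    (hS.preimage continuous_level)

theorem exists_strip_subset {S : Set ℝ} (hS : IsOpen S) (h0 : 0 ∈ S) :
    ∃ τ > 0, E.strip τ ⊆ E.levelDomain S := by
  have ha := E.a_pos
  obtain ⟨ε, hε, hball⟩ := Metric.isOpen_iff.1 hS 0 h0
  refine ⟨min (Real.pi / 2) (ε / E.a), lt_min (by positivity) (by positivity), fun p hp => ?_⟩
  have hp' : (p.2 : ℝ) < min (Real.pi / 2) (ε / E.a) := hp
  obtain ⟨h1, h2⟩ := lt_min_iff.1 hp'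
  refine ⟨h1, hball ?_⟩
  rw [mem_ball_zero_iff, Real.norm_of_nonneg (level_nonneg p)]
  obtain ⟨φ, h⟩ := exists_param p
  have hD : √(E.speedSq φ) ≤ E.a := (Real.sqrt_le_left ha.le).2 (E.speedSq_le_a_sq φ)
  rw [h, level_param φ p.2.2]
  calc Real.sin p.2 * √(E.speedSq φ) ≤ p.2 * E.a :=
        mul_le_mul (Real.sin_le p.2.2.1) hD (Real.sqrt_nonneg _) p.2.2.1
    _ < ε := (lt_div_iff₀ ha).1 h2

theorem levelDomain_subset_strip (S : Set ℝ) : E.levelDomain S ⊆ E.strip Real.pi := fun p hp => by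
  have h : (p.2 : ℝ) < Real.pi / 2 := hp.1
  change (p.2 : ℝ) < Real.pi
  linarith [Real.pi_pos]

/-- The conjugacy does not depend on the choice of the parameter of the foot point. -/
theorem conjMap_eq (hM : IsLevelMap E E' M) {p : E.Phase} (hp : level p ∈ M.source) {φ θ : ℝ}
    (h : p = E.param (φ, θ)) : conjMap E E' M p =
      E'.rotCurve (M (level p)) (E.normAngle (level p) φ + angleShift E E' M (level p)) := by
  obtain ⟨k, hk⟩ := param_fst_eq (congrArg Prod.fst ((param_angleParam p).symm.trans h))
  rw [conjMap, hk, normAngle_add_int_mul_two_pi (hM.sq_lt _ hp), add_right_comm]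
  have := (rotCurve_periodic (E := E') (hM.sq_lt' _ (M.map_source hp))).int_mul k
  rw [mul_one] at this
  exact this _

theorem conjMap_rotCurve (hM : IsLevelMap E E' M) (hm : m ∈ M.source) (h0 : 0 ≤ m) (t : ℝ) :
    conjMap E E' M (E.rotCurve m t) = E'.rotCurve (M m) (t + angleShift E E' M m) := by
  have hl := level_rotCurve h0 (hM.sq_lt m hm) t
  have h := conjMap_eq hM (p := E.rotCurve m t) (by rwa [hl]) (φ := E.normAngleInv m t) rfl
  rwa [hl, normAngle_normAngleInv (hM.sq_lt m hm)] at h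

/-- The level domains are the unions of the invariant curves. -/
theorem mem_levelDomain_iff {S : Set ℝ} (hS : ∀ m ∈ S, m ^ 2 < E.b ^ 2) {p : E.Phase} :
    p ∈ E.levelDomain S ↔ ∃ m ∈ S, 0 ≤ m ∧ ∃ t, p = E.rotCurve m t := by
  constructor
  · intro hp
    obtain ⟨t, ht⟩ := exists_rotCurve (hS _ hp.2) hp.1.le
    exact ⟨level p, hp.2, level_nonneg p, t, ht⟩
  · rintro ⟨m, hm, h0, t, rfl⟩
    refine ⟨rotCurve_snd_lt (hS m hm) t, ?_⟩
    rwa [level_rotCurve h0 (hS m hm)]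

theorem conjMap_mem (hM : IsLevelMap E E' M) {p : E.Phase} (hp : p ∈ E.levelDomain M.source) :
    conjMap E E' M p ∈ E'.levelDomain M.target := by
  obtain ⟨m, hm, h0, t, rfl⟩ := (mem_levelDomain_iff hM.sq_lt).1 hp
  rw [conjMap_rotCurve hM hm h0]
  exact (mem_levelDomain_iff hM.sq_lt').2 ⟨M m, M.map_source hm, hM.nonneg hm h0, _, rfl⟩

theorem conjMap_symm_conjMap (hM : IsLevelMap E E' M) {p : E.Phase}
    (hp : p ∈ E.levelDomain M.source) : conjMap E' E M.symm (conjMap E E' M p) = p := by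
  obtain ⟨m, hm, h0, t, rfl⟩ := (mem_levelDomain_iff hM.sq_lt).1 hp
  rw [conjMap_rotCurve hM hm h0, conjMap_rotCurve hM.symm (M.map_source hm) (hM.nonneg hm h0)]
  simp only [angleShift, M.left_inv hm]
  congr 1; ring

theorem contDiffAt_angleShift (hM : IsLevelMap E E' M) (hm : m ∈ M.source) :
    ContDiffAt ℝ ∞ (angleShift E E' M) m := by
  have h1 : ContDiffAt ℝ ∞ (fun x => E'.baseAngle (M x)) m :=
    ContDiffAt.comp (g := fun q : ℝ × ℝ => E'.normAngle q.2 q.1)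
      (f := fun x => (E'.specialParam, M x)) m
      (contDiffAt_normAngle (hM.sq_lt' _ (M.map_source hm)))
      (contDiffAt_const.prodMk (hM.contDiffAt m hm))
  have h2 : ContDiffAt ℝ ∞ (fun x => E.baseAngle x) m :=
    ContDiffAt.comp (g := fun q : ℝ × ℝ => E.normAngle q.2 q.1)
      (f := fun x => (E.specialParam, x)) m
      (contDiffAt_normAngle (hM.sq_lt _ hm)) (contDiffAt_const.prodMk contDiffAt_id)
  exact h1.sub h2

/-- The conjugacy in terms of the parameter of the foot point and the level, with values in the
angle coordinate and the level. -/
theorem contDiffAt_conjCoord (hM : IsLevelMap E E' M) (hm : m ∈ M.source) (φ : ℝ) :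
    ContDiffAt ℝ ∞ (fun q : ℝ × ℝ => (E.normAngle q.2 q.1 + angleShift E E' M q.2, M q.2))
      (φ, m) := by
  have h1 : ContDiffAt ℝ ∞ (fun q : ℝ × ℝ => angleShift E E' M q.2) (φ, m) :=
    ContDiffAt.comp (g := angleShift E E' M) (f := Prod.snd) (φ, m)
      (contDiffAt_angleShift hM hm) contDiffAt_snd
  have h2 : ContDiffAt ℝ ∞ (fun q : ℝ × ℝ => M q.2) (φ, m) :=
    ContDiffAt.comp (g := M) (f := Prod.snd) (φ, m) (hM.contDiffAt m hm) contDiffAt_snd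
  exact ((contDiffAt_normAngle (hM.sq_lt m hm)).add h1).prodMk h2

theorem continuousAt_conjMap (hM : IsLevelMap E E' M) {p : E.Phase} (hp : level p ∈ M.source) :
    ContinuousAt (conjMap E E' M) p := by
  obtain ⟨s, -, hsc, hs⟩ := exists_section (param_angleParam p)
  have h1 : ContinuousAt (fun x => (s x, level x)) p := hsc.prodMk continuous_level.continuousAt
  have h2 : ContinuousAt (fun x => (E.normAngle (level x) (s x) + angleShift E E' M (level x),
      M (level x))) p :=
    ContinuousAt.comp (f := fun x => (s x, level x))
      (g := fun q : ℝ × ℝ => (E.normAngle q.2 q.1 + angleShift E E' M q.2, M q.2))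
      (contDiffAt_conjCoord hM hp (s p)).continuousAt h1
  have h3 : ContinuousAt (fun x => E'.rotCurve (M (level x))
      (E.normAngle (level x) (s x) + angleShift E E' M (level x))) p :=
    ContinuousAt.comp (g := fun q : ℝ × ℝ => E'.rotCurve q.2 q.1)
      (f := fun x => (E.normAngle (level x) (s x) + angleShift E E' M (level x), M (level x)))
      (continuousAt_rotCurve (hM.sq_lt' _ (M.map_source hp))) h2
  refine h3.congr ?_
  filter_upwards [continuous_level.continuousAt.preimage_mem_nhds (M.open_source.mem_nhds hp)]
    with x hx
  exact (conjMap_eq hM hx (hs x)).symm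

theorem smoothOn_conjMap (hM : IsLevelMap E E' M) {W : Set E.Phase}
    (hW : W ⊆ E.levelDomain M.source) : SmoothOn (conjMap E E' M) W := by
  have key : ContDiffOn ℝ ∞ (fun q : ℝ × ℝ =>
      (((E'.rotCurve (M (Real.sin q.2 * √(E.speedSq q.1)))
        (E.normAngle (Real.sin q.2 * √(E.speedSq q.1)) q.1 +
          angleShift E E' M (Real.sin q.2 * √(E.speedSq q.1)))).1 : Plane),
        ((E'.rotCurve (M (Real.sin q.2 * √(E.speedSq q.1)))
        (E.normAngle (Real.sin q.2 * √(E.speedSq q.1)) q.1 +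
          angleShift E E' M (Real.sin q.2 * √(E.speedSq q.1)))).2 : ℝ)))
      {q | q.2 ∈ Set.Ioo 0 Real.pi ∧ E.param q ∈ W} := by
    rintro ⟨φ, θ⟩ ⟨hθ, hq⟩
    have hl := level_param (E := E) φ ⟨hθ.1.le, hθ.2.le⟩
    have hm : Real.sin θ * √(E.speedSq φ) ∈ M.source := by
      rw [← hl]; exact (hW hq).2
    have hpos : 0 < Real.sin θ * √(E.speedSq φ) :=
      mul_pos (Real.sin_pos_of_mem_Ioo hθ) (E.sqrt_speedSq_pos φ)
    have h1 : ContDiffAt ℝ ∞ (fun q : ℝ × ℝ => (q.1, Real.sin q.2 * √(E.speedSq q.1)))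
        (φ, θ) := by
      have hD : ContDiffAt ℝ ∞ (fun q : ℝ × ℝ => E.speedSq q.1) (φ, θ) :=
        (E.contDiff_speedSq.comp contDiff_fst).contDiffAt
      exact contDiffAt_fst.prodMk (contDiffAt_snd.sin.mul (hD.sqrt (E.speedSq_pos φ).ne'))
    have h2 := ContDiffAt.comp
      (g := fun q : ℝ × ℝ => (E.normAngle q.2 q.1 + angleShift E E' M q.2, M q.2))
      (f := fun q : ℝ × ℝ => (q.1, Real.sin q.2 * √(E.speedSq q.1))) (φ, θ)
      (contDiffAt_conjCoord hM hm φ) h1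
    exact (ContDiffAt.comp (g := fun q : ℝ × ℝ => (((E'.rotCurve q.2 q.1).1 : Plane),
      ((E'.rotCurve q.2 q.1).2 : ℝ))) (φ, θ)
      (contDiffAt_rotCurve ((hM.pos_iff _ hm).2 hpos) (hM.sq_lt' _ (M.map_source hm)))
      h2).contDiffWithinAt
  refine key.congr ?_
  rintro ⟨φ, θ⟩ ⟨hθ, hq⟩
  have hl := level_param (E := E) φ ⟨hθ.1.le, hθ.2.le⟩
  have := conjMap_eq hM (p := E.param (φ, θ)) (hW hq).2 rfl
  rw [hl] at this
  simp only [this]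

/-- The conjugacy as a homeomorphism between neighbourhoods of the boundaries. -/
noncomputable def conjHomeo (hM : IsLevelMap E E' M) : OpenPartialHomeomorph E.Phase E'.Phase where
  toFun := conjMap E E' M
  invFun := conjMap E' E M.symm
  source := E.levelDomain M.source
  target := E'.levelDomain M.target
  map_source' := fun _ hp => conjMap_mem hM hp
  map_target' := fun _ hp => conjMap_mem hM.symm hp
  left_inv' := fun _ hp => conjMap_symm_conjMap hM hp
  right_inv' := fun _ hp => conjMap_symm_conjMap hM.symm hp
  open_source := isOpen_levelDomain M.open_source
  open_target := isOpen_levelDomain M.open_target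
  continuousOn_toFun := fun _ hp => (continuousAt_conjMap hM hp.2).continuousWithinAt
  continuousOn_invFun := fun _ hp => (continuousAt_conjMap hM.symm hp.2).continuousWithinAt

theorem billiard_mem_levelDomain {S : Set ℝ} (hS : ∀ m ∈ S, m ^ 2 < E.b ^ 2) {p : E.Phase}
    (hp : p ∈ E.levelDomain S) : E.billiard p ∈ E.levelDomain S := by
  obtain ⟨m, hm, h0, t, rfl⟩ := (mem_levelDomain_iff hS).1 hp
  rw [billiard_rotCurve h0 (hS m hm)]
  exact (mem_levelDomain_iff hS).2 ⟨m, hm, h0, _, rfl⟩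

theorem conjMap_billiard (hM : IsLevelMap E E' M) {p : E.Phase}
    (hp : p ∈ E.levelDomain M.source) :
    conjMap E E' M (E.billiard p) = E'.billiard (conjMap E E' M p) := by
  obtain ⟨m, hm, h0, t, rfl⟩ := (mem_levelDomain_iff hM.sq_lt).1 hp
  rw [billiard_rotCurve h0 (hM.sq_lt m hm), conjMap_rotCurve hM hm h0, conjMap_rotCurve hM hm h0,
    billiard_rotCurve (hM.nonneg hm h0) (hM.sq_lt' _ (M.map_source hm)), hM.rotNum_eq m hm,
    add_right_comm]

theorem level_conjMap_pos_iff (hM : IsLevelMap E E' M) {p : E.Phase}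
    (hp : p ∈ E.levelDomain M.source) : 0 < level (conjMap E E' M p) ↔ 0 < level p := by
  obtain ⟨m, hm, h0, t, rfl⟩ := (mem_levelDomain_iff hM.sq_lt).1 hp
  rw [conjMap_rotCurve hM hm h0, level_rotCurve (hM.nonneg hm h0) (hM.sq_lt' _ (M.map_source hm)),
    level_rotCurve h0 (hM.sq_lt m hm), hM.pos_iff m hm]

theorem conjMap_mem_puncturedPhase_iff (hM : IsLevelMap E E' M) {p : E.Phase}
    (hp : p ∈ E.levelDomain M.source) :
    conjMap E E' M p ∈ E'.puncturedPhase ↔ p ∈ E.puncturedPhase := by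
  rw [mem_puncturedPhase_iff, mem_puncturedPhase_iff, level_conjMap_pos_iff hM hp]
  obtain ⟨m, hm, h0, t, rfl⟩ := (mem_levelDomain_iff hM.sq_lt).1 hp
  rw [conjMap_rotCurve hM hm h0, rotCurve_fst_special_iff (hM.sq_lt' _ (M.map_source hm)),
    rotCurve_fst_special_iff (hM.sq_lt m hm), angleShift, add_sub_assoc, sub_sub_cancel_left,
    ← sub_eq_add_neg]

theorem angle_eq_zero_iff {p : E.Phase} (hp : p ∈ E.strip Real.pi) :
    (p.2 : ℝ) = 0 ↔ ¬ 0 < level p := by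
  rw [← mem_openPhase_iff]
  constructor
  · intro h hp'
    exact hp'.1.ne' h
  · intro h
    by_contra h0
    exact h ⟨lt_of_le_of_ne p.2.2.1 (Ne.symm h0), hp⟩

variable (E E') in
/-- The billiard maps of any two ellipses are conjugate near the boundary of the phase cylinder. -/
theorem exists_boundary_conjugacy :
    ∃ τ₁ > (0 : ℝ), ∃ τ₂ > (0 : ℝ), ∃ h : OpenPartialHomeomorph E.Phase E'.Phase,
      E.strip τ₁ ⊆ h.source ∧ h.source ⊆ E.strip Real.pi ∧
      E'.strip τ₂ ⊆ h.target ∧ h.target ⊆ E'.strip Real.pi ∧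
      (∀ p ∈ h.source, E.billiard p ∈ h.source ∧ h (E.billiard p) = E'.billiard (h p)) ∧
      (∀ p ∈ h.source, ((p.2 : ℝ) = 0 ↔ ((h p).2 : ℝ) = 0)) ∧
      (∀ p ∈ h.source, (p ∈ E.puncturedPhase ↔ h p ∈ E'.puncturedPhase)) ∧
      SmoothOn h (h.source ∩ E.puncturedPhase) ∧
      SmoothOn h.symm (h.target ∩ E'.puncturedPhase) := by
  obtain ⟨M, hM⟩ := exists_isLevelMap E E'
  obtain ⟨τ₁, h1, hτ₁⟩ := exists_strip_subset (E := E) M.open_source hM.zero_mem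
  obtain ⟨τ₂, h2, hτ₂⟩ := exists_strip_subset (E := E') M.open_target hM.symm.zero_mem
  refine ⟨τ₁, h1, τ₂, h2, conjHomeo hM, hτ₁, levelDomain_subset_strip _, hτ₂,
    levelDomain_subset_strip _, fun p hp => ⟨billiard_mem_levelDomain hM.sq_lt hp,
      conjMap_billiard hM hp⟩, fun p hp => ?_,
    fun p hp => (conjMap_mem_puncturedPhase_iff hM hp).symm,
    smoothOn_conjMap hM Set.inter_subset_left, smoothOn_conjMap hM.symm Set.inter_subset_left⟩
  rw [angle_eq_zero_iff (levelDomain_subset_strip _ hp),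
    angle_eq_zero_iff (levelDomain_subset_strip _ ((conjHomeo hM).map_source hp))]
  exact not_congr (level_conjMap_pos_iff hM hp).symm

end Ellipse

theorem mainTheorem2 (E₁ E₂ : Ellipse) :
    -- (i): one homeomorphism between forward invariant neighbourhoods of the boundaries `θ = 0`
    (∃ τ₁ > (0 : ℝ), ∃ τ₂ > (0 : ℝ), ∃ h : OpenPartialHomeomorph E₁.Phase E₂.Phase,
      E₁.strip τ₁ ⊆ h.source ∧ h.source ⊆ E₁.strip Real.pi ∧
      E₂.strip τ₂ ⊆ h.target ∧ h.target ⊆ E₂.strip Real.pi ∧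
      (∀ p ∈ h.source, E₁.billiard p ∈ h.source ∧ h (E₁.billiard p) = E₂.billiard (h p)) ∧
      (∀ p ∈ h.source, ((p.2 : ℝ) = 0 ↔ ((h p).2 : ℝ) = 0)) ∧
      -- which restricts to a smooth diffeomorphism between the punctured neighbourhoods
      (∀ p ∈ h.source, (p ∈ E₁.puncturedPhase ↔ h p ∈ E₂.puncturedPhase)) ∧
      Ellipse.SmoothOn h (h.source ∩ E₁.puncturedPhase) ∧
      Ellipse.SmoothOn h.symm (h.target ∩ E₂.puncturedPhase)) ∧
    -- (ii): a global homeomorphism of the open phase cylinders conjugating the billiard maps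
    ((∃ h : OpenPartialHomeomorph E₁.Phase E₂.Phase,
      h.source = E₁.openPhase ∧ h.target = E₂.openPhase ∧
      ∀ p ∈ E₁.openPhase, h (E₁.billiard p) = E₂.billiard (h p)) →
      Ellipse.Similar E₁ E₂ ∧ E₁.ecc = E₂.ecc) := by
  refine ⟨Ellipse.exists_boundary_conjugacy E₁ E₂, ?_⟩
  rintro ⟨h, hs, ht, hc⟩
  have hr := Ellipse.ratio_eq_of_conj hs ht hc
  exact ⟨Ellipse.similar_of_ratio_eq hr, by rw [Ellipse.ecc, Ellipse.ecc, hr]⟩
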